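/- Let $K$ be a perfect field, let $E/K$ be an elliptic curve given by a Weierstrass equation with coordinate functions $x,y$ and origin $O$, and let $P\in E(K)$. For $m\in\mathbb{Z}$ let $\psi_m$ be the $m$-th division polynomial of $E$, so that $\psi_m^2\in K[x]$, and let $\theta_m=x\psi_m^2-\psi_{m+1}\psi_{m-1}\in K[x]$, so that $x\circ[m]=\theta_m/\psi_m^2$ for $m\neq 0$. Put $\delta_m^P=\theta_m-x(P)\psi_m^2\in K[x]$ if $P\ne O$, and $\delta_m^P=\psi_m^2$ if $P=O$. We say that $\delta_m^P$ factorizes over $K$ if it is the product of two nonconstant polynomials in $K[x]$. The point $P$ is called magnified if there are a finite extension $L/K$, an elliptic curve $E'/L$, a (nonzero) isogeny $\phi:E'\to E$ defined over $L$, and a point $R\in E'(L)$ with $\phi(R)=P$, such that $[L:K]<\deg\phi$. Then $P$ is magnified if and only if there is an integer $m$ such that $\delta_m^P$ factorizes over $K$. -/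

import Mathlib

open Polynomial
open scoped Polynomial.Bivariate

universe u

namespace EllipticMagnified

open WeierstrassCurve

noncomputable section

/-- `HasValueAt W P f c` : the rational function `f ∈ F(W)` is regular at the `F`-rational point `P`
of the projective curve `W`, and `f(P) = c`.

At an affine point `(x, y)` this says that `f = p / q` for polynomials `p`, `q` in the coordinate
functions with `q(x, y) ≠ 0` and `p(x, y) / q(x, y) = c`.

At the point at infinity we use that a nonzero element `a` of the coordinate ring `F[W]` has a pole
at infinity of order the degree (in `X`) of its norm to `F[X]` (for instance `X` has norm `X ^ 2`,
and `Y` has a norm of degree `3`): `f = a / b` has value `c` at infinity when `f - c = (a - c b) / b`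
vanishes there, that is, when `a - c b` has a pole of strictly smaller order than `b`
(or `a - c b = 0`, the degree of `0` being `⊥`). -/
def HasValueAt {F : Type u} [Field F] (W : WeierstrassCurve F) :
    W.toAffine.Point → W.toAffine.FunctionField → F → Prop
  | .zero, f, c => ∃ a b : W.toAffine.CoordinateRing, b ≠ 0 ∧
      f = algebraMap W.toAffine.CoordinateRing W.toAffine.FunctionField a /
        algebraMap W.toAffine.CoordinateRing W.toAffine.FunctionField b ∧
      (Algebra.norm F[X] (a - algebraMap F W.toAffine.CoordinateRing c * b)).degree <
        (Algebra.norm F[X] b).degree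
  | .some x y _, f, c => ∃ p q : F[X][Y], q.evalEval x y ≠ 0 ∧
      f = algebraMap W.toAffine.CoordinateRing W.toAffine.FunctionField
            (Affine.CoordinateRing.mk W.toAffine p) /
        algebraMap W.toAffine.CoordinateRing W.toAffine.FunctionField
            (Affine.CoordinateRing.mk W.toAffine q) ∧
      p.evalEval x y / q.evalEval x y = c

/-- Let `g = φ^* : F(W₂) → F(W₁)` be the pullback of functions along a nonconstant morphism
`φ : W₁ → W₂` of curves over `F`. `Sends g R P` says that `φ(R) = P`: every function `f` that is
regular at `P` has a pullback `f ∘ φ` that is regular at `R`, with `(f ∘ φ)(R) = f(P)`. -/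
def Sends {F : Type u} [Field F] {W₁ W₂ : WeierstrassCurve F}
    (g : W₂.toAffine.FunctionField →ₐ[F] W₁.toAffine.FunctionField)
    (R : W₁.toAffine.Point) (P : W₂.toAffine.Point) : Prop :=
  ∀ (f : W₂.toAffine.FunctionField) (c : F), HasValueAt W₂ P f c → HasValueAt W₁ R (g f) c

/-- A (nonzero) isogeny `W₁ → W₂` defined over `F`: a nonconstant morphism of curves over `F` that
sends the origin to the origin. Nonconstant morphisms of smooth projective curves over `F` are
given by `F`-algebra homomorphisms of the function fields in the other direction. -/
structure Isogeny {F : Type u} [Field F] (W₁ W₂ : WeierstrassCurve F) where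
  /-- The pullback of functions `φ^* : F(W₂) → F(W₁)`. -/
  pullback : W₂.toAffine.FunctionField →ₐ[F] W₁.toAffine.FunctionField
  /-- The isogeny sends the origin to the origin. -/
  sends_zero : Sends pullback .zero .zero

/-- The degree `[F(W₁) : φ^* F(W₂)]` of an isogeny. -/
def Isogeny.degree {F : Type u} [Field F] {W₁ W₂ : WeierstrassCurve F} (φ : Isogeny W₁ W₂) : ℕ :=
  Module.finrank φ.pullback.fieldRange W₁.toAffine.FunctionField

/-- The point of `E(L)` given by `P ∈ E(K)`, for a field extension `L / K`. -/
def pointBaseChange {K : Type u} [Field K] (E : WeierstrassCurve K) (L : Type u) [Field L]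
    [Algebra K L] : E.toAffine.Point → (E.baseChange L).toAffine.Point
  | .zero => .zero
  | .some x y h => .some (algebraMap K L x) (algebraMap K L y)
      ((Affine.map_nonsingular E.toAffine (algebraMap K L).injective x y).mpr h)

/-- `P ∈ E(K)` is magnified: there are a finite extension `L / K`, an elliptic curve `E'` over `L`,
an isogeny `φ : E' → E` over `L` and a point `R ∈ E'(L)` with `φ(R) = P`, such that
`[L : K] < deg φ`. -/
def IsMagnified {K : Type u} [Field K] (E : WeierstrassCurve K) (P : E.toAffine.Point) : Prop :=
  ∃ (L : Type u) (_ : Field L) (_ : Algebra K L) (_ : FiniteDimensional K L)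
    (E' : WeierstrassCurve L) (_ : E'.IsElliptic) (φ : Isogeny E' (E.baseChange L))
    (R : E'.toAffine.Point),
    Sends φ.pullback R (pointBaseChange E L P) ∧
      Module.finrank K L < φ.degree

/-- The polynomial `δ_m^P`, which is `θ_m - x(P) ψ_m ^ 2` if `P ≠ O`, and `ψ_m ^ 2` if `P = O`.
Here `ψ_m ^ 2` and `θ_m` are `E.ΨSq m` and `E.Φ m`, as polynomials in `K[X]`. -/
def delta {K : Type u} [Field K] (E : WeierstrassCurve K) (m : ℤ) : E.toAffine.Point → K[X]
  | .zero => E.ΨSq m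
  | .some x _ _ => E.Φ m - C x * E.ΨSq m

/-- A polynomial factorizes over `K` if it is the product of two nonconstant polynomials over `K`. -/
def Factorizes {K : Type u} [Field K] (f : K[X]) : Prop :=
  ∃ g h : K[X], 0 < g.natDegree ∧ 0 < h.natDegree ∧ f = g * h

end

end EllipticMagnified

/-! Suppose δ_m^P = g·h and 2P ≠ O. A root s of g is the x-coordinate of a point Q with mQ = P. A
conjugation fixing s sends Q to Q or to -Q, and -Q would give P = -P; hence Q is defined over K(s),
and [K(s) : K] ≤ deg g < m² = deg [m] (`isMagnified_of_factorizes`). If 2P = O, then 3P = P, so [3]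
magnifies P over K itself. The same equation makes x(P) a root of δ_3^P when P ≠ O, while for P = O
the polynomial ψ_m² with m = 3 or 5 is a square in K[x].

Conversely let φ : E' → E have degree N > [L : K] and φ(R) = P, with 2P ≠ O. In characteristic 0
take m = N (`factorizes_of_sends`). Choose A with N·A = R over an algebraic closure and put B =
φ(A), so that N·B = P and x(B) is a root of δ_N^P. The conjugates of B over L lie in the image under
φ of the at most N² points A' with N·A' = R. This set is stable under ker φ, a group of order N, so
the image has at most N elements. Hence x(B) has degree at most [L : K]·N < N² = deg δ_N^P over K,
and its minimal polynomial is a proper factor. In characteristic p take m = p: since [p]^*ω = pω =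
0, the numerator and the denominator of x∘[p] have zero derivative, so δ_p^P is a p-th power over
the perfect field K (`factorizes_delta_char`).

Two bodies of theory support this. The first is that x(nP) = Φ_n/ΨSq_n with coprime numerator and
denominator. The identities behind it are proved at the generic point in characteristic 0, where the
logarithmic derivative shows that the generic point has infinite order
(`divisionIdentities_of_charZero`), and then carried to every ring through the universal curve. They
give coprimality (`isCoprime_Φ_ΨSq`), multiples of arbitrary points (`hasXRatio_nsmul`), and [m] as
an isogeny of degree m² (`exists_isogeny_nsmul`).

The second turns an isogeny, given only as an embedding of function fields, into a homomorphism of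
points with kernel of order N, compatible with Galois action. View the isogeny as a point X over the
function field. The pullback of the invariant differential along X is a constant multiple of the
invariant differential (`exists_logDer_eq_smul`), so translating X by A changes it by a constant
point, and that point is the image of A (`pointHom`). The kernel is counted by embeddings of
function fields (`natCard_ker_pointHom`). -/

namespace EllipticMagnified

open WeierstrassCurve

noncomputable section

/-! ### The addition law and the invariant differential -/

section AdditionLaw

variable {F : Type*} [Field F] (W : WeierstrassCurve F)

/-- The partial derivative `2y + a₁x + a₃` of the Weierstrass equation with respect to `y`. -/
def dY (x y : F) : F := 2 * y + W.a₁ * x + W.a₃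

/-- Minus the partial derivative of the Weierstrass equation with respect to `x`. -/
def dX (x y : F) : F := 3 * x ^ 2 + 2 * W.a₂ * x + W.a₄ - W.a₁ * y

variable {W}

lemma dY_ne_zero_or_dX_ne_zero {x y : F} (h : W.toAffine.Nonsingular x y) :
    dY W x y ≠ 0 ∨ dX W x y ≠ 0 := by
  rw [Affine.nonsingular_iff'] at h
  rcases h.2 with h | h
  · right
    contrapose! h
    simp only [dX] at h
    linear_combination -h
  · left
    simpa only [dY] using h

lemma sub_negY_eq_dY (x y : F) : y - W.toAffine.negY x y = dY W x y := by
  simp only [Affine.negY, dY]; ring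

lemma dY_negY (x y : F) : dY W x (W.toAffine.negY x y) = - dY W x y := by
  simp only [Affine.negY, dY]; ring

lemma equation_eq {x y : F} (h : W.toAffine.Equation x y) :
    y ^ 2 + W.a₁ * x * y + W.a₃ * y = x ^ 3 + W.a₂ * x ^ 2 + W.a₄ * x + W.a₆ :=
  (Affine.equation_iff _ _).mp h

variable [DecidableEq F]

/-- The coordinates of a sum, with the slope of the line as a parameter. -/
lemma exists_add_eq {x₁ y₁ x₂ y₂ : F} (h₁ : W.toAffine.Nonsingular x₁ y₁)
    (h₂ : W.toAffine.Nonsingular x₂ y₂) (hxy : ¬(x₁ = x₂ ∧ y₁ = W.toAffine.negY x₂ y₂)) :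
    ∃ (l x₃ y₃ : F) (h₃ : W.toAffine.Nonsingular x₃ y₃),
      Affine.Point.some x₁ y₁ h₁ + Affine.Point.some x₂ y₂ h₂ = Affine.Point.some x₃ y₃ h₃ ∧
      x₃ = l ^ 2 + W.a₁ * l - W.a₂ - x₁ - x₂ ∧
      y₃ = -(l * (x₃ - x₁) + y₁) - W.a₁ * x₃ - W.a₃ ∧
      y₁ - y₂ = l * (x₁ - x₂) ∧ (x₁ = x₂ → y₁ = y₂ ∧ dY W x₁ y₁ ≠ 0 ∧
        l * dY W x₁ y₁ = dX W x₁ y₁) ∧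
      dX W x₁ y₁ - l * dY W x₁ y₁ = (x₁ - x₂) * (x₁ - x₃) ∧
      dX W x₂ y₂ - l * dY W x₂ y₂ = (x₂ - x₁) * (x₂ - x₃) := by
  have e₁ := equation_eq h₁.1
  have e₂ := equation_eq h₂.1
  refine ⟨W.toAffine.slope x₁ x₂ y₁ y₂, _, _, _, Affine.Point.add_some hxy, ?_⟩
  set l := W.toAffine.slope x₁ x₂ y₁ y₂ with hl
  refine ⟨rfl, rfl, ?_⟩
  by_cases hx : x₁ = x₂
  · have hy : y₁ ≠ W.toAffine.negY x₂ y₂ := fun h => hxy ⟨hx, h⟩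
    have hyy := Affine.Y_eq_of_Y_ne h₁.1 h₂.1 hx hy
    subst hx hyy
    have hd : dY W x₁ y₁ ≠ 0 := by rw [← sub_negY_eq_dY]; exact sub_ne_zero.mpr hy
    have hl' : l * dY W x₁ y₁ = dX W x₁ y₁ := by
      rw [hl, Affine.slope_of_Y_ne rfl hy, sub_negY_eq_dY, div_mul_cancel₀ _ hd]; rfl
    refine ⟨by ring, fun _ => ⟨rfl, hd, hl'⟩, by rw [hl']; ring, by rw [hl']; ring⟩
  · have hs : x₁ - x₂ ≠ 0 := sub_ne_zero.mpr hx
    have hl' : y₁ - y₂ = l * (x₁ - x₂) := by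
      rw [hl, Affine.slope_of_X_ne hx, div_mul_cancel₀ _ hs]
    -- On the line of slope l the Weierstrass equation becomes (X - x₁)(X - x₂)(X - x₃) = 0; both
    -- relations are the derivative of this cubic, taken at x₁ and at x₂.
    refine ⟨hl', fun h => absurd h hx, ?_, ?_⟩ <;>
    · clear hl
      clear_value l
      apply mul_left_cancel₀ hs
      obtain rfl : y₁ = y₂ + l * (x₁ - x₂) := by linear_combination hl'
      simp only [dX, dY, Affine.addX]
      first
      | linear_combination e₁ - e₂
      | linear_combination e₂ - e₁

end AdditionLaw

section LogDerivative

variable {k F V : Type*} [Field k] [Field F] [Algebra k F] [AddCommGroup V] [Module k V]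
  [Module F V] (d : Derivation k F V) (W : WeierstrassCurve F)

/-- The value `dx / (2y + a₁x + a₃)` of the invariant differential at a point. -/
def logDer : W.toAffine.Point → V
  | .zero => 0
  | .some x y _ => (dY W x y)⁻¹ • d x

/-- The coefficients of `W` are constants of the derivation `d`. -/
def ConstCoeffs : Prop :=
  d W.a₁ = 0 ∧ d W.a₂ = 0 ∧ d W.a₃ = 0 ∧ d W.a₄ = 0 ∧ d W.a₆ = 0

variable {d W}

lemma dY_smul_deriv_eq (hd : ConstCoeffs d W) {x y : F} (h : W.toAffine.Equation x y) :
    dY W x y • d y = dX W x y • d x := by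
  obtain ⟨h1, h2, h3, h4, h6⟩ := hd
  have e := congrArg d (equation_eq h)
  simp only [map_add, Derivation.leibniz, Derivation.leibniz_pow, h1, h2, h3, h4, h6, smul_zero,
    add_zero, ← Nat.cast_smul_eq_nsmul F, smul_smul] at e
  simp only [dY, dX]
  rw [← sub_eq_zero] at e ⊢
  convert! e using 1
  push_cast
  module

/-- Away from 2-torsion this is the definition together with the differentiated Weierstrass
equation. At a point with dY = 0 the inverse makes `logDer` equal to 0, and the formulas persist: dX
≠ 0 forces d x = 0, and differentiating 2y + a₁x + a₃ = 0 gives 2 d y = 0. -/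
lemma deriv_eq_smul_logDer (h2 : (2 : F) ≠ 0) (hd : ConstCoeffs d W) {x y : F}
    (h : W.toAffine.Nonsingular x y) :
    d x = dY W x y • logDer d W (.some x y h) ∧ d y = dX W x y • logDer d W (.some x y h) := by
  have e := dY_smul_deriv_eq hd h.1
  simp only [logDer]
  by_cases hy : dY W x y = 0
  · have hx := (dY_ne_zero_or_dX_ne_zero h).resolve_left (not_not.mpr hy)
    rw [hy, zero_smul] at e
    have hdx : d x = 0 := (smul_eq_zero.mp e.symm).resolve_left hx
    have : d (dY W x y) = 0 := by rw [hy, map_zero]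
    obtain ⟨h1, -, h3, -, -⟩ := hd
    simp only [dY, map_add, Derivation.leibniz, h1, h3, hdx, smul_zero, add_zero] at this
    rw [show (2 : F) = ((2 : ℕ) : F) by norm_num, Derivation.map_natCast, smul_zero, add_zero]
      at this
    have hdy : d y = 0 := (smul_eq_zero.mp this).resolve_left (by exact_mod_cast h2)
    simp [hdx, hdy]
  · refine ⟨by rw [smul_inv_smul₀ hy], ?_⟩
    rw [smul_smul, mul_comm, ← smul_smul, ← e, inv_smul_smul₀ hy]

/-- Nonsingularity makes one of dY, dX invertible, so the pair of equations pins down the vector.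
This allows `logDer` to be computed without dividing by dY. -/
lemma logDer_eq_of_deriv_eq {x y : F} (h : W.toAffine.Nonsingular x y)
    (h2 : (2 : F) ≠ 0) (hd : ConstCoeffs d W) {u : V}
    (hx : d x = dY W x y • u) (hy : d y = dX W x y • u) : logDer d W (.some x y h) = u := by
  obtain ⟨ex, ey⟩ := deriv_eq_smul_logDer h2 hd h
  rcases dY_ne_zero_or_dX_ne_zero h with h' | h'
  · rw [hx] at ex
    exact (smul_right_injective V h' ex).symm
  · rw [hy] at ey
    exact (smul_right_injective V h' ey).symm

lemma logDer_neg (P : W.toAffine.Point) : logDer d W (-P) = - logDer d W P := by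
  cases P with
  | zero => change (0 : V) = -0; simp
  | some x y h =>
    rw [Affine.Point.neg_some]
    simp only [logDer]
    rw [dY_negY, inv_neg, neg_smul]

variable [DecidableEq F]

/-- This is the translation invariance of the differential, obtained by differentiating the addition
formulas. Once the derivative of the slope is known in terms of u₁ and u₂, the derivatives of x₃ and
y₃ come out as dY and dX times u₁ + u₂. -/
lemma logDer_add (h2 : (2 : F) ≠ 0) (hd : ConstCoeffs d W) (P Q : W.toAffine.Point) :
    logDer d W (P + Q) = logDer d W P + logDer d W Q := by
  match P, Q with
  | .zero, Q =>
    change logDer d W (0 + Q) = 0 + _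
    rw [zero_add, zero_add]
  | .some x y h, .zero =>
    change logDer d W (_ + 0) = _ + 0
    rw [add_zero, add_zero]
  | .some x₁ y₁ h₁, .some x₂ y₂ h₂ =>
    by_cases hxy : x₁ = x₂ ∧ y₁ = W.toAffine.negY x₂ y₂
    · rw [Affine.Point.add_of_Y_eq hxy.1 hxy.2]
      have : Affine.Point.some x₁ y₁ h₁ = -Affine.Point.some x₂ y₂ h₂ := by
        rw [Affine.Point.neg_some]
        simp only [Affine.Point.some.injEq]; exact hxy
      rw [this, logDer_neg, neg_add_cancel]
      rfl
    · obtain ⟨l, x₃, y₃, h₃, hadd, hx₃, hy₃, hl, hdbl, E₁, E₂⟩ := exists_add_eq h₁ h₂ hxy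
      rw [hadd]
      obtain ⟨hx1, hy1⟩ := deriv_eq_smul_logDer h2 hd h₁
      obtain ⟨hx2, hy2⟩ := deriv_eq_smul_logDer h2 hd h₂
      set u₁ := logDer d W (.some x₁ y₁ h₁)
      set u₂ := logDer d W (.some x₂ y₂ h₂)
      -- For a chord, differentiate l(x₁ - x₂) = y₁ - y₂; for a tangent, differentiate l·dY = dX at
      -- the point of contact.
      have hdl : d l = (x₁ - x₃) • u₁ + (x₂ - x₃) • u₂ := by
        by_cases hx : x₁ = x₂
        · obtain ⟨hyy, hne, hl'⟩ := hdbl hx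
          subst hx hyy
          have hu : u₁ = u₂ := rfl
          have := congrArg d hl'
          obtain ⟨c1, c2, c3, c4, c6⟩ := hd
          have t2 : d (2 : F) = 0 := by simpa using d.map_natCast 2
          have t3 : d (3 : F) = 0 := by simpa using d.map_natCast 3
          simp only [dX, dY, map_add, map_sub, Derivation.leibniz, Derivation.leibniz_pow, c1, c2,
            c3, c4, t2, t3, smul_zero, add_zero, ← Nat.cast_smul_eq_nsmul F, smul_smul, smul_add,
                hx1,
            hy1] at this
          rw [← hu]
          apply smul_right_injective V hne
          simp only
          rw [← sub_eq_zero] at this ⊢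
          rw [← this, hx₃]
          match_scalars
          · simp only [dY]
          · simp only [dX, dY] at hl' ⊢
            push_cast
            linear_combination (W.a₁ + 2 * l) * hl'
        · have hs : x₁ - x₂ ≠ 0 := sub_ne_zero.mpr hx
          have := congrArg d hl
          simp only [map_sub, Derivation.leibniz, hx1, hy1, hx2, hy2] at this
          apply smul_right_injective V hs
          simp only
          rw [← sub_eq_zero] at this ⊢
          rw [← neg_eq_zero, ← this]
          match_scalars
          · ring
          · linear_combination -E₁
          · linear_combination E₂
      have hdx3 : d x₃ = dY W x₃ y₃ • (u₁ + u₂) := by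
        obtain ⟨c1, c2, c3, c4, c6⟩ := hd
        rw [hx₃]
        simp only [map_add, map_sub, Derivation.leibniz, Derivation.leibniz_pow, c1, c2,
            smul_zero, add_zero, ← Nat.cast_smul_eq_nsmul F, hx1, hx2, hdl]
        rw [← hx₃]
        match_scalars
        · simp only [dY, hy₃]; push_cast; ring
        · simp only [dY, hy₃]; push_cast; linear_combination 2 * hl
      refine logDer_eq_of_deriv_eq h₃ h2 hd hdx3 ?_
      obtain ⟨c1, c2, c3, c4, c6⟩ := hd
      -- The derivative of the cubic cut out by the line, now at its third root; the reflection of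
      -- that intersection point replaces l by -(a₁ + l).
      have E₃ : dX W x₃ y₃ + (W.a₁ + l) * dY W x₃ y₃ = (x₃ - x₁) * (x₃ - x₂) := by
        simp only [dX, dY] at E₁ ⊢
        rw [hy₃]
        linear_combination E₁ + 2 * (x₃ - x₁) * hx₃
      have hdy3 : d y₃ = _ := congrArg d hy₃
      rw [hdy3]
      simp only [map_add, map_sub, map_neg, Derivation.leibniz, c1, c3, smul_zero, add_zero,
          sub_zero,
        hdx3, hx1, hy1, hdl]
      match_scalars
      · linear_combination -E₃ - E₁
      · linear_combination -E₃

end LogDerivative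

/-! ### Sum and difference of two points -/

section AddSub

variable {F : Type*} [Field F] {W : WeierstrassCurve F}

lemma dY_sq {x y : F} (h : W.toAffine.Equation x y) :
    dY W x y ^ 2 = 4 * x ^ 3 + W.b₂ * x ^ 2 + 2 * W.b₄ * x + W.b₆ := by
  have q := equation_eq h
  simp only [dY, WeierstrassCurve.b₂, WeierstrassCurve.b₄, WeierstrassCurve.b₆]
  linear_combination 4 * q

variable [DecidableEq F]

/-- The `x`-coordinates of the sum and the difference of two points. -/
lemma exists_add_sub_eq {x₁ y₁ x₂ y₂ : F} (h₁ : W.toAffine.Nonsingular x₁ y₁)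
    (h₂ : W.toAffine.Nonsingular x₂ y₂) (hx : x₁ ≠ x₂) :
    ∃ (x₃ y₃ x₄ y₄ : F) (h₃ : W.toAffine.Nonsingular x₃ y₃) (h₄ : W.toAffine.Nonsingular x₄ y₄),
      Affine.Point.some x₁ y₁ h₁ + Affine.Point.some x₂ y₂ h₂ = Affine.Point.some x₃ y₃ h₃ ∧
      Affine.Point.some x₁ y₁ h₁ - Affine.Point.some x₂ y₂ h₂ = Affine.Point.some x₄ y₄ h₄ ∧
      (x₃ + x₄) * (x₁ - x₂) ^ 2 = 2 * (x₁ + x₂) * (x₁ * x₂) + W.b₂ * (x₁ * x₂) +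
        W.b₄ * (x₁ + x₂) + W.b₆ ∧
      x₃ * x₄ * (x₁ - x₂) ^ 2 = (x₁ * x₂) ^ 2 - W.b₄ * (x₁ * x₂) - W.b₆ * (x₁ + x₂) - W.b₈ := by
  have hD : x₁ - x₂ ≠ 0 := sub_ne_zero.mpr hx
  obtain ⟨l, x₃, y₃, h₃, e₃, hx₃, -, hl, -⟩ := exists_add_eq h₁ h₂ (fun h => hx h.1)
  have h₂' : W.toAffine.Nonsingular x₂ (W.toAffine.negY x₂ y₂) :=
    (Affine.nonsingular_neg _ _).mpr h₂
  obtain ⟨m, x₄, y₄, h₄, e₄, hx₄, -, hm, -⟩ := exists_add_eq h₁ h₂' (fun h => hx h.1)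
  refine ⟨x₃, y₃, x₄, y₄, h₃, h₄, e₃, ?_, ?_⟩
  · rw [sub_eq_add_neg, Affine.Point.neg_some, e₄]
  have q₁ := equation_eq h₁.1
  have q₂ := equation_eq h₂.1
  have n₃ : x₃ * (x₁ - x₂) ^ 2 = (y₁ - y₂) ^ 2 + W.a₁ * (y₁ - y₂) * (x₁ - x₂) -
      (W.a₂ + x₁ + x₂) * (x₁ - x₂) ^ 2 := by
    rw [hl, hx₃]; ring
  have n₄ : x₄ * (x₁ - x₂) ^ 2 = (y₁ - W.toAffine.negY x₂ y₂) ^ 2 +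
      W.a₁ * (y₁ - W.toAffine.negY x₂ y₂) * (x₁ - x₂) - (W.a₂ + x₁ + x₂) * (x₁ - x₂) ^ 2 := by
    rw [hm, hx₄]; ring
  simp only [Affine.negY] at n₄
  simp only [WeierstrassCurve.b₂, WeierstrassCurve.b₄, WeierstrassCurve.b₆, WeierstrassCurve.b₈]
  constructor
  · rw [add_mul, n₃, n₄]
    linear_combination 2 * q₁ + 2 * q₂
  · apply mul_right_cancel₀ (pow_ne_zero 2 hD)
    rw [show x₃ * x₄ * (x₁ - x₂) ^ 2 * (x₁ - x₂) ^ 2 =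
      (x₃ * (x₁ - x₂) ^ 2) * (x₄ * (x₁ - x₂) ^ 2) by ring, n₃, n₄]
    generalize W.a₁ = a1, W.a₂ = a2, W.a₃ = a3, W.a₄ = a4, W.a₆ = a6 at *
    generalize x₁ = x1, x₂ = x2, y₁ = y1, y₂ = y2 at *
    linear_combination ((a1 * a3 * x1) + (-1 * a1 * a3 * x2) + (a1 * x1 * y1) + (-2 * a1 * x2 * y2)
        + (a1 ^ 2 * x1 * x2) + (-1 * a1 ^ 2 * x2 ^ 2) + (4 * a2 * x1 * x2) + (-1 * a2 * x1 ^ 2) +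
        (-2 * a2 * x2 ^ 2) + (a3 * y1) + (-2 * a3 * y2) + (a4 * x1) + (a6) + (2 * x1 * x2 ^ 2) + (2
        * x1 ^ 2 * x2) + (-1 * x1 ^ 3) + (-2 * x2 ^ 3) + (y1 ^ 2) + (-2 * y2 ^ 2)) * q₁ + ((-1 * a1
        * a3 * x1) + (a1 * a3 * x2) + (a1 * x2 * y2) + (a1 ^ 2 * x1 * x2) + (-1 * a1 ^ 2 * x1 ^ 2)
        + (4 * a2 * x1 * x2) + (-4 * a2 * x1 ^ 2) + (-1 * a2 * x2 ^ 2) + (a3 * y2) + (-2 * a4 * x1)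
        + (a4 * x2) + (-1 * a6) + (2 * x1 * x2 ^ 2) + (2 * x1 ^ 2 * x2) + (-4 * x1 ^ 3) + (-1 * x2
        ^ 3) + (y2 ^ 2)) * q₂

/-- The duplication formula for the `x`-coordinate. -/
lemma exists_two_nsmul_eq {x y : F} (h : W.toAffine.Nonsingular x y) (hy : dY W x y ≠ 0) :
    ∃ (x' y' : F) (h' : W.toAffine.Nonsingular x' y'),
      (2 : ℕ) • Affine.Point.some x y h = Affine.Point.some x' y' h' ∧
      x' * dY W x y ^ 2 = x ^ 4 - W.b₄ * x ^ 2 - 2 * W.b₆ * x - W.b₈ := by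
  obtain ⟨l, x₃, y₃, h₃, e₃, hx₃, -, -, hl, -⟩ := exists_add_eq h h
    (fun h' => hy (by rw [← sub_negY_eq_dY, sub_eq_zero]; exact h'.2))
  obtain ⟨-, -, hl⟩ := hl rfl
  refine ⟨x₃, y₃, h₃, by rw [two_nsmul, e₃], ?_⟩
  have q := equation_eq h.1
  have : x₃ * dY W x y ^ 2 = dX W x y ^ 2 + W.a₁ * dX W x y * dY W x y -
      (W.a₂ + 2 * x) * dY W x y ^ 2 := by
    rw [← hl, hx₃]; ring
  rw [this]
  simp only [dX, dY, WeierstrassCurve.b₄, WeierstrassCurve.b₆, WeierstrassCurve.b₈]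
  linear_combination (-(W.a₁ ^ 2 + 4 * W.a₂ + 8 * x)) * q

end AddSub

/-! ### Transcendental elements have nonzero differential -/

section Kaehler

open scoped IntermediateField.algebraAdjoinAdjoin in
-- Extend t to a transcendence basis s. In characteristic 0 the field F is formally étale over the
-- polynomial ring k[s], so differentials of F come from k[s] by scalar extension, and the partial
-- derivative in the variable t detects D t.
lemma kaehler_D_ne_zero {k F : Type*} [Field k] [CharZero k] [Field F] [Algebra k F] {t : F}
    (ht : Transcendental k t) : KaehlerDifferential.D k F t ≠ 0 := by
  obtain ⟨s, hts, hs⟩ := exists_isTranscendenceBasis_superset (R := k) (s := {t})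
    ((algebraicIndependent_singleton_iff (x := ((↑) : ({t} : Set F) → F)) ⟨t, rfl⟩).mpr ht)
  let A := Algebra.adjoin k (Set.range ((↑) : s → F))
  let M := IntermediateField.adjoin k (Set.range ((↑) : s → F))
  have : Algebra.IsAlgebraic M F := hs.isAlgebraic_field
  have : Algebra.FormallyEtale M F := Algebra.FormallyEtale.of_isSeparable M F
  have : Algebra.FormallyEtale A M := .of_isLocalization (nonZeroDivisors _)
  have : Algebra.FormallyEtale A F := .comp _ M _
  let e : MvPolynomial s k ≃ₐ[k] A := hs.1.aevalEquiv
  let i : s := ⟨t, hts rfl⟩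
  let δ : Derivation k A A := Derivation.mk'
    (e.toLinearMap ∘ₗ (MvPolynomial.pderiv i).toLinearMap ∘ₗ e.symm.toLinearMap) (fun a b => by
      simp [smul_eq_mul])
  let t' : A := e (MvPolynomial.X i)
  have ht' : algebraMap A F t' = t := by
    change algebraMap _ F (hs.1.aevalEquiv _) = t
    rw [hs.1.algebraMap_aevalEquiv]
    simp [i]
  have hδ : δ t' = 1 := by
    change e (MvPolynomial.pderiv i (e.symm (e (MvPolynomial.X i)))) = 1
    simp
  intro h
  rw [← ht'] at h
  have h2 := KaehlerDifferential.tensorKaehlerEquivOfFormallyEtale_symm_D_algebraMap k A F t'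
  rw [h, map_zero] at h2
  have h3 := congrArg (LinearMap.lTensor F δ.liftKaehlerDifferential) h2
  rw [map_zero, LinearMap.lTensor_tmul, Derivation.liftKaehlerDifferential_comp_D, hδ] at h3
  have h4 := congrArg (TensorProduct.rid A F) h3
  simp at h4

end Kaehler

/-! ### The generic point -/

section Generic

variable {k : Type*} [Field k] (W : WeierstrassCurve k)

/-- The coordinate function `x`. -/
def genX : W.toAffine.FunctionField :=
  algebraMap W.toAffine.CoordinateRing _ (Affine.CoordinateRing.mk W.toAffine (C X))

/-- The coordinate function `y`. -/
def genY : W.toAffine.FunctionField :=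
  algebraMap W.toAffine.CoordinateRing _ (Affine.CoordinateRing.mk W.toAffine Y)

variable {M : Type*} [Field M]

/-- Evaluation of functions at a point with transcendental `x`-coordinate is injective. -/
lemma eval_injective {W : WeierstrassCurve k} {f : k →+* M} {a b : M}
    (h : (W.map f).toAffine.Equation a b)
    (ha : ∀ p : k[X], p.eval₂ f a = 0 → p = 0) :
    Function.Injective (AdjoinRoot.lift (eval₂RingHom f a) b
      (show W.toAffine.polynomial.eval₂ (eval₂RingHom f a) b = 0 by
        have := equation_eq h
        simp only [map_a₁, map_a₂, map_a₃, map_a₄, map_a₆] at this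
        rw [Affine.polynomial]
        simp only [eval₂_add, eval₂_sub, eval₂_pow, eval₂_X, eval₂_mul, eval₂_C, coe_eval₂RingHom]
        linear_combination this)) := by
  set φ := AdjoinRoot.lift (eval₂RingHom f a) b _
  rw [injective_iff_map_eq_zero]
  intro z hz
  -- The norm is z times its conjugate, so it vanishes at (a, b) as well; it is a polynomial in a
  -- alone, hence zero.
  have hn : φ (algebraMap k[X] _ (Algebra.norm k[X] z)) = 0 := by
    obtain ⟨p, q, rfl⟩ := Affine.CoordinateRing.exists_smul_basis_eq z
    have := Affine.CoordinateRing.coe_norm_smul_basis (W' := W.toAffine) p q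
    change φ (AdjoinRoot.of _ _) = 0
    rw [this, map_mul, map_mul]
    convert! zero_mul _ using 2
    rw [← hz]
    congr 1
    rw [map_add, map_mul, Affine.CoordinateRing.smul, Affine.CoordinateRing.smul, mul_one]
  have : φ (algebraMap k[X] _ (Algebra.norm k[X] z)) = (Algebra.norm k[X] z).eval₂ f a :=
    AdjoinRoot.lift_of _
  rw [this] at hn
  have : Module.Finite k[X] W.toAffine.CoordinateRing :=
    .of_basis (Affine.CoordinateRing.basis W.toAffine)
  exact Algebra.norm_eq_zero_iff.mp (ha _ hn)

/-- The homomorphism `k(W) → M` given by a point with transcendental `x`-coordinate. -/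
def evalHom (W : WeierstrassCurve k) (f : k →+* M) (a b : M)
    (h : (W.map f).toAffine.Equation a b) (ha : ∀ p : k[X], p.eval₂ f a = 0 → p = 0) :
    W.toAffine.FunctionField →+* M :=
  IsFractionRing.lift (eval_injective h ha)

section
variable {W} {f : k →+* M} {a b : M} (h : (W.map f).toAffine.Equation a b)
  (ha : ∀ p : k[X], p.eval₂ f a = 0 → p = 0)

lemma evalHom_mk (p : k[X][Y]) : evalHom W f a b h ha
    (algebraMap _ _ (Affine.CoordinateRing.mk W.toAffine p)) = p.eval₂ (eval₂RingHom f a) b := by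
  rw [evalHom, IsFractionRing.lift_algebraMap, AdjoinRoot.lift_mk]

lemma evalHom_genX : evalHom W f a b h ha (genX W) = a := by
  rw [genX, evalHom_mk]; simp

lemma evalHom_genY : evalHom W f a b h ha (genY W) = b := by
  rw [genY, evalHom_mk]; simp

lemma evalHom_algebraMap (c : k) : evalHom W f a b h ha (algebraMap k _ c) = f c := by
  have : algebraMap k W.toAffine.FunctionField c =
    algebraMap _ _ (Affine.CoordinateRing.mk W.toAffine (C (C c))) := rfl
  rw [this, evalHom_mk]; simp

end

variable {W}

/-- Ring homomorphisms on the function field are determined by their values on constants and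
coordinates. -/
lemma functionField_hom_ext {g₁ g₂ : W.toAffine.FunctionField →+* M}
    (hc : ∀ c : k, g₁ (algebraMap k _ c) = g₂ (algebraMap k _ c)) (hx : g₁ (genX W) = g₂ (genX W))
    (hy : g₁ (genY W) = g₂ (genY W)) : g₁ = g₂ := by
  apply IsLocalization.ringHom_ext (nonZeroDivisors W.toAffine.CoordinateRing)
  apply AdjoinRoot.ringHom_ext
  · apply Polynomial.ringHom_ext
    · exact hc
    · exact hx
  · exact hy

lemma algebraMap_mk (p : k[X]) :
    algebraMap W.toAffine.CoordinateRing W.toAffine.FunctionField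
      (Affine.CoordinateRing.mk W.toAffine (C p)) = aeval (genX W) p := by
  induction p using Polynomial.induction_on' with
  | add p q hp hq => simp only [map_add, hp, hq]
  | monomial n a =>
    rw [← C_mul_X_pow_eq_monomial]
    simp only [map_mul, map_pow, aeval_C, aeval_X]
    rfl

lemma exists_eq_algebraMap (z : W.toAffine.CoordinateRing) : ∃ p q : k[X],
    z = p • (1 : W.toAffine.CoordinateRing) + q • Affine.CoordinateRing.mk W.toAffine Y ∧
    algebraMap _ W.toAffine.FunctionField z = aeval (genX W) p + aeval (genX W) q * genY W := by
  obtain ⟨p, q, rfl⟩ := Affine.CoordinateRing.exists_smul_basis_eq z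
  refine ⟨p, q, rfl, ?_⟩
  rw [map_add, Affine.CoordinateRing.smul, Affine.CoordinateRing.smul, map_mul, map_mul,
    algebraMap_mk, algebraMap_mk, map_one, mul_one]
  rfl

lemma transcendental_genX : Transcendental k (genX W) := by
  rw [transcendental_iff]
  intro p hp
  rw [← algebraMap_mk] at hp
  have := (map_eq_zero_iff _ (IsFractionRing.injective W.toAffine.CoordinateRing _)).mp hp
  have h2 : p • (1 : W.toAffine.CoordinateRing) + (0 : k[X]) •
      Affine.CoordinateRing.mk W.toAffine Y = 0 := by
    rw [zero_smul, add_zero, Affine.CoordinateRing.smul, this, zero_mul]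
  exact (Affine.CoordinateRing.smul_basis_eq_zero h2).1

lemma generic_equation : (W.baseChange W.toAffine.FunctionField).toAffine.Equation
    (genX W) (genY W) := by
  rw [Affine.equation_iff]
  have h : Affine.CoordinateRing.mk W.toAffine (Y ^ 2 + C (C W.a₁ * X + C W.a₃) * Y -
    C (X ^ 3 + C W.a₂ * X ^ 2 + C W.a₄ * X + C W.a₆)) = 0 := AdjoinRoot.mk_self
  have h2 := congrArg (algebraMap _ W.toAffine.FunctionField) h
  simp only [map_add, map_sub, map_mul, map_pow, map_zero, algebraMap_mk, aeval_C, aeval_X] at h2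
  rw [sub_eq_zero] at h2
  change genY W ^ 2 + algebraMap k _ W.a₁ * genX W * genY W + algebraMap k _ W.a₃ * genY W = _
  refine Eq.trans ?_ h2
  change _ = genY W ^ 2 + _ * genY W
  ring

end Generic

/-! ### Multiples of a point of infinite order -/

section InfiniteOrder

/-- The numerator of `x(P + Q) x(P - Q)`. -/
def prodNum {R : Type*} [CommRing R] (W : WeierstrassCurve R) (s t u : R) : R :=
  s ^ 2 - W.b₄ * s * u - W.b₆ * t * u - W.b₈ * u ^ 2

/-- The numerator of `x(P + Q) + x(P - Q)`. -/
def sumNum {R : Type*} [CommRing R] (W : WeierstrassCurve R) (s t u : R) : R :=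
  2 * t * s + W.b₂ * s * u + W.b₄ * t * u + W.b₆ * u ^ 2

variable {F : Type*} [Field F] {W : WeierstrassCurve F}

/-- The `x`-coordinate of a point, with value `0` at infinity. -/
def xCoord : W.toAffine.Point → F
  | .zero => 0
  | .some x _ _ => x

@[simp] lemma xCoord_some {x y : F} (h : W.toAffine.Nonsingular x y) :
    xCoord (Affine.Point.some x y h) = x := rfl

lemma exists_eq_some {P : W.toAffine.Point} (hP : P ≠ 0) :
    ∃ (y : F) (h : W.toAffine.Nonsingular (xCoord P) y), P = .some (xCoord P) y h := by
  cases P with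
  | zero => exact absurd rfl hP
  | some x y h => exact ⟨y, h, rfl⟩

lemma eq_or_eq_neg_of_xCoord_eq {P Q : W.toAffine.Point} (hP : P ≠ 0) (hQ : Q ≠ 0)
    (h : xCoord P = xCoord Q) : P = Q ∨ P = -Q := by
  obtain ⟨y, hy, e⟩ := exists_eq_some hP
  obtain ⟨y', hy', e'⟩ := exists_eq_some hQ
  rw [e, e']
  exact Affine.Point.X_eq_iff.mp h

variable [DecidableEq F]

lemma xCoord_add_sub {P Q : W.toAffine.Point} (hP : P ≠ 0) (hQ : Q ≠ 0)
    (h : xCoord P ≠ xCoord Q) :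
    P + Q ≠ 0 ∧ P - Q ≠ 0 ∧
    (xCoord (P + Q) + xCoord (P - Q)) * (xCoord P - xCoord Q) ^ 2 =
      sumNum W (xCoord P * xCoord Q) (xCoord P + xCoord Q) 1 ∧
    xCoord (P + Q) * xCoord (P - Q) * (xCoord P - xCoord Q) ^ 2 =
      prodNum W (xCoord P * xCoord Q) (xCoord P + xCoord Q) 1 := by
  obtain ⟨y, hy, e⟩ := exists_eq_some hP
  obtain ⟨y', hy', e'⟩ := exists_eq_some hQ
  generalize xCoord P = x at *
  generalize xCoord Q = x' at *
  subst e e'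
  obtain ⟨x₃, y₃, x₄, y₄, h₃, h₄, e₃, e₄, hs, hp⟩ := exists_add_sub_eq hy hy' h
  rw [e₃, e₄]
  refine ⟨Affine.Point.some_ne_zero _, Affine.Point.some_ne_zero _, ?_, ?_⟩
  · simp only [xCoord_some, sumNum, hs]; ring
  · simp only [xCoord_some, prodNum, hp]; ring

variable {x y : F} (h : W.toAffine.Nonsingular x y)

/-- The sequence attached to a point whose terms are the values of the division polynomials. -/
def divSeq : ℕ → F
  | 0 => 0
  | 1 => 1
  | 2 => dY W x y
  -- The relation ψ_{j+1}ψ_{j-1} = (x - x(jP))ψ_j², with j = n + 2, solved for the next term.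
  | n + 3 => (x - xCoord ((n + 2) • Affine.Point.some x y h)) * divSeq (n + 2) ^ 2 / divSeq (n + 1)

variable {h} (hinf : ∀ n : ℕ, n ≠ 0 → n • Affine.Point.some x y h ≠ 0)
include hinf

lemma xCoord_nsmul_ne {m n : ℕ} (hm : m ≠ 0) (hn : n ≠ 0) (hmn : m ≠ n) :
    xCoord (m • Affine.Point.some x y h) ≠ xCoord (n • Affine.Point.some x y h) := by
  wlog hlt : n < m generalizing m n
  · exact (this hn hm hmn.symm (by omega)).symm
  intro e
  rcases eq_or_eq_neg_of_xCoord_eq (hinf m hm) (hinf n hn) e with e | e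
  · apply hinf (m - n) (by omega)
    obtain ⟨j, rfl⟩ := Nat.exists_eq_add_of_lt hlt
    rw [show n + j + 1 - n = j + 1 by omega]
    rw [add_assoc, add_nsmul] at e
    simpa using e
  · apply hinf (m + n) (by omega)
    rw [add_nsmul, e, neg_add_cancel]

lemma dY_ne_zero_of_infinite : dY W x y ≠ 0 := by
  intro h0
  apply hinf 2 (by norm_num)
  rw [two_nsmul, Affine.Point.add_self_of_Y_eq]
  rw [← sub_negY_eq_dY, sub_eq_zero] at h0
  exact h0

lemma divSeq_ne_zero : ∀ n : ℕ, n ≠ 0 → divSeq h n ≠ 0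
  | 0, hn => absurd rfl hn
  | 1, _ => by simp [divSeq]
  | 2, _ => by simpa [divSeq] using dY_ne_zero_of_infinite hinf
  | n + 3, _ => by
    have h1 := divSeq_ne_zero (n + 1) (by omega)
    have h2 := divSeq_ne_zero (n + 2) (by omega)
    rw [divSeq]
    have := xCoord_nsmul_ne hinf (m := 1) (n := n + 2) (by omega) (by omega) (by omega)
    rw [one_nsmul, xCoord_some] at this
    exact div_ne_zero (mul_ne_zero (sub_ne_zero.mpr this) (pow_ne_zero 2 h2)) h1

lemma divSeq_one (n : ℕ) (hn : 1 ≤ n) : divSeq h (n + 1) * divSeq h (n - 1) =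
    (x - xCoord (n • Affine.Point.some x y h)) * divSeq h n ^ 2 := by
  match n, hn with
  | 1, _ => simp [divSeq]
  | n + 2, _ =>
    rw [show n + 2 + 1 = n + 3 by rfl, divSeq, show n + 2 - 1 = n + 1 by rfl,
      div_mul_cancel₀ _ (divSeq_ne_zero hinf (n + 1) (by omega))]

lemma xCoord_two_nsmul : xCoord ((2 : ℕ) • Affine.Point.some x y h) * dY W x y ^ 2 =
    x ^ 4 - W.b₄ * x ^ 2 - 2 * W.b₆ * x - W.b₈ := by
  obtain ⟨x', y', h', e, e'⟩ := exists_two_nsmul_eq h (dY_ne_zero_of_infinite hinf)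
  rw [e, xCoord_some, e']

lemma xCoord_nsmul_add_sub {m n : ℕ} (hn : n ≠ 0) (hmn : n < m) :
    (xCoord ((m + n) • Affine.Point.some x y h) + xCoord ((m - n) • Affine.Point.some x y h)) *
      (xCoord (m • Affine.Point.some x y h) - xCoord (n • Affine.Point.some x y h)) ^ 2 =
      sumNum W (xCoord (m • Affine.Point.some x y h) * xCoord (n • Affine.Point.some x y h))
        (xCoord (m • Affine.Point.some x y h) + xCoord (n • Affine.Point.some x y h)) 1 ∧
    xCoord ((m + n) • Affine.Point.some x y h) * xCoord ((m - n) • Affine.Point.some x y h) *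
      (xCoord (m • Affine.Point.some x y h) - xCoord (n • Affine.Point.some x y h)) ^ 2 =
      prodNum W (xCoord (m • Affine.Point.some x y h) * xCoord (n • Affine.Point.some x y h))
        (xCoord (m • Affine.Point.some x y h) + xCoord (n • Affine.Point.some x y h)) 1 := by
  have := (xCoord_add_sub (hinf m (by omega)) (hinf n hn)
    (xCoord_nsmul_ne hinf (by omega) hn (by omega))).2.2
  have e : m • Affine.Point.some x y h - n • Affine.Point.some x y h =
      (m - n) • Affine.Point.some x y h := by
    rw [sub_nsmul _ hmn.le, sub_eq_add_neg]
  rwa [← add_nsmul, e] at this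

/-- The elliptic relations. -/
lemma divSeq_add_mul_divSeq_sub (n : ℕ) (hn : 1 ≤ n) : ∀ m, n ≤ m →
    divSeq h (m + n) * divSeq h (m - n) = (xCoord (n • Affine.Point.some x y h) -
      xCoord (m • Affine.Point.some x y h)) * divSeq h m ^ 2 * divSeq h n ^ 2 := by
  -- The relation for (m, n + 3) follows from those for (m, n + 1) and (m, n + 2) and the one-step
  -- relations at m ± (n + 2) and n + 2. Only x-coordinates of sums and differences enter, through
  -- their symmetric functions.
  induction n using Nat.strong_induction_on with
  | _ n ih =>
  intro m hm
  rcases hm.eq_or_lt with rfl | hlt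
  · simp [divSeq]
  match n, hn with
  | 1, _ =>
    rw [divSeq_one hinf m (by omega)]
    simp [divSeq]
  | 2, _ =>
    have a1 := divSeq_one hinf m (by omega)
    have a2 := divSeq_one hinf (m + 1) (by omega)
    have a3 := divSeq_one hinf (m - 1) (by omega)
    rw [show m + 1 - 1 = m by omega] at a2
    rw [show m - 1 + 1 = m by omega] at a3
    have hx2 := xCoord_two_nsmul hinf
    have hq := dY_sq h.1
    obtain ⟨s1, s2⟩ := xCoord_nsmul_add_sub hinf (m := m) (n := 1) one_ne_zero (by omega)
    rw [one_nsmul, xCoord_some] at s1 s2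
    have hw := divSeq_ne_zero hinf m (by omega)
    apply mul_left_cancel₀ (pow_ne_zero 2 hw)
    rw [show m - 1 - 1 = m - 2 by omega] at a3
    rw [show m + 1 + 1 = m + 2 by omega] at a2
    rw [show divSeq h 2 = dY W x y by rw [divSeq]]
    generalize divSeq h (m + 2) = wp at *
    generalize divSeq h (m - 2) = wm at *
    generalize divSeq h (m + 1) = wp1 at *
    generalize divSeq h (m - 1) = wm1 at *
    generalize divSeq h m = w at *
    generalize xCoord (m • Affine.Point.some x y h) = Xm at *
    generalize xCoord ((m + 1) • Affine.Point.some x y h) = Xp at *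
    generalize xCoord ((m - 1) • Affine.Point.some x y h) = Xmm at *
    generalize xCoord (2 • Affine.Point.some x y h) = X2 at *
    simp only [sumNum, prodNum] at s1 s2
    calc w ^ 2 * (wp * wm) = (wp * w) * (w * wm) := by ring
      _ = (x - Xp) * (x - Xmm) * (wp1 * wm1) ^ 2 := by rw [a2, a3]; ring
      _ = (x - Xp) * (x - Xmm) * (Xm - x) ^ 2 * w ^ 4 := by rw [a1]; ring
      _ = _ := by linear_combination w ^ 4 * (- x * s1 + s2 - hx2 + Xm * hq)
  | n + 3, _ =>
    have i1 := ih (n + 1) (by omega) (by omega) m (by omega)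
    have i2 := ih (n + 2) (by omega) (by omega) m (by omega)
    have a1 := divSeq_one hinf (m + (n + 2)) (by omega)
    have a2 := divSeq_one hinf (m - (n + 2)) (by omega)
    have a3 := divSeq_one hinf (n + 2) (by omega)
    rw [show m + (n + 2) + 1 = m + (n + 3) by omega,
      show m + (n + 2) - 1 = m + (n + 1) by omega] at a1
    rw [show m - (n + 2) + 1 = m - (n + 1) by omega,
      show m - (n + 2) - 1 = m - (n + 3) by omega] at a2
    rw [show n + 2 + 1 = n + 3 by omega, show n + 2 - 1 = n + 1 by omega] at a3
    obtain ⟨s1, s2⟩ := xCoord_nsmul_add_sub hinf (m := m) (n := n + 2) (by omega) (by omega)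
    obtain ⟨t1, t2⟩ := xCoord_nsmul_add_sub hinf (m := n + 2) (n := 1) (by omega) (by omega)
    rw [one_nsmul, xCoord_some] at t1 t2
    rw [show n + 2 + 1 = n + 3 by omega, show n + 2 - 1 = n + 1 by omega] at t1 t2
    have hne : divSeq h (m + (n + 1)) * divSeq h (m - (n + 1)) ≠ 0 :=
      mul_ne_zero (divSeq_ne_zero hinf _ (by omega)) (divSeq_ne_zero hinf _ (by omega))
    apply mul_left_cancel₀ hne
    generalize divSeq h (m + (n + 1)) = wp1 at *
    generalize divSeq h (m - (n + 1)) = wm1 at *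
    generalize divSeq h (m + (n + 2)) = wp2 at *
    generalize divSeq h (m - (n + 2)) = wm2 at *
    generalize divSeq h (m + (n + 3)) = wp3 at *
    generalize divSeq h (m - (n + 3)) = wm3 at *
    generalize divSeq h (n + 1) = v1 at *
    generalize divSeq h (n + 2) = v2 at *
    generalize divSeq h (n + 3) = v3 at *
    generalize divSeq h m = w at *
    generalize xCoord (m • Affine.Point.some x y h) = Xm at *
    generalize xCoord ((n + 1) • Affine.Point.some x y h) = X1 at *
    generalize xCoord ((n + 2) • Affine.Point.some x y h) = X2 at *
    generalize xCoord ((n + 3) • Affine.Point.some x y h) = X3 at *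
    generalize xCoord ((m + (n + 2)) • Affine.Point.some x y h) = Xp at *
    generalize xCoord ((m - (n + 2)) • Affine.Point.some x y h) = Xmm at *
    simp only [sumNum, prodNum] at s1 s2 t1 t2
    calc wp1 * wm1 * (wp3 * wm3) = (wp3 * wp1) * (wm1 * wm3) := by ring
      _ = (x - Xp) * (x - Xmm) * (wp2 * wm2) ^ 2 := by rw [a1, a2]; ring
      _ = (x - Xp) * (x - Xmm) * (Xm - X2) ^ 2 * (w ^ 4 * v2 ^ 4) := by rw [i2]; ring
      -- The expression (x(R) - x(S + Q))(x(R) - x(S - Q))(x(S) - x(Q))² is symmetric in R and S; it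
      -- is used here with R the base point, S its m-th multiple and Q its (n + 2)-nd multiple.
      _ = (Xm - X3) * (Xm - X1) * ((x - X2) * v2 ^ 2) ^ 2 * w ^ 4 := by
        linear_combination w ^ 4 * v2 ^ 4 * (- x * s1 + s2 + Xm * t1 - t2)
      _ = (Xm - X3) * (Xm - X1) * (v3 * v1) ^ 2 * w ^ 4 := by rw [a3]
      _ = wp1 * wm1 * ((X3 - Xm) * w ^ 2 * v3 ^ 2) := by rw [i1]; ring

lemma divSeq_three : divSeq h 3 = W.Ψ₃.eval x := by
  have a := divSeq_one hinf 2 (by norm_num)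
  have hx2 := xCoord_two_nsmul hinf
  have hq := dY_sq h.1
  simp only [show divSeq h (2 - 1) = 1 by simp [divSeq], show divSeq h 2 = dY W x y by rw [divSeq],
    mul_one, Nat.reduceAdd] at a
  rw [a, sub_mul, hx2, hq, WeierstrassCurve.Ψ₃]
  simp
  ring

lemma divSeq_four : divSeq h 4 = W.preΨ₄.eval x * dY W x y := by
  have a := divSeq_one hinf 3 (by norm_num)
  have h3 := divSeq_three hinf
  have a2 := divSeq_one hinf 2 (by norm_num)
  have hx2 := xCoord_two_nsmul hinf
  have hq := dY_sq h.1
  have hβ := dY_ne_zero_of_infinite hinf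
  obtain ⟨s1, -⟩ := xCoord_nsmul_add_sub hinf (m := 2) (n := 1) (by omega) (by omega)
  rw [one_nsmul, xCoord_some] at s1
  simp only [show divSeq h (2 - 1) = 1 by simp [divSeq], Nat.reduceAdd, Nat.reduceSub,
    show divSeq h 2 = dY W x y by rw [divSeq], mul_one] at a a2 s1
  apply mul_right_cancel₀ hβ
  rw [a]
  generalize xCoord (2 • Affine.Point.some x y h) = X2 at *
  generalize xCoord (3 • Affine.Point.some x y h) = X3 at *
  generalize divSeq h 3 = w3 at *
  have e1 : (X3 + x) * w3 ^ 2 = sumNum W (X2 * dY W x y ^ 2 * x)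
      (X2 * dY W x y ^ 2 + x * dY W x y ^ 2) (dY W x y ^ 2) := by
    rw [a2]
    simp only [sumNum] at s1 ⊢
    linear_combination dY W x y ^ 4 * s1
  have e2 : (x - X3) * w3 ^ 2 = 2 * x * w3 ^ 2 - (X3 + x) * w3 ^ 2 := by ring
  rw [e2, e1, hx2, h3, mul_assoc (eval x W.preΨ₄), ← sq, hq]
  simp only [sumNum, WeierstrassCurve.Ψ₃, WeierstrassCurve.preΨ₄, eval_add, eval_mul, eval_pow,
    eval_C, eval_X, eval_ofNat, WeierstrassCurve.b₂, WeierstrassCurve.b₄,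
    WeierstrassCurve.b₆, WeierstrassCurve.b₈]
  ring

/-- Both sequences are determined by their first values and the duplication recursions. The even and
odd recursions are the elliptic relations for the pairs (m + 4, m + 2) and (m + 3, m + 2), with
x-coordinates removed by the one-step relation. -/
lemma divSeq_eq_normEDS (n : ℕ) :
    divSeq h n = normEDS (dY W x y) (W.Ψ₃.eval x) (W.preΨ₄.eval x) n := by
  have hβ := dY_ne_zero_of_infinite hinf
  induction n using normEDSRec' with
  | zero => simp [divSeq]
  | one => simp [divSeq]
  | two => simp [divSeq]
  | three => simpa using divSeq_three hinf
  | four => simpa using divSeq_four hinf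
  | even m ih =>
    have r := divSeq_add_mul_divSeq_sub hinf (m + 2) (by omega) (m + 4) (by omega)
    have a1 := divSeq_one hinf (m + 2) (by omega)
    have a2 := divSeq_one hinf (m + 4) (by omega)
    rw [show m + 4 + (m + 2) = 2 * (m + 3) by ring, show m + 4 - (m + 2) = 2 by omega] at r
    rw [show m + 2 + 1 = m + 3 by ring, show m + 2 - 1 = m + 1 by omega] at a1
    rw [show m + 4 + 1 = m + 5 by ring, show m + 4 - 1 = m + 3 by omega] at a2
    have key := normEDS_even (dY W x y) (W.Ψ₃.eval x) (W.preΨ₄.eval x) (m + 3)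
    rw [show ((m : ℤ) + 3 - 1) = ((m + 2 : ℕ) : ℤ) by push_cast; ring,
      show ((m : ℤ) + 3 + 2) = ((m + 5 : ℕ) : ℤ) by push_cast; ring,
      show ((m : ℤ) + 3 - 2) = ((m + 1 : ℕ) : ℤ) by push_cast; ring,
      show ((m : ℤ) + 3 + 1) = ((m + 4 : ℕ) : ℤ) by push_cast; ring,
      show ((m : ℤ) + 3) = ((m + 3 : ℕ) : ℤ) by push_cast; ring,
      ← ih (m + 2) (by omega), ← ih (m + 5) (by omega), ← ih (m + 1) (by omega),
      ← ih (m + 4) (by omega), ← ih (m + 3) (by omega)] at key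
    apply mul_right_cancel₀ hβ
    push_cast at key ⊢
    rw [key]
    rw [show divSeq h 2 = dY W x y by rw [divSeq]] at r
    rw [r]
    linear_combination (divSeq h (m + 4)) ^ 2 * a1 - (divSeq h (m + 2)) ^ 2 * a2
  | odd m ih =>
    have r := divSeq_add_mul_divSeq_sub hinf (m + 2) (by omega) (m + 3) (by omega)
    have a1 := divSeq_one hinf (m + 2) (by omega)
    have a2 := divSeq_one hinf (m + 3) (by omega)
    rw [show m + 3 + (m + 2) = 2 * (m + 2) + 1 by ring, show m + 3 - (m + 2) = 1 by omega,
      show divSeq h 1 = 1 by rw [divSeq], mul_one] at r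
    rw [show m + 2 + 1 = m + 3 by ring, show m + 2 - 1 = m + 1 by omega] at a1
    rw [show m + 3 + 1 = m + 4 by ring, show m + 3 - 1 = m + 2 by omega] at a2
    have key := normEDS_odd (dY W x y) (W.Ψ₃.eval x) (W.preΨ₄.eval x) (m + 2)
    rw [show ((m : ℤ) + 2 + 2) = ((m + 4 : ℕ) : ℤ) by push_cast; ring,
      show ((m : ℤ) + 2 - 1) = ((m + 1 : ℕ) : ℤ) by push_cast; ring,
      show ((m : ℤ) + 2 + 1) = ((m + 3 : ℕ) : ℤ) by push_cast; ring,
      show ((m : ℤ) + 2) = ((m + 2 : ℕ) : ℤ) by push_cast; ring,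
      ← ih (m + 2) (by omega), ← ih (m + 1) (by omega),
      ← ih (m + 4) (by omega), ← ih (m + 3) (by omega)] at key
    push_cast at key ⊢
    rw [key, r]
    linear_combination (divSeq h (m + 3)) ^ 2 * a1 - (divSeq h (m + 2)) ^ 2 * a2

lemma eval_preΨ_eq (n : ℕ) : divSeq h n =
    (W.preΨ n).eval x * if Even n then dY W x y else 1 := by
  rw [divSeq_eq_normEDS hinf, normEDS, WeierstrassCurve.preΨ]
  have := map_preNormEDS (b := W.Ψ₂Sq ^ 2) (c := W.Ψ₃) (d := W.preΨ₄) (evalRingHom x) n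
  simp only [coe_evalRingHom] at this
  rw [this, eval_pow]
  have e : W.Ψ₂Sq.eval x = dY W x y ^ 2 := by
    rw [dY_sq h.1, WeierstrassCurve.Ψ₂Sq]; simp
  rw [e, ← pow_mul]
  simp

lemma eval_ΨSq_eq (n : ℕ) : (W.ΨSq n).eval x = divSeq h n ^ 2 := by
  rw [eval_preΨ_eq hinf, WeierstrassCurve.ΨSq, eval_mul, eval_pow, mul_pow]
  have e : W.Ψ₂Sq.eval x = dY W x y ^ 2 := by
    rw [dY_sq h.1, WeierstrassCurve.Ψ₂Sq]; simp
  by_cases hn : Even n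
  · simp [hn, e]
  · simp [hn]

lemma eval_Φ_eq {n : ℕ} (hn : n ≠ 0) : (W.Φ n).eval x =
    xCoord (n • Affine.Point.some x y h) * (W.ΨSq n).eval x := by
  have e : W.Ψ₂Sq.eval x = dY W x y ^ 2 := by
    rw [dY_sq h.1, WeierstrassCurve.Ψ₂Sq]; simp
  have a := divSeq_one hinf n (by omega)
  have h1 := eval_preΨ_eq hinf (n + 1)
  have h2 := eval_preΨ_eq hinf (n - 1)
  have : (W.preΨ (n + 1)).eval x * (W.preΨ (n - 1)).eval x * (if Even n then 1 else W.Ψ₂Sq).eval x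
      = divSeq h (n + 1) * divSeq h (n - 1) := by
    rw [h1, h2]
    obtain ⟨m, rfl⟩ := Nat.exists_eq_succ_of_ne_zero hn
    push_cast
    simp only [Nat.succ_eq_add_one, add_sub_cancel_right]
    rw [show m + 1 + 1 = m + 2 by ring]
    by_cases hm : Even m
    · simp [hm, Nat.even_add_one, e, parity_simps]; ring
    · simp [hm, Nat.even_add_one, parity_simps]
  rw [WeierstrassCurve.Φ, eval_sub, eval_mul, eval_mul, eval_mul, eval_X]
  simp only [Int.even_coe_nat]
  rw [this, a, eval_ΨSq_eq hinf]
  ring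

end InfiniteOrder

/-! ### The generic point and identities between division polynomials -/

section Forms

variable {R S : Type*} [CommRing R] [CommRing S] (W : WeierstrassCurve R)

/-- The homogeneous form of the numerator of the duplication formula. -/
def dupNum (s u : R) : R :=
  s ^ 4 - W.b₄ * s ^ 2 * u ^ 2 - 2 * W.b₆ * s * u ^ 3 - W.b₈ * u ^ 4

/-- The homogeneous form of the denominator of the duplication formula, divided by `u`. -/
def dupDen (s u : R) : R :=
  4 * s ^ 3 + W.b₂ * s ^ 2 * u + 2 * W.b₄ * s * u ^ 2 + W.b₆ * u ^ 3

variable {W} (f : R →+* S)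

lemma map_prodNum (s t u : R) : f (prodNum W s t u) = prodNum (W.map f) (f s) (f t) (f u) := by
  simp [prodNum]

lemma map_sumNum (s t u : R) : f (sumNum W s t u) = sumNum (W.map f) (f s) (f t) (f u) := by
  simp [sumNum, map_ofNat]

lemma map_dupNum (s u : R) : f (dupNum W s u) = dupNum (W.map f) (f s) (f u) := by
  simp [dupNum, map_ofNat]

lemma map_dupDen (s u : R) : f (dupDen W s u) = dupDen (W.map f) (f s) (f u) := by
  simp [dupDen, map_ofNat]

/-- The discriminant of the quadratic with roots x(P + Q) and x(P - Q), cleared of denominators, is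
the product of the squares of ψ₂ at P and Q. The identity rests on the relation among the
b-invariants. -/
lemma sumNum_sq_sub_prodNum (s t : R) :
    sumNum W (s * t) (s + t) 1 ^ 2 - 4 * prodNum W (s * t) (s + t) 1 * (s - t) ^ 2 =
      dupDen W s 1 * dupDen W t 1 := by
  have := W.b_relation
  simp only [sumNum, prodNum, dupDen]
  linear_combination (s - t) ^ 2 * this

end Forms

section Generic

variable {k : Type*} [Field k] {W : WeierstrassCurve k}

local notation "F" => W.toAffine.FunctionField

lemma dY_gen_ne_zero (h2 : (2 : k) ≠ 0) :
    dY (W.baseChange F) (genX W) (genY W) ≠ 0 := by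
  intro h
  have e : algebraMap W.toAffine.CoordinateRing F
      ((C W.a₁ * X + C W.a₃ : k[X]) • (1 : W.toAffine.CoordinateRing) + (C 2 : k[X]) •
        Affine.CoordinateRing.mk W.toAffine Y) = 0 := by
    rw [Affine.CoordinateRing.smul, Affine.CoordinateRing.smul, map_add, map_mul, map_mul,
      algebraMap_mk, algebraMap_mk, map_one, mul_one, ← h]
    simp only [dY, map_add, map_mul, aeval_C, aeval_X, map_ofNat]
    change _ + 2 * genY W = 2 * genY W + algebraMap k F _ * _ + algebraMap k F _
    ring
  have := (map_eq_zero_iff _ (IsFractionRing.injective W.toAffine.CoordinateRing _)).mp e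
  have := (Affine.CoordinateRing.smul_basis_eq_zero this).2
  exact h2 (C_eq_zero.mp this)

lemma generic_nonsingular (h2 : (2 : k) ≠ 0) :
    (W.baseChange F).toAffine.Nonsingular (genX W) (genY W) := by
  rw [Affine.nonsingular_iff']
  exact ⟨generic_equation, .inr (dY_gen_ne_zero h2)⟩

lemma constCoeffs_baseChange {k K V : Type*} [Field k] [Field K] [Algebra k K] [AddCommGroup V]
    [Module k V] [Module K V] (W : WeierstrassCurve k) (d : Derivation k K V) :
    ConstCoeffs d (W.baseChange K) := by
  refine ⟨?_, ?_, ?_, ?_, ?_⟩ <;> exact d.map_algebraMap _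

lemma logDer_nsmul {k K V : Type*} [Field k] [Field K] [Algebra k K] [AddCommGroup V]
    [Module k V] [Module K V] [DecidableEq K] {W : WeierstrassCurve K} {d : Derivation k K V}
    (h2 : (2 : K) ≠ 0) (hd : ConstCoeffs d W) (P : W.toAffine.Point) (n : ℕ) :
    logDer d W (n • P) = n • logDer d W P := by
  induction n with
  | zero => simp only [zero_nsmul]; rfl
  | succ n ih => rw [succ_nsmul, logDer_add h2 hd, ih, succ_nsmul]

lemma logDer_ne_zero {k K : Type*} [Field k] [CharZero k] [Field K] [Algebra k K]
    {W : WeierstrassCurve K} (hd : ConstCoeffs (KaehlerDifferential.D k K) W) {x y : K}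
    (h : W.toAffine.Nonsingular x y) (hx : Transcendental k x) :
    logDer (KaehlerDifferential.D k K) W (.some x y h) ≠ 0 := by
  have : CharZero K := charZero_of_injective_algebraMap (algebraMap k K).injective
  intro h0
  apply kaehler_D_ne_zero hx
  rw [(deriv_eq_smul_logDer two_ne_zero hd h).1, h0, smul_zero]

/-- The logarithmic derivative of nP is n times that of P, which is nonzero because a transcendental
coordinate has nonzero differential in characteristic 0. No knowledge of torsion is required. -/
lemma nsmul_ne_zero_of_transcendental {k K : Type*} [Field k] [CharZero k] [Field K] [Algebra k K]
    [DecidableEq K] {W : WeierstrassCurve K} (hd : ConstCoeffs (KaehlerDifferential.D k K) W)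
    {x y : K} (h : W.toAffine.Nonsingular x y) (hx : Transcendental k x) (n : ℕ) (hn : n ≠ 0) :
    n • (.some x y h : W.toAffine.Point) ≠ 0 := by
  have : CharZero K := charZero_of_injective_algebraMap (algebraMap k K).injective
  intro h0
  have h1 := logDer_nsmul two_ne_zero hd (.some x y h) n
  rw [h0, ← Nat.cast_smul_eq_nsmul K] at h1
  exact smul_ne_zero (Nat.cast_ne_zero.mpr hn) (logDer_ne_zero hd h hx) h1.symm

/-- The identities between consecutive division polynomials. -/
structure DivisionIdentities {R : Type*} [CommRing R] (W : WeierstrassCurve R) (n : ℕ) : Prop where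
  ΨSq_mul : 1 ≤ n → W.ΨSq (n + 1) * W.ΨSq (n - 1) = (W.Φ n - X * W.ΨSq n) ^ 2
  Φ_mul : 2 ≤ n → W.Φ (n + 1) * W.Φ (n - 1) =
    prodNum (W.map C) (W.Φ n * X) (W.Φ n + X * W.ΨSq n) (W.ΨSq n)
  Φ_mul_ΨSq : 2 ≤ n → W.Φ (n + 1) * W.ΨSq (n - 1) + W.Φ (n - 1) * W.ΨSq (n + 1) =
    sumNum (W.map C) (W.Φ n * X) (W.Φ n + X * W.ΨSq n) (W.ΨSq n)
  ΨSq_two_mul : 1 ≤ n → W.ΨSq (2 * n) = W.ΨSq n * dupDen (W.map C) (W.Φ n) (W.ΨSq n)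
  Φ_two_mul : 1 ≤ n → W.Φ (2 * n) = dupNum (W.map C) (W.Φ n) (W.ΨSq n)
  -- This is [n]^*ω = nω with denominators cleared, squared to eliminate y.
  wronskian : 1 ≤ n → (derivative (W.Φ n) * W.ΨSq n - W.Φ n * derivative (W.ΨSq n)) ^ 2 * W.Ψ₂Sq =
    n ^ 2 * W.ΨSq n * dupDen (W.map C) (W.Φ n) (W.ΨSq n)

lemma map_C_map {R S : Type*} [CommRing R] [CommRing S] (W : WeierstrassCurve R)
    (f : R →+* S) : (W.map f).map C = (W.map C).map (mapRingHom f) := by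
  ext <;> simp

lemma DivisionIdentities.of_map {R S : Type*} [CommRing R] [CommRing S] {W : WeierstrassCurve R}
    {f : R →+* S} (hf : Function.Injective f) {n : ℕ} (h : DivisionIdentities (W.map f) n) :
    DivisionIdentities W n := by
  have hi : Function.Injective (mapRingHom f) := Polynomial.map_injective f hf
  have hX : mapRingHom f X = X := by simp
  have hD (p : R[X]) : mapRingHom f (derivative p) = derivative (mapRingHom f p) := by
    simp [derivative_map]
  obtain ⟨h1, h2, h3, h4, h5, h6⟩ := h
  simp only [map_C_map, map_ΨSq, map_Φ, map_Ψ₂Sq, ← coe_mapRingHom] at h1 h2 h3 h4 h5 h6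
  constructor <;> intro hn <;> apply hi <;>
    simp only [map_mul, map_sub, map_add, map_pow, map_prodNum, map_sumNum, map_dupNum, map_dupDen,
      hX, hD, map_natCast]
  exacts [h1 hn, h2 hn, h3 hn, h4 hn, h5 hn, h6 hn]

lemma DivisionIdentities.map {R S : Type*} [CommRing R] [CommRing S] {W : WeierstrassCurve R}
    {n : ℕ} (h : DivisionIdentities W n) (f : R →+* S) : DivisionIdentities (W.map f) n := by
  have hX : mapRingHom f X = X := by simp
  have hD (p : R[X]) : mapRingHom f (derivative p) = derivative (mapRingHom f p) := by
    simp [derivative_map]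
  obtain ⟨h1, h2, h3, h4, h5, h6⟩ := h
  constructor <;> intro hn <;>
    [have e := congrArg (mapRingHom f) (h1 hn); have e := congrArg (mapRingHom f) (h2 hn);
      have e := congrArg (mapRingHom f) (h3 hn); have e := congrArg (mapRingHom f) (h4 hn);
      have e := congrArg (mapRingHom f) (h5 hn); have e := congrArg (mapRingHom f) (h6 hn)] <;>
    simp only [map_mul, map_sub, map_add, map_pow, map_prodNum, map_sumNum, map_dupNum, map_dupDen,
      hX, hD, map_natCast] at e <;>
    simpa only [map_C_map, map_ΨSq, map_Φ, map_Ψ₂Sq, ← coe_mapRingHom] using e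

/-- The elliptic relation for (n + 1, n - 1) expresses ψ_{2n}ψ₂ through x((n - 1)P) - x((n + 1)P).
Its square is a discriminant, which `sumNum_sq_sub_prodNum` factors. -/
lemma divSeq_two_mul {K : Type*} [Field K] [DecidableEq K] {W : WeierstrassCurve K} {x y : K}
    {h : W.toAffine.Nonsingular x y}
    (hinf : ∀ n : ℕ, n ≠ 0 → n • Affine.Point.some x y h ≠ 0) (n : ℕ) (hn : 1 ≤ n) :
    divSeq h (2 * n) ^ 2 = dupDen W (xCoord (n • Affine.Point.some x y h)) 1 *
      divSeq h n ^ 8 := by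
  have hβ := dY_ne_zero_of_infinite hinf
  have hq := dY_sq h.1
  obtain rfl | hn := hn.eq_or_lt
  · simp only [mul_one, one_nsmul, xCoord_some, divSeq, one_pow, dupDen, hq]
  have r := divSeq_add_mul_divSeq_sub hinf (n - 1) (by omega) (n + 1) (by omega)
  have a := divSeq_one hinf n (by omega)
  obtain ⟨s1, s2⟩ := xCoord_nsmul_add_sub hinf (m := n) (n := 1) one_ne_zero (by omega)
  rw [show n + 1 + (n - 1) = 2 * n by omega, show n + 1 - (n - 1) = 2 by omega,
    show divSeq h 2 = dY W x y by rw [divSeq]] at r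
  rw [one_nsmul, xCoord_some] at s1 s2
  apply mul_right_cancel₀ (pow_ne_zero 2 hβ)
  have e := sumNum_sq_sub_prodNum (W := W) (xCoord (n • Affine.Point.some x y h)) x
  rw [← s1, ← s2] at e
  have e' : dupDen W x 1 = dY W x y ^ 2 := by rw [hq, dupDen]; ring
  rw [e'] at e
  generalize divSeq h (2 * n) = w2 at *
  generalize divSeq h (n - 1) = wm at *
  generalize divSeq h (n + 1) = wp at *
  generalize divSeq h n = w at *
  calc w2 ^ 2 * dY W x y ^ 2 = (w2 * dY W x y) ^ 2 := by ring
    _ = (xCoord ((n - 1) • Affine.Point.some x y h) -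
        xCoord ((n + 1) • Affine.Point.some x y h)) ^ 2 * (wp * wm) ^ 4 := by rw [r]; ring
    _ = _ := by
      rw [a]
      linear_combination w ^ 8 * e

lemma xCoord_two_mul_nsmul {K : Type*} [Field K] [DecidableEq K] {W : WeierstrassCurve K} {x y : K}
    {h : W.toAffine.Nonsingular x y}
    (hinf : ∀ n : ℕ, n ≠ 0 → n • Affine.Point.some x y h ≠ 0) (n : ℕ) (hn : 1 ≤ n) :
    xCoord ((2 * n) • Affine.Point.some x y h) *
      dupDen W (xCoord (n • Affine.Point.some x y h)) 1 =
      dupNum W (xCoord (n • Affine.Point.some x y h)) 1 := by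
  obtain ⟨y', h', e⟩ := exists_eq_some (hinf n (by omega))
  have hinf' : ∀ m : ℕ, m ≠ 0 → m • Affine.Point.some _ y' h' ≠ 0 := by
    intro m hm
    rw [← e, ← mul_nsmul']
    exact hinf _ (mul_ne_zero hm (by omega))
  have := xCoord_two_nsmul hinf'
  rw [← e, ← mul_nsmul', dY_sq h'.1] at this
  simp only [dupDen, dupNum]
  linear_combination this

lemma eq_of_aeval_genX {p q : k[X]} (h : aeval (genX W) p = aeval (genX W) q) : p = q := by
  rw [← sub_eq_zero]
  exact transcendental_iff.mp transcendental_genX _ (by rw [map_sub, h, sub_self])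

/-- The generic point has infinite order and transcendental x-coordinate, so each identity in k[X]
may be tested at it, where it becomes a relation between the terms of `divSeq` and the x-coordinates
of multiples. -/
lemma divisionIdentities_of_charZero {k : Type*} [Field k] [CharZero k] (W : WeierstrassCurve k)
    (n : ℕ) : DivisionIdentities W n := by
  classical
  let K := W.toAffine.FunctionField
  have : CharZero K := charZero_of_injective_algebraMap (algebraMap k K).injective
  let d := KaehlerDifferential.D k K
  have hd : ConstCoeffs d (W.baseChange K) := constCoeffs_baseChange W d
  let h : (W.baseChange K).toAffine.Nonsingular (genX W) (genY W) := generic_nonsingular two_ne_zero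
  have hinf : ∀ n : ℕ, n ≠ 0 → n • Affine.Point.some _ _ h ≠ 0 := fun n hn =>
    nsmul_ne_zero_of_transcendental hd h transcendental_genX n hn
  have eV (n : ℕ) : aeval (genX W) (W.ΨSq n) = divSeq h n ^ 2 := by
    rw [← eval_ΨSq_eq hinf, baseChange, map_ΨSq, eval_map_algebraMap]
  have eU (n : ℕ) (hn : n ≠ 0) : aeval (genX W) (W.Φ n) =
      xCoord (n • Affine.Point.some _ _ h) * divSeq h n ^ 2 := by
    rw [← eval_ΨSq_eq hinf, ← eval_Φ_eq hinf hn, baseChange, map_Φ, eval_map_algebraMap]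
  have eX : aeval (genX W) (X : k[X]) = genX W := aeval_X _
  have hmap : (W.map C).map ((aeval (genX W) : k[X] →ₐ[k] K) : k[X] →+* K) = W.baseChange K := by
    ext <;> simp [baseChange]
  have eP (s t u : k[X]) : aeval (genX W) (prodNum (W.map C) s t u) = prodNum (W.baseChange K)
      (aeval (genX W) s) (aeval (genX W) t) (aeval (genX W) u) := by
    rw [← hmap]; exact map_prodNum (aeval (genX W) : k[X] →ₐ[k] K).toRingHom s t u
  have eS (s t u : k[X]) : aeval (genX W) (sumNum (W.map C) s t u) = sumNum (W.baseChange K)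
      (aeval (genX W) s) (aeval (genX W) t) (aeval (genX W) u) := by
    rw [← hmap]; exact map_sumNum (aeval (genX W) : k[X] →ₐ[k] K).toRingHom s t u
  have eN (s u : k[X]) : aeval (genX W) (dupNum (W.map C) s u) = dupNum (W.baseChange K)
      (aeval (genX W) s) (aeval (genX W) u) := by
    rw [← hmap]; exact map_dupNum (aeval (genX W) : k[X] →ₐ[k] K).toRingHom s u
  have eD (s u : k[X]) : aeval (genX W) (dupDen (W.map C) s u) = dupDen (W.baseChange K)
      (aeval (genX W) s) (aeval (genX W) u) := by
    rw [← hmap]; exact map_dupDen (aeval (genX W) : k[X] →ₐ[k] K).toRingHom s u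
  have c1 (hn : 1 ≤ n) : ((n : ℤ) - 1) = ((n - 1 : ℕ) : ℤ) := by omega
  have c2 : ((n : ℤ) + 1) = ((n + 1 : ℕ) : ℤ) := by omega
  have c3 : (2 * (n : ℤ)) = ((2 * n : ℕ) : ℤ) := by omega
  have a := fun hn => divSeq_one hinf n hn
  have s := fun hn => xCoord_nsmul_add_sub hinf (m := n) (n := 1) one_ne_zero hn
  simp only [one_nsmul, xCoord_some] at s
  constructor <;> intro hn <;> apply eq_of_aeval_genX (W := W)
  · rw [c1 hn, c2, map_mul, map_pow, map_sub, map_mul, eV, eV, eU _ (by omega), eV, eX, ← mul_pow,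
      a hn]
    ring
  · rw [c1 (by omega), c2, map_mul, eP, map_mul, map_add, map_mul, eU _ (by omega),
      eU _ (by omega), eU _ (by omega), eV, eX, mul_mul_mul_comm, ← mul_pow, a (by omega)]
    have e := (s hn).2
    simp only [prodNum] at e ⊢
    linear_combination divSeq h n ^ 4 * e
  · rw [c1 (by omega), c2, map_add, map_mul, map_mul, eS, map_mul, map_add, map_mul,
      eU _ (by omega), eU _ (by omega), eU _ (by omega), eV, eV, eV, eX]
    have e := (s hn).1
    have a := a (by omega)
    simp only [sumNum] at e ⊢
    generalize divSeq h (n + 1) = wp at *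
    generalize divSeq h (n - 1) = wm at *
    generalize xCoord ((n + 1) • Affine.Point.some _ _ h) = xp at *
    generalize xCoord ((n - 1) • Affine.Point.some _ _ h) = xm at *
    trans (xp + xm) * (wp * wm) ^ 2
    · ring
    rw [a]
    linear_combination divSeq h n ^ 4 * e
  · rw [c3, eV, divSeq_two_mul hinf n hn, map_mul, eD, eU _ (by omega), eV]
    simp only [dupDen]
    ring
  · rw [c3, eU _ (by omega), divSeq_two_mul hinf n hn, ← mul_assoc, xCoord_two_mul_nsmul hinf n hn,
      eN, eU _ (by omega), eV]
    simp only [dupNum]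
    ring
  -- Differentiate x(nP)·ΨSq_n = Φ_n, using that the logarithmic derivative of nP is n times that of
  -- P, and compare the coefficients of the nonzero invariant differential.
  · obtain ⟨x', y', h', e⟩ : ∃ (x' y' : K) (h' : (W.baseChange K).toAffine.Nonsingular x' y'),
        n • Affine.Point.some _ _ h = .some x' y' h' := by
      obtain ⟨y', h', e⟩ := exists_eq_some (hinf n (by omega))
      exact ⟨_, y', h', e⟩
    have hl := logDer_nsmul two_ne_zero hd (.some _ _ h) n
    have hU := eU n (by omega)
    rw [← eV, e, xCoord_some] at hU
    rw [e, ← Nat.cast_smul_eq_nsmul K] at hl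
    have hx := (deriv_eq_smul_logDer two_ne_zero hd h).1
    have hx' := (deriv_eq_smul_logDer two_ne_zero hd h').1
    rw [hl] at hx'
    have hω := logDer_ne_zero hd h transcendental_genX
    have hq := dY_sq h.1
    have hq' := dY_sq h'.1
    have dU := congrArg d hU
    rw [Derivation.leibniz, Derivation.map_aeval, Derivation.map_aeval, hx, hx', smul_smul,
      smul_smul, smul_smul, smul_smul, smul_smul, ← add_smul] at dU
    have dU := smul_left_injective K hω dU
    have e2 : aeval (genX W) W.Ψ₂Sq = dY (W.baseChange K) (genX W) (genY W) ^ 2 := by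
      rw [hq, WeierstrassCurve.Ψ₂Sq]
      simp only [baseChange, map_add, map_mul, map_pow, aeval_C, aeval_X, map_b₂, map_b₄, map_b₆]
      rw [map_ofNat (algebraMap k W.toAffine.FunctionField) 4,
        map_ofNat (algebraMap k W.toAffine.FunctionField) 2]
    simp only [map_mul, map_pow, map_sub, eD, map_natCast, e2]
    simp only [dupDen]
    generalize aeval (genX W) (W.Φ n) = u at *
    generalize aeval (genX W) (W.ΨSq n) = v at *
    generalize aeval (genX W) (derivative (W.Φ n)) = u' at *
    generalize aeval (genX W) (derivative (W.ΨSq n)) = v' at *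
    trans (v ^ 2 * (dY (W.baseChange K) x' y') * n) ^ 2
    · rw [← mul_pow, hU]
      congr 1
      linear_combination v * dU
    · rw [mul_pow, mul_pow, hq', hU]
      ring

/-- Every Weierstrass curve over a commutative ring is the image of one over a domain of
characteristic zero. -/
lemma exists_universal {R : Type*} [CommRing R] (W : WeierstrassCurve R) :
    ∃ (W₀ : WeierstrassCurve (MvPolynomial (Fin 5) ℤ)) (φ : MvPolynomial (Fin 5) ℤ →+* R),
      W₀.map φ = W := by
  refine ⟨⟨.X 0, .X 1, .X 2, .X 3, .X 4⟩, MvPolynomial.eval₂Hom (Int.castRingHom R)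
    ![W.a₁, W.a₂, W.a₃, W.a₄, W.a₆], ?_⟩
  ext <;> simp

/-- The identities have integral coefficients in a₁, ..., a₆. They hold over the fraction field of
ℤ[a₁, ..., a₆], which has characteristic 0, hence over this polynomial ring, and then specialise to
any ring. -/
theorem divisionIdentities {R : Type*} [CommRing R] (W : WeierstrassCurve R) (n : ℕ) :
    DivisionIdentities W n := by
  obtain ⟨W₀, φ, rfl⟩ := exists_universal W
  refine DivisionIdentities.map ?_ φ
  exact DivisionIdentities.of_map (f := algebraMap _ (FractionRing (MvPolynomial (Fin 5) ℤ)))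
    (IsFractionRing.injective _ _) (divisionIdentities_of_charZero _ n)

end Generic

/-! ### Coprimality of the division polynomials -/

section Coprime

/-- The product of two primitive linear forms is primitive: ac, ad + cb and bd generate the unit
ideal. The product (ra + sb)(tc + wd) involves ad and cb separately, but its square lies in the
ideal of the three symmetric expressions, whence the explicit combination. -/
lemma dvd_of_dvd_mul_coprime {R : Type*} [CommRing R] {a b c d g h : R} (hab : IsCoprime a b)
    (hcd : IsCoprime c d) (h1 : g ∣ h * (b * d)) (h2 : g ∣ h * (a * c))
    (h3 : g ∣ h * (a * d + c * b)) : g ∣ h := by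
  obtain ⟨r, s, hrs⟩ := hab
  obtain ⟨t, w, htw⟩ := hcd
  have e : h = h * (a * c) * (r ^ 2 * (t ^ 2 * a * c + 2 * t * w * a * d) +
      2 * r * s * b * (t ^ 2 * c + 2 * t * w * d) - b * d * (r ^ 2 * w ^ 2 + s ^ 2 * t ^ 2)) +
      h * (a * d + c * b) * (r ^ 2 * w ^ 2 * a * d + s ^ 2 * t ^ 2 * c * b) +
      h * (b * d) * (2 * r * s * w ^ 2 * a * d + s ^ 2 * (2 * t * w * c * b + w ^ 2 * b * d)) := by
    refine Eq.trans (b := h * (r * a + s * b) ^ 2 * (t * c + w * d) ^ 2) ?_ ?_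
    · rw [hrs, htw]; ring
    · ring
  rw [e]
  exact dvd_add (dvd_add (h2.mul_right _) (h3.mul_right _)) (h1.mul_right _)

/-- A convex sequence of natural numbers that vanishes infinitely often vanishes. -/
lemma eq_zero_of_convex {g : ℕ → ℕ} (h1 : g 1 = 0) (hinf : ∀ N, ∃ n, N ≤ n ∧ g n = 0)
    (hg : ∀ n, 2 ≤ n → 2 * g n ≤ g (n + 1) + g (n - 1)) (n : ℕ) (hn : 1 ≤ n) : g n = 0 := by
  induction n, hn using Nat.le_induction with
  | base => exact h1
  | succ n hn ih =>
    by_contra h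
    -- A zero term followed by a nonzero one makes a convex sequence strictly increasing from there
    -- on, so it has no later zeros.
    have key : ∀ m, n + 1 ≤ m → g (m - 1) < g m := by
      intro m hm
      induction m, hm using Nat.le_induction with
      | base => simpa [ih] using Nat.pos_of_ne_zero h
      | succ m hm ih' =>
        have := hg m (by omega)
        rw [Nat.add_sub_cancel]
        omega
    obtain ⟨m, hm, hm0⟩ := hinf (n + 1)
    have := key m hm
    omega

variable {k : Type*} [Field k] (W : WeierstrassCurve k) [W.IsElliptic]

/-- The entries (s², 2su, u²) are the symmetric coordinates of the pair (P, P), and `addSubMap`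
takes them to those of the pair (2P, O), whose last coordinate vanishes. The Bézout relations of
`addSubMap`, available for nonzero discriminant, then put (s²)⁴ and (u²)⁴ in the ideal of numerator
and denominator. -/
lemma isCoprime_dup {R : Type*} [CommRing R] (W : WeierstrassCurve R) [W.IsElliptic] {s u : R}
    (h : IsCoprime s u) : IsCoprime (dupNum W s u) (u * dupDen W s u) := by
  have e0 := addSubMapCoeff_condition W ![s ^ 2, 2 * s * u, u ^ 2] 0
  have e2 := addSubMapCoeff_condition W ![s ^ 2, 2 * s * u, u ^ 2] 2
  simp only [Fin.sum_univ_three] at e0 e2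
  have m0 : (addSubMap W 0).eval ![s ^ 2, 2 * s * u, u ^ 2] = dupNum W s u := by
    simp [addSubMap, dupNum]; ring
  have m1 : (addSubMap W 1).eval ![s ^ 2, 2 * s * u, u ^ 2] = u * dupDen W s u := by
    simp [addSubMap, dupDen]; ring
  have m2 : (addSubMap W 2).eval ![s ^ 2, 2 * s * u, u ^ 2] = 0 := by
    simp [addSubMap]; ring
  simp only [m0, m1, m2, mul_zero, add_zero] at e0 e2
  generalize MvPolynomial.eval (_ : Fin 3 → R) _ = A at e0
  generalize MvPolynomial.eval (_ : Fin 3 → R) _ = B at e0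
  generalize MvPolynomial.eval (_ : Fin 3 → R) _ = A' at e2
  generalize MvPolynomial.eval (_ : Fin 3 → R) _ = B' at e2
  have : IsCoprime ((s ^ 2) ^ 4) ((u ^ 2) ^ 4) := h.pow.pow
  obtain ⟨r, t, hrt⟩ := this
  simp only [Matrix.cons_val] at e0 e2
  refine ⟨r * A + t * A', r * B + t * B', ?_⟩
  linear_combination r * e0 + t * e2 + hrt

lemma isCoprime_Φ_ΨSq_two_pow (j : ℕ) : IsCoprime (W.Φ (2 ^ j : ℕ)) (W.ΨSq (2 ^ j : ℕ)) := by
  induction j with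
  | zero => simp [isCoprime_one_right]
  | succ j ih =>
    have e := divisionIdentities W (2 ^ j)
    have : ((2 ^ (j + 1) : ℕ) : ℤ) = 2 * ((2 ^ j : ℕ) : ℤ) := by push_cast; ring
    rw [this, e.Φ_two_mul Nat.one_le_two_pow, e.ΨSq_two_mul Nat.one_le_two_pow]
    exact isCoprime_dup _ ih

/-- Let G_n be the gcd. The identities for indices n ± 1 have right-hand sides that are quadratic
forms in Φ_n and ΨSq_n, hence divisible by G_n². Since the reduced pairs at n ± 1 are primitive,
G_n² divides G_{n+1}G_{n-1}. So deg G_n is convex in n for n ≥ 2; it vanishes at 1 and, by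
duplication, at all powers of two, hence everywhere. -/
lemma isCoprime_Φ_ΨSq (n : ℕ) (hn : 1 ≤ n) : IsCoprime (W.Φ n) (W.ΨSq n) := by
  classical
  let G (n : ℕ) : k[X] := EuclideanDomain.gcd (W.Φ n) (W.ΨSq n)
  have hG (n : ℕ) : G n ≠ 0 := fun h => W.Φ_ne_zero n (EuclideanDomain.gcd_eq_zero_iff.mp h).1
  have hdec (n : ℕ) : ∃ a b, W.Φ n = G n * a ∧ W.ΨSq n = G n * b ∧ IsCoprime a b := by
    obtain ⟨a, ha⟩ := EuclideanDomain.gcd_dvd_left (W.Φ n) (W.ΨSq n)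
    obtain ⟨b, hb⟩ := EuclideanDomain.gcd_dvd_right (W.Φ n) (W.ΨSq n)
    refine ⟨a, b, ha, hb, ?_⟩
    have := EuclideanDomain.gcd_eq_gcd_ab (W.Φ n) (W.ΨSq n)
    refine ⟨EuclideanDomain.gcdA (W.Φ n) (W.ΨSq n), EuclideanDomain.gcdB (W.Φ n) (W.ΨSq n), ?_⟩
    apply mul_left_cancel₀ (hG n)
    change G n = _ at this
    rw [mul_one]
    conv_rhs => rw [this]
    conv_rhs => enter [1, 1]; rw [ha]
    conv_rhs => enter [2, 1]; rw [hb]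
    ring
  have hdvd (n : ℕ) (hn : 2 ≤ n) : G n ^ 2 ∣ G (n + 1) * G (n - 1) := by
    obtain ⟨a, b, ha, hb, -⟩ := hdec n
    obtain ⟨a₁, b₁, ha₁, hb₁, hc₁⟩ := hdec (n + 1)
    obtain ⟨a₂, b₂, ha₂, hb₂, hc₂⟩ := hdec (n - 1)
    obtain ⟨i1, i2, i3, -⟩ := divisionIdentities W n
    rw [show ((n : ℤ) - 1) = ((n - 1 : ℕ) : ℤ) by omega,
      show ((n : ℤ) + 1) = ((n + 1 : ℕ) : ℤ) by omega] at i1 i2 i3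
    specialize i1 (by omega)
    specialize i2 hn
    specialize i3 hn
    rw [ha, hb, hb₁, hb₂] at i1
    rw [ha, hb, ha₁, ha₂] at i2
    rw [ha, hb, ha₁, ha₂, hb₁, hb₂] at i3
    apply dvd_of_dvd_mul_coprime hc₁ hc₂
    · refine ⟨(a - X * b) ^ 2, ?_⟩
      linear_combination i1
    · refine ⟨prodNum (W.map C) (a * X) (a + X * b) b, ?_⟩
      simp only [prodNum] at i2 ⊢
      linear_combination i2
    · refine ⟨sumNum (W.map C) (a * X) (a + X * b) b, ?_⟩
      simp only [sumNum] at i3 ⊢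
      linear_combination i3
  have hcop (n : ℕ) : IsCoprime (W.Φ n) (W.ΨSq n) ↔ (G n).natDegree = 0 := by
    rw [← EuclideanDomain.gcd_isUnit_iff]
    change IsUnit (G n) ↔ _
    rw [isUnit_iff_degree_eq_zero, degree_eq_natDegree (hG n), Nat.cast_eq_zero]
  rw [hcop]
  refine eq_zero_of_convex (g := fun n => (G n).natDegree) ?_ ?_ ?_ n hn
  · exact (hcop 1).mp (by simpa using isCoprime_Φ_ΨSq_two_pow W 0)
  · exact fun N => ⟨2 ^ N, Nat.lt_two_pow_self.le, (hcop _).mp (isCoprime_Φ_ΨSq_two_pow W N)⟩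
  · intro n hn
    have := natDegree_le_of_dvd (hdvd n hn) (mul_ne_zero (hG _) (hG _))
    rwa [natDegree_pow, natDegree_mul (hG _) (hG _)] at this

lemma ΨSq_ne_zero_of_isElliptic {n : ℕ} (hn : n ≠ 0) : W.ΨSq n ≠ 0 := by
  intro h
  have := isCoprime_Φ_ΨSq W n (by omega)
  rw [h, isCoprime_zero_right] at this
  have h2 := natDegree_eq_zero_of_isUnit this
  rw [natDegree_Φ, Int.natAbs_natCast] at h2
  exact hn (by simpa using h2)

end Coprime

/-! ### Multiples of points and division polynomials -/

section Multiples

variable {k : Type*} [Field k] {W : WeierstrassCurve k}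

/-- The homogeneous coordinates of the image of a point in the projective line are `(s : u)`. -/
def HasXRatio (P : W.toAffine.Point) (s u : k) : Prop :=
  (P = 0 ∧ u = 0 ∧ s ≠ 0) ∨ (P ≠ 0 ∧ u ≠ 0 ∧ s = xCoord P * u)

lemma hasXRatio_iff {P : W.toAffine.Point} {s u a b : k} (h : HasXRatio P a b) :
    HasXRatio P s u ↔ ∃ c : k, c ≠ 0 ∧ s = c * a ∧ u = c * b := by
  rcases h with ⟨rfl, rfl, ha⟩ | ⟨hP, hb, ha⟩
  · constructor
    · rintro (⟨-, rfl, hs⟩ | ⟨h, -⟩)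
      · exact ⟨s / a, div_ne_zero hs ha, by field_simp, by simp⟩
      · exact absurd rfl h
    · rintro ⟨c, hc, rfl, rfl⟩
      exact .inl ⟨rfl, mul_zero _, mul_ne_zero hc ha⟩
  · constructor
    · rintro (⟨h, -⟩ | ⟨-, hu, hs⟩)
      · exact absurd h hP
      · exact ⟨u / b, div_ne_zero hu hb, by rw [hs, ha]; field_simp, by field_simp⟩
    · rintro ⟨c, hc, rfl, rfl⟩
      exact .inr ⟨hP, mul_ne_zero hc hb, by rw [ha]; ring⟩

lemma HasXRatio.ne_zero {P : W.toAffine.Point} {s u : k} (h : HasXRatio P s u) :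
    s ≠ 0 ∨ u ≠ 0 := by
  rcases h with ⟨-, -, h⟩ | ⟨-, h, -⟩
  exacts [.inl h, .inr h]

lemma hasXRatio_neg {P : W.toAffine.Point} {s u : k} (h : HasXRatio P s u) :
    HasXRatio (-P) s u := by
  rcases h with ⟨rfl, rfl, ha⟩ | ⟨hP, hb, ha⟩
  · exact .inl ⟨rfl, rfl, ha⟩
  · cases P with
    | zero => exact absurd rfl hP
    | some x y h => exact .inr ⟨Affine.Point.some_ne_zero _, hb, ha⟩

lemma HasXRatio.mul {P : W.toAffine.Point} {s u : k} (h : HasXRatio P s u) {c : k} (hc : c ≠ 0) :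
    HasXRatio P (s * c) (u * c) :=
  (hasXRatio_iff h).mpr ⟨c, hc, mul_comm _ _, mul_comm _ _⟩

/-- A point of the projective line is determined by a second point and the symmetric functions of
the two. -/
lemma exists_mul_eq_of_symmetric {s u s' u' a b a' b' : k} (h1 : s * s' = a * a')
    (h2 : s * u' + s' * u = a * b' + a' * b) (h3 : u * u' = b * b')
    (hs' : s' ≠ 0 ∨ u' ≠ 0) {c : k} (hc : c ≠ 0) (ha : a' = c * s') (hb : b' = c * u') :
    a = c⁻¹ * s ∧ b = c⁻¹ * u := by
  subst ha hb
  have e1 : s' * (s - c * a) = 0 := by linear_combination h1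
  have e3 : u' * (u - c * b) = 0 := by linear_combination h3
  have e2 : u' * (s - c * a) + s' * (u - c * b) = 0 := by linear_combination h2
  have key : s - c * a = 0 ∧ u - c * b = 0 := by
    rcases hs' with h | h
    · have e := (mul_eq_zero.mp e1).resolve_left h
      rw [e, mul_zero, zero_add] at e2
      exact ⟨e, (mul_eq_zero.mp e2).resolve_left h⟩
    · have e := (mul_eq_zero.mp e3).resolve_left h
      rw [e, mul_zero, add_zero] at e2
      exact ⟨(mul_eq_zero.mp e2).resolve_left h, e⟩
  constructor
  · field_simp; linear_combination -key.1
  · field_simp; linear_combination -key.2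

variable [DecidableEq k]

lemma hasXRatio_two_nsmul [W.IsElliptic] {x y : k} (h : W.toAffine.Nonsingular x y) :
    HasXRatio (Affine.Point.some x y h + .some x y h) (dupNum W x 1) (dupDen W x 1) := by
  have hd : dupDen W x 1 = dY W x y ^ 2 := by rw [dY_sq h.1, dupDen]; ring
  by_cases hy : dY W x y = 0
  · rw [hy, zero_pow two_ne_zero] at hd
    refine .inl ⟨?_, hd, ?_⟩
    · apply Affine.Point.add_self_of_Y_eq
      rw [← sub_negY_eq_dY, sub_eq_zero] at hy
      exact hy
    -- At a point of order two the denominator vanishes, so the numerator cannot.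
    · have := isCoprime_dup W (s := x) (u := 1) isCoprime_one_right
      rw [hd, mul_zero, isCoprime_zero_right] at this
      exact this.ne_zero
  · obtain ⟨x', y', h', e, e'⟩ := exists_two_nsmul_eq h hy
    rw [← two_nsmul, e]
    refine .inr ⟨Affine.Point.some_ne_zero _, hd ▸ pow_ne_zero 2 hy, ?_⟩
    rw [hd, xCoord_some, e', dupNum]
    ring

/-- The projective form of the formulas for the `x`-coordinates of the sum and the difference. -/
lemma exists_hasXRatio_add_sub [W.IsElliptic] {A B : W.toAffine.Point} {a b c d : k}
    (hA : HasXRatio A a b) (hB : HasXRatio B c d) :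
    ∃ s u s' u' : k, HasXRatio (A + B) s u ∧ HasXRatio (A - B) s' u' ∧
      s * s' = prodNum W (a * c) (a * d + b * c) (b * d) ∧
      s * u' + s' * u = sumNum W (a * c) (a * d + b * c) (b * d) ∧
      u * u' = (a * d - b * c) ^ 2 := by
  have hA' := hA
  have hB' := hB
  rcases hA with ⟨rfl, rfl, ha⟩ | ⟨hA0, hb, ha⟩
  · refine ⟨c * a, d * a, c * a, d * a, ?_, ?_, ?_, ?_, ?_⟩
    · rw [zero_add]; exact hB.mul ha
    · rw [zero_sub]; exact (hasXRatio_neg hB).mul ha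
    · simp only [prodNum]; ring
    · simp only [sumNum]; ring
    · ring
  rcases hB with ⟨rfl, rfl, hc⟩ | ⟨hB0, hd, hc⟩
  · refine ⟨a * c, b * c, a * c, b * c, ?_, ?_, ?_, ?_, ?_⟩
    · rw [add_zero]; exact hA'.mul hc
    · rw [sub_zero]; exact hA'.mul hc
    · simp only [prodNum]; ring
    · simp only [sumNum]; ring
    · ring
  by_cases hx : xCoord A = xCoord B
  -- Equal x-coordinates mean A = ±B, so one of A + B and A - B is the origin and the other is 2A;
  -- the sum and product forms then specialise to the duplication forms.
  · have key : HasXRatio (A + A) (prodNum W (a * c) (a * d + b * c) (b * d))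
        (sumNum W (a * c) (a * d + b * c) (b * d)) := by
      obtain ⟨y, h, e⟩ := exists_eq_some hA0
      have := (hasXRatio_two_nsmul h).mul (pow_ne_zero 2 (mul_ne_zero hb hd))
      rw [← e] at this
      convert this using 1
      · rw [ha, hc, ← hx, prodNum, dupNum]; ring
      · rw [ha, hc, ← hx, sumNum, dupDen]; ring
    have h0 : HasXRatio (0 : W.toAffine.Point) 1 0 := .inl ⟨rfl, rfl, one_ne_zero⟩
    have e0 : a * d - b * c = 0 := by rw [ha, hc, hx]; ring
    rcases eq_or_eq_neg_of_xCoord_eq hA0 hB0 hx with e | e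
    · refine ⟨_, _, _, _, by rw [← e]; exact key, by rw [e, sub_self]; exact h0, ?_, ?_, ?_⟩
      · ring
      · ring
      · rw [e0]; ring
    · have e' : A - B = A + A := by rw [e]; abel
      refine ⟨_, _, _, _, by rw [e, neg_add_cancel]; exact h0, e' ▸ key, ?_, ?_, ?_⟩
      · ring
      · ring
      · rw [e0]; ring
  · obtain ⟨h1, h2, e1, e2⟩ := xCoord_add_sub hA0 hB0 hx
    have hne : a * d - b * c ≠ 0 := by
      rw [ha, hc, show xCoord A * b * d - b * (xCoord B * d) =
        (xCoord A - xCoord B) * (b * d) by ring]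
      exact mul_ne_zero (sub_ne_zero.mpr hx) (mul_ne_zero hb hd)
    refine ⟨_, _, _, _, .inr ⟨h1, hne, rfl⟩, .inr ⟨h2, hne, rfl⟩, ?_, ?_, ?_⟩
    · simp only [prodNum] at e2 ⊢
      rw [ha, hc]
      linear_combination b ^ 2 * d ^ 2 * e2
    · simp only [sumNum] at e1 ⊢
      rw [ha, hc]
      linear_combination b ^ 2 * d ^ 2 * e1
    · ring

/-- The `x`-coordinate of a multiple of a point is given by the division polynomials. -/
theorem hasXRatio_nsmul [W.IsElliptic] {x y : k} (h : W.toAffine.Nonsingular x y) (n : ℕ) :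
    HasXRatio (n • Affine.Point.some x y h) ((W.Φ n).eval x) ((W.ΨSq n).eval x) := by
  induction n using Nat.strong_induction_on with
  | _ n ih =>
  match n with
  | 0 => exact .inl ⟨zero_nsmul _, by simp, by simp⟩
  | 1 => exact .inr ⟨by rw [one_nsmul]; exact Affine.Point.some_ne_zero _, by simp, by simp⟩
  | n + 2 =>
    have h1 := ih (n + 1) (by omega)
    have h0 := ih n (by omega)
    -- The points (n + 2)P and nP are the sum and the difference of (n + 1)P and P. The division
    -- polynomials satisfy the same symmetric relations, and nP is known by induction, so (n + 2)P
    -- is determined.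
    obtain ⟨s, u, s', u', hs, hs', e1, e2, e3⟩ := exists_hasXRatio_add_sub h1
      (show HasXRatio (Affine.Point.some x y h) x 1 from
        .inr ⟨Affine.Point.some_ne_zero _, one_ne_zero, by simp⟩)
    rw [← succ_nsmul] at hs
    rw [succ_nsmul, add_sub_cancel_right] at hs'
    obtain ⟨c, hc, ea, eb⟩ := (hasXRatio_iff hs').mp h0
    have i1 := (divisionIdentities W (n + 1)).ΨSq_mul (by omega)
    have i2 : W.Φ ((n + 1 : ℕ) + 1) * W.Φ ((n + 1 : ℕ) - 1) = prodNum (W.map C) (W.Φ (n + 1 : ℕ) *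
        X)
        (W.Φ (n + 1 : ℕ) + X * W.ΨSq (n + 1 : ℕ)) (W.ΨSq (n + 1 : ℕ)) := by
      -- At index 1 the identity lies outside the range of `DivisionIdentities` and is checked
      -- directly.
      cases n with
      | zero =>
        simp [prodNum, WeierstrassCurve.Φ_two]
        rw [map_ofNat C 2]
        ring
      | succ n => exact (divisionIdentities W (n + 2)).Φ_mul (by omega)
    have i3 : W.Φ ((n + 1 : ℕ) + 1) * W.ΨSq ((n + 1 : ℕ) - 1) +
        W.Φ ((n + 1 : ℕ) - 1) * W.ΨSq ((n + 1 : ℕ) + 1) = sumNum (W.map C) (W.Φ (n + 1 : ℕ) * X)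
        (W.Φ (n + 1 : ℕ) + X * W.ΨSq (n + 1 : ℕ)) (W.ΨSq (n + 1 : ℕ)) := by
      cases n with
      | zero =>
        simp [sumNum, WeierstrassCurve.ΨSq_two, WeierstrassCurve.Ψ₂Sq]
        rw [map_ofNat C 2, map_ofNat C 4]
        ring
      | succ n => exact (divisionIdentities W (n + 2)).Φ_mul_ΨSq (by omega)
    rw [show ((n + 1 : ℕ) : ℤ) + 1 = ((n + 2 : ℕ) : ℤ) by push_cast; ring,
      show ((n + 1 : ℕ) : ℤ) - 1 = (n : ℤ) by push_cast; ring] at i1 i2 i3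
    have f1 := congrArg (eval x) i1
    have f2 := congrArg (eval x) i2
    have f3 := congrArg (eval x) i3
    have hmap : (W.map C).map (evalRingHom x) = W := by ext <;> simp
    rw [← coe_evalRingHom, map_prodNum, hmap] at f2
    rw [← coe_evalRingHom, map_sumNum, hmap] at f3
    simp only [coe_evalRingHom, eval_mul, eval_add, eval_X, eval_pow, eval_sub, mul_one] at *
    rw [mul_comm x] at f1 f2 f3
    rw [hasXRatio_iff hs]
    refine ⟨c⁻¹, inv_ne_zero hc, exists_mul_eq_of_symmetric (e1.trans f2.symm) (e2.trans f3.symm)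
      (e3.trans f1.symm) hs'.ne_zero hc ea eb⟩

end Multiples

/-! ### Valuations on function fields -/

section Valuations

/-- The coefficients of `W` are integral. -/
structure IntegralCoeffs {F Γ : Type*} [Field F] [LinearOrderedCommGroupWithZero Γ]
    (v : Valuation F Γ) (W : WeierstrassCurve F) : Prop where
  a₁ : v W.a₁ ≤ 1
  a₂ : v W.a₂ ≤ 1
  a₃ : v W.a₃ ≤ 1
  a₄ : v W.a₄ ≤ 1
  a₆ : v W.a₆ ≤ 1

variable {F Γ : Type*} [Field F] [LinearOrderedCommGroupWithZero Γ] {v : Valuation F Γ}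
  {W : WeierstrassCurve F}

lemma val_le_one_of_isTrivialOn {k : Type*} [Field k] [Algebra k F] [hv : v.IsTrivialOn k]
    (c : k) : v (algebraMap k F c) ≤ 1 := by
  by_cases hc : c = 0
  · simp [hc]
  · rw [hv.eq_one c hc]

lemma integralCoeffs_baseChange {k : Type*} [Field k] [Algebra k F] [hv : v.IsTrivialOn k]
    (W : WeierstrassCurve k) : IntegralCoeffs v (W.baseChange F) :=
  ⟨val_le_one_of_isTrivialOn _, val_le_one_of_isTrivialOn _, val_le_one_of_isTrivialOn _,
    val_le_one_of_isTrivialOn _, val_le_one_of_isTrivialOn _⟩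

/-- Where x has a pole, x³ dominates the right-hand side of the equation; v y ≤ v x would bound the
left-hand side by v(x)², so y² dominates there. -/
lemma one_lt_val_y {x y : F} (hW : IntegralCoeffs v W) (h : W.toAffine.Equation x y)
    (hx : 1 < v x) : v y ^ 2 = v x ^ 3 := by
  have e := equation_eq h
  have hx0 : 0 < v x := zero_lt_one.trans hx
  have h3 : v (x ^ 3 + W.a₂ * x ^ 2 + W.a₄ * x + W.a₆) = v x ^ 3 := by
    have l1 : v (W.a₆) < v x ^ 3 := hW.a₆.trans_lt (one_lt_pow₀ hx three_ne_zero)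
    have l2 : v (W.a₄ * x) < v x ^ 3 := by
      rw [map_mul]
      calc v W.a₄ * v x ≤ 1 * v x := mul_le_mul_left hW.a₄ _
        _ < v x ^ 3 := by rw [one_mul]; exact lt_self_pow₀ hx (by norm_num)
    have l3 : v (W.a₂ * x ^ 2) < v x ^ 3 := by
      rw [map_mul, map_pow]
      calc v W.a₂ * v x ^ 2 ≤ 1 * v x ^ 2 := mul_le_mul_left hW.a₂ _
        _ < v x ^ 3 := by rw [one_mul]; exact pow_lt_pow_right₀ hx (by norm_num)
    rw [add_assoc, add_assoc, Valuation.map_add_eq_of_lt_left, map_pow]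
    rw [map_pow]
    exact v.map_add_lt l3 (v.map_add_lt l2 l1)
  have hψ : v (W.a₁ * x + W.a₃) ≤ v x := by
    apply v.map_add_le
    · rw [map_mul]; exact (mul_le_mul_left hW.a₁ _).trans_eq (one_mul _)
    · exact hW.a₃.trans hx.le
  rw [show y ^ 2 + W.a₁ * x * y + W.a₃ * y = y ^ 2 + (W.a₁ * x + W.a₃) * y by ring] at e
  rw [← h3, ← e]
  by_cases hy : v y ≤ v x
  · exfalso
    have : v (y ^ 2 + (W.a₁ * x + W.a₃) * y) ≤ v x ^ 2 := by
      apply v.map_add_le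
      · rw [map_pow]; exact pow_le_pow_left' hy 2
      · rw [map_mul, sq]; exact mul_le_mul' hψ hy
    rw [e, h3] at this
    exact absurd this (not_le.mpr (pow_lt_pow_right₀ hx (by norm_num)))
  · push Not at hy
    rw [Valuation.map_add_eq_of_lt_left, map_pow]
    rw [map_pow, map_mul, sq]
    exact mul_lt_mul_of_pos_right (hψ.trans_lt hy) (hx0.trans hy)

end Valuations

/-! ### The place at infinity and the degree of the norm -/

section FunctionField

variable {k : Type*} [Field k] {W : WeierstrassCurve k} {Γ : Type*}
  [LinearOrderedCommGroupWithZero Γ] {v : Valuation W.toAffine.FunctionField Γ} [v.IsTrivialOn k]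

local notation "ι" => algebraMap W.toAffine.CoordinateRing W.toAffine.FunctionField

/-- A valuation with a pole of `x` is given by the degree of the norm. -/
lemma val_sq_eq (hx : 1 < v (genX W)) {a : W.toAffine.CoordinateRing} (ha : a ≠ 0) :
    v (ι a) ^ 2 = v (genX W) ^ (Algebra.norm k[X] a).natDegree := by
  obtain ⟨p, q, rfl, e⟩ := exists_eq_algebraMap a
  have hy := one_lt_val_y (integralCoeffs_baseChange (v := v) W) generic_equation hx
  have hn := Affine.CoordinateRing.degree_norm_smul_basis (W' := W.toAffine) p q
  rw [e]
  by_cases hq : q = 0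
  · have hp : p ≠ 0 := by rintro rfl; simp [hq] at ha
    subst hq
    have : (Algebra.norm k[X] (p • 1 + (0 : k[X]) •
        Affine.CoordinateRing.mk W.toAffine Y)).natDegree = p.natDegree * 2 := by
      rw [natDegree_eq_of_degree_eq_some]
      rw [hn, degree_eq_natDegree hp]
      simp
      norm_cast
      ring
    rw [this, map_zero, zero_mul, add_zero,
      valuation_aeval_eq_valuation_X_pow_natDegree_of_one_lt_valuation_X _ hx hp, ← pow_mul]
  have eq : v (aeval (genX W) q * genY W) ^ 2 = v (genX W) ^ (2 * q.natDegree + 3) := by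
    rw [map_mul, mul_pow, hy,
      valuation_aeval_eq_valuation_X_pow_natDegree_of_one_lt_valuation_X _ hx hq,
      ← pow_mul, ← pow_add, mul_comm q.natDegree]
  by_cases hp : p = 0
  · subst hp
    have : (Algebra.norm k[X] ((0 : k[X]) • 1 + q •
        Affine.CoordinateRing.mk W.toAffine Y)).natDegree = 2 * q.natDegree + 3 := by
      rw [natDegree_eq_of_degree_eq_some]
      rw [hn, degree_eq_natDegree hq]
      simp
    rw [this, map_zero, zero_add, eq]
  have ep : v (aeval (genX W) p) ^ 2 = v (genX W) ^ (2 * p.natDegree) := by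
    rw [valuation_aeval_eq_valuation_X_pow_natDegree_of_one_lt_valuation_X _ hx hp, ← pow_mul,
      mul_comm 2]
  have : (Algebra.norm k[X] (p • 1 + q •
      Affine.CoordinateRing.mk W.toAffine Y)).natDegree =
      max (2 * p.natDegree) (2 * q.natDegree + 3) := by
    rw [natDegree_eq_of_degree_eq_some]
    rw [hn, degree_eq_natDegree hq, degree_eq_natDegree hp]
    norm_cast
  rw [this]
  -- One degree is even and the other odd, so p and q·y never have the same value and cannot cancel.
  rcases lt_or_ge (2 * p.natDegree) (2 * q.natDegree + 3) with h | h
  · rw [max_eq_right h.le, ← eq, Valuation.map_add_eq_of_lt_right]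
    rw [← pow_lt_pow_iff_left₀ zero_le zero_le two_ne_zero, ep, eq]
    exact pow_lt_pow_right₀ hx h
  · have h : 2 * q.natDegree + 3 < 2 * p.natDegree := by omega
    rw [max_eq_left h.le, ← ep, Valuation.map_add_eq_of_lt_left]
    rw [← pow_lt_pow_iff_left₀ zero_le zero_le two_ne_zero, ep, eq]
    exact pow_lt_pow_right₀ hx h

lemma val_lt_val_iff (hx : 1 < v (genX W)) {a b : W.toAffine.CoordinateRing} (hb : b ≠ 0) :
    v (ι a) < v (ι b) ↔ (Algebra.norm k[X] a).degree < (Algebra.norm k[X] b).degree := by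
  have : Module.Finite k[X] W.toAffine.CoordinateRing :=
    .of_basis (Affine.CoordinateRing.basis W.toAffine)
  have : Module.Free k[X] W.toAffine.CoordinateRing :=
    .of_basis (Affine.CoordinateRing.basis W.toAffine)
  have hinj : Function.Injective ι := IsFractionRing.injective _ _
  have hb' : Algebra.norm k[X] b ≠ 0 := Algebra.norm_ne_zero_iff.mpr hb
  by_cases ha : a = 0
  · subst ha
    rw [map_zero, map_zero, Algebra.norm_zero, degree_zero]
    simp only [bot_lt_iff_ne_bot, ne_eq, degree_eq_bot, hb', not_false_iff, iff_true]
    exact zero_lt_iff.mpr ((Valuation.ne_zero_iff v).mpr ((map_ne_zero_iff _ hinj).mpr hb))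
  · have ha' : Algebra.norm k[X] a ≠ 0 := Algebra.norm_ne_zero_iff.mpr ha
    rw [← pow_lt_pow_iff_left₀ zero_le zero_le two_ne_zero, val_sq_eq hx ha,
      val_sq_eq hx hb, pow_lt_pow_iff_right₀ hx, degree_eq_natDegree ha', degree_eq_natDegree hb',
      Nat.cast_lt]

/-- This replaces the degree condition defining values at the origin by a valuation. Any valuation
trivial on constants with a pole of x will do, which later allows pulling back along embeddings of
function fields. -/
lemma hasValueAt_zero_iff (hx : 1 < v (genX W)) (f : W.toAffine.FunctionField) (c : k) :
    HasValueAt W .zero f c ↔ v (f - algebraMap k _ c) < 1 := by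
  have hinj : Function.Injective ι := IsFractionRing.injective _ _
  have key (a b : W.toAffine.CoordinateRing) (hb : b ≠ 0) :
      v (ι a / ι b - algebraMap k _ c) < 1 ↔ (Algebra.norm k[X]
        (a - algebraMap k W.toAffine.CoordinateRing c * b)).degree <
          (Algebra.norm k[X] b).degree := by
    have hb' : ι b ≠ 0 := (map_ne_zero_iff _ hinj).mpr hb
    have e : ι a / ι b - algebraMap k _ c =
        ι (a - algebraMap k W.toAffine.CoordinateRing c * b) / ι b := by
      rw [map_sub, map_mul, ← IsScalarTower.algebraMap_apply, sub_div, mul_div_cancel_right₀ _ hb']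
    rw [e, map_div₀, div_lt_one₀ (zero_lt_iff.mpr ((Valuation.ne_zero_iff v).mpr hb')),
      val_lt_val_iff hx hb]
  constructor
  · rintro ⟨a, b, hb, rfl, hab⟩
    exact (key a b hb).mpr hab
  · intro h
    obtain ⟨a, b, hb, rfl⟩ := IsFractionRing.div_surjective (A := W.toAffine.CoordinateRing) f
    have hb' := nonZeroDivisors.ne_zero hb
    exact ⟨a, b, hb', rfl, (key a b hb').mp h⟩

end FunctionField

/-- There is a place with a pole at a given transcendental function. -/
lemma exists_valuation_one_lt {k F : Type*} [Field k] [Field F] [Algebra k F] {t : F}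
    (ht : Transcendental k t) :
    ∃ V : ValuationSubring F, V.valuation.IsTrivialOn k ∧ 1 < V.valuation t := by
  have ht0 : t ≠ 0 := by rintro rfl; exact ht isAlgebraic_zero
  let A := Algebra.adjoin k {t⁻¹}
  let s : A := ⟨t⁻¹, Algebra.self_mem_adjoin_singleton k _⟩
  -- As t⁻¹ is transcendental, it is not a unit of k[t⁻¹], so some valuation ring containing k[t⁻¹]
  -- has t⁻¹ in its maximal ideal.
  have hI : Ideal.span {s} ≠ ⊤ := by
    rw [Ne, Ideal.span_singleton_eq_top]
    intro hu
    obtain ⟨r, hr⟩ := hu.exists_right_inv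
    have hr2 : (r : F) ∈ Algebra.adjoin k {t⁻¹} := r.2
    rw [Algebra.adjoin_singleton_eq_range_aeval] at hr2
    obtain ⟨p, hp⟩ := hr2
    have e : t⁻¹ * aeval t⁻¹ p = 1 := by
      have := congrArg Subtype.val hr
      change t⁻¹ * (r : F) = 1 at this
      rw [← this]
      congr 1
    have ht' : Transcendental k t⁻¹ := fun h => ht (IsAlgebraic.inv_iff.mp h)
    have := transcendental_iff.mp ht' (X * p - 1) (by simp [e])
    have := congrArg (eval 0) this
    simp at this
  obtain ⟨V, hAV, hV⟩ := Ideal.image_subset_nonunits_valuationSubring (A := A.toSubring)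
    (Ideal.span {s}) hI
  have hk (c : k) : algebraMap k F c ∈ V := hAV (A.algebraMap_mem c)
  refine ⟨V, ⟨fun c hc => ?_⟩, ?_⟩
  · have h1 := (V.valuation_le_one_iff _).mpr (hk c)
    have h2 := (V.valuation_le_one_iff _).mpr (hk c⁻¹)
    rw [map_inv₀, map_inv₀] at h2
    have h0 : V.valuation (algebraMap k F c) ≠ 0 := by simpa using hc
    exact le_antisymm h1 ((inv_le_one₀ (zero_lt_iff.mpr h0)).mp h2)
  · have := V.mem_nonunits_iff.mp (hV ⟨s, Ideal.subset_span rfl, rfl⟩)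
    change V.valuation t⁻¹ < 1 at this
    rw [map_inv₀] at this
    exact (inv_lt_one₀ (zero_lt_iff.mpr (by simpa using ht0))).mp this

/-! ### Reduction of points with respect to a valuation -/

section Reduction

variable {F Γ : Type*} [Field F] [LinearOrderedCommGroupWithZero Γ] (v : Valuation F Γ)
  {W : WeierstrassCurve F}

/-- The point `P` reduces to the origin without being the origin. -/
def HasPole (P : W.toAffine.Point) : Prop :=
  ∃ (x y : F) (h : W.toAffine.Nonsingular x y), P = .some x y h ∧ 1 < v x

/-- The point `P` reduces to `(a, b)`. -/
def ReducesTo (P : W.toAffine.Point) (a b : F) : Prop :=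
  ∃ (x y : F) (h : W.toAffine.Nonsingular x y), P = .some x y h ∧ v (x - a) < 1 ∧ v (y - b) < 1

variable {v}

lemma val_natCast_le (n : ℕ) : v (n : F) ≤ 1 := by
  induction n with
  | zero => simp
  | succ n ih => rw [Nat.cast_succ]; exact v.map_add_le ih (map_one v).le

lemma val_dY_le (hW : IntegralCoeffs v W) {a b : F} (ha : v a ≤ 1) (hb : v b ≤ 1) :
    v (dY W a b) ≤ 1 := by
  have h2 : v (2 : F) ≤ 1 := by exact_mod_cast val_natCast_le (v := v) 2
  refine v.map_add_le (v.map_add_le ?_ ?_) hW.a₃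
  · rw [map_mul]; exact mul_le_one' h2 hb
  · rw [map_mul]; exact mul_le_one' hW.a₁ ha

lemma val_dX_le (hW : IntegralCoeffs v W) {a b : F} (ha : v a ≤ 1) (hb : v b ≤ 1) :
    v (dX W a b) ≤ 1 := by
  have h2 : v (2 : F) ≤ 1 := by exact_mod_cast val_natCast_le (v := v) 2
  have h3 : v (3 : F) ≤ 1 := by exact_mod_cast val_natCast_le (v := v) 3
  refine v.map_sub_le (v.map_add_le (v.map_add_le ?_ ?_) hW.a₄) ?_
  · rw [map_mul, map_pow]; exact mul_le_one' h3 (pow_le_one' ha 2)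
  · rw [map_mul, map_mul]; exact mul_le_one' (mul_le_one' h2 hW.a₂) ha
  · rw [map_mul]; exact mul_le_one' hW.a₁ hb

variable [DecidableEq F]

/-- A point reducing to the origin does not change the reduction of an integral point. The chord has
slope l with v(l)² = v(x), and the chord relation at (a, b) bounds v(x - a)·v(x₃ - a) by v(l), which
forces v(x₃ - a) < 1. -/
lemma HasPole.add_reducesTo (hW : IntegralCoeffs v W) {P : W.toAffine.Point} (hP : HasPole v P)
    {a b : F} (h : W.toAffine.Nonsingular a b) (ha : v a ≤ 1) (hb : v b ≤ 1) :
    ReducesTo v (P + .some a b h) a b := by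
  obtain ⟨x, y, h', rfl, hx⟩ := hP
  have hxa : x ≠ a := by rintro rfl; exact absurd hx (not_lt.mpr ha)
  obtain ⟨l, x₃, y₃, h₃, e, ex, ey, hl, -, -, e₂⟩ := exists_add_eq h' h (fun h => hxa h.1)
  refine ⟨x₃, y₃, h₃, e, ?_⟩
  have hy2 := one_lt_val_y hW h'.1 hx
  have hx0 : 0 < v x := zero_lt_one.trans hx
  have hy : 1 < v y := by
    rw [← one_lt_pow_iff_of_nonneg zero_le two_ne_zero, hy2]
    exact one_lt_pow₀ hx three_ne_zero
  have hu : v (x - a) = v x := v.map_sub_eq_of_lt_left (ha.trans_lt hx)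
  have hw : v (y - b) = v y := v.map_sub_eq_of_lt_left (hb.trans_lt hy)
  have hl2 : v l ^ 2 = v x := by
    have := congrArg v hl
    rw [hw, map_mul, hu] at this
    rw [this, mul_pow, pow_succ (v x) 2, mul_comm] at hy2
    exact mul_left_cancel₀ (pow_ne_zero 2 hx0.ne') hy2
  have hl1 : 1 < v l := by
    rw [← one_lt_pow_iff_of_nonneg zero_le two_ne_zero, hl2]; exact hx
  have hl0 : 0 < v l := zero_lt_one.trans hl1
  have hM := val_dY_le hW ha hb
  have hN := val_dX_le hW ha hb
  have h3 : v (3 : F) ≤ 1 := by exact_mod_cast val_natCast_le (v := v) 3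
  have b1 : v (x - a) * v (x₃ - a) ≤ v l := by
    rw [← map_mul, show (x - a) * (x₃ - a) = (a - x) * (a - x₃) by ring, ← e₂]
    refine v.map_sub_le (hN.trans hl1.le) ?_
    rw [map_mul]
    exact mul_le_of_le_one_right' hM
  have b2 : v (x₃ - a) < 1 := by
    by_contra! hc
    have : v l ^ 2 ≤ v l := by
      rw [hl2, ← hu]
      exact (le_mul_of_one_le_right' hc).trans b1
    exact absurd this (not_le.mpr (lt_self_pow₀ hl1 (by norm_num)))
  refine ⟨b2, ?_⟩
  -- The previous bound only makes l(x₃ - a) integral; the y-coordinate needs its cancellation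
  -- against dY, obtained by multiplying the chord relation by l.
  have b3 : v (x - a) * v (l * (x₃ - a) + dY W a b) ≤ v l := by
    rw [← map_mul, show (x - a) * (l * (x₃ - a) + dY W a b) =
      l * dX W a b + dY W a b * (W.a₁ * l - W.a₂ - 3 * a - (x₃ - a)) by
        linear_combination (-l) * e₂ + dY W a b * ex]
    refine v.map_add_le ?_ ?_
    · rw [map_mul]; exact mul_le_of_le_one_right' hN
    · rw [map_mul]
      refine (mul_le_of_le_one_left' hM).trans ?_
      refine v.map_sub_le (v.map_sub_le (v.map_sub_le ?_ (hW.a₂.trans hl1.le)) ?_)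
        (b2.le.trans hl1.le)
      · rw [map_mul]; exact mul_le_of_le_one_left' hW.a₁
      · rw [map_mul]; exact (mul_le_one' h3 ha).trans hl1.le
  have b4 : v (l * (x₃ - a) + dY W a b) < 1 := by
    by_contra! hc
    have : v l ^ 2 ≤ v l := by
      rw [hl2, ← hu]
      exact (le_mul_of_one_le_right' hc).trans b3
    exact absurd this (not_le.mpr (lt_self_pow₀ hl1 (by norm_num)))
  have ey' : y₃ - b = -(l * (x₃ - a) + dY W a b) - W.a₁ * (x₃ - a) := by
    rw [ey]; simp only [dY]; linear_combination -hl
  rw [ey']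
  refine v.map_sub_lt ?_ ?_
  · rwa [Valuation.map_neg]
  · rw [map_mul]; exact (mul_le_of_le_one_left' hW.a₁).trans_lt b2

/-- The slope l of the chord through P and -(a, b) has a pole. If dY is a unit, the numerator y - b
+ dY is a unit over the small x - a; if dX is a unit, l(y - b) is a unit although y - b is small.
Then l² dominates x₃. The last hypothesis guarantees that the line is a chord. -/
lemma ReducesTo.hasPole_sub (hW : IntegralCoeffs v W) {P : W.toAffine.Point} {a b : F}
    (hP : ReducesTo v P a b) (h : W.toAffine.Nonsingular a b) (ha : v a ≤ 1) (hb : v b ≤ 1)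
    (hd : v (dY W a b) = 1 ∨ v (dX W a b) = 1)
    (hne : ∀ y h', P ≠ .some a y h') : HasPole v (P - .some a b h) := by
  obtain ⟨x, y, h', rfl, hx, hy⟩ := hP
  have hxa : x ≠ a := by rintro rfl; exact hne _ _ rfl
  have hn : W.toAffine.Nonsingular a (W.toAffine.negY a b) := (Affine.nonsingular_neg _ _).mpr h
  obtain ⟨l, x₃, y₃, h₃, e, ex, -, hl, -⟩ := exists_add_eq h' hn (fun h => hxa h.1)
  refine ⟨x₃, y₃, h₃, by rw [sub_eq_add_neg, Affine.Point.neg_some, e], ?_⟩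
  have hM := val_dY_le hW ha hb
  have hN := val_dX_le hW ha hb
  have h3 : v (3 : F) ≤ 1 := by exact_mod_cast val_natCast_le (v := v) 3
  have hl' : y - b + dY W a b = l * (x - a) := by
    rw [← hl, ← sub_negY_eq_dY]; ring
  have hl1 : 1 < v l := by
    by_contra! hc
    by_cases hd1 : v (dY W a b) = 1
    · have h1 : v (y - b + dY W a b) = 1 := by
        rw [Valuation.map_add_eq_of_lt_right, hd1]; rwa [hd1]
      rw [hl', map_mul] at h1
      exact absurd h1 (ne_of_lt ((mul_le_of_le_one_left' hc).trans_lt hx))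
    · have hd2 := hd.resolve_left hd1
      have e4 : l * (y - b) = dX W a b + ((x - a) * (x - a + 3 * a + W.a₂) - W.a₁ * (y - b)) := by
        apply mul_right_cancel₀ (sub_ne_zero.mpr hxa)
        have q₁ := equation_eq h'.1
        have q₂ := equation_eq h.1
        simp only [dX, dY] at hl' ⊢
        linear_combination (-(y - b)) * hl' + q₁ - q₂
      have h1 : v (dX W a b + ((x - a) * (x - a + 3 * a + W.a₂) - W.a₁ * (y - b))) = 1 := by
        rw [Valuation.map_add_eq_of_lt_left, hd2]
        rw [hd2]
        refine v.map_sub_lt ?_ ?_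
        · rw [map_mul]
          refine (mul_le_of_le_one_right' ?_).trans_lt hx
          refine v.map_add_le (v.map_add_le hx.le ?_) hW.a₂
          rw [map_mul]; exact mul_le_one' h3 ha
        · rw [map_mul]; exact (mul_le_of_le_one_left' hW.a₁).trans_lt hy
      rw [← e4, map_mul] at h1
      exact absurd h1 (ne_of_lt ((mul_le_of_le_one_left' hc).trans_lt hy))
  have hx1 : v x ≤ 1 := by
    rw [show x = (x - a) + a by ring]; exact v.map_add_le hx.le ha
  have e5 : x₃ = l * (l + W.a₁) + -(W.a₂ + x + a) := by rw [ex]; ring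
  have h6 : v (l * (l + W.a₁)) = v l ^ 2 := by
    rw [map_mul, Valuation.map_add_eq_of_lt_left, sq]
    exact hW.a₁.trans_lt hl1
  have h7 : 1 < v l ^ 2 := one_lt_pow₀ hl1 two_ne_zero
  rw [e5, Valuation.map_add_eq_of_lt_left, h6]
  · exact h7
  · rw [h6, Valuation.map_neg]
    exact (v.map_add_le (v.map_add_le hW.a₂ hx1) ha).trans_lt h7

end Reduction

/-! ### The local ring at an affine point -/

section LocalRing

variable {k : Type u} [Field k] {W : WeierstrassCurve k}

local notation "ι" => algebraMap W.toAffine.CoordinateRing W.toAffine.FunctionField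

/-- Evaluation of elements of the coordinate ring at a point. -/
def evalAt {x y : k} (h : W.toAffine.Equation x y) : W.toAffine.CoordinateRing →+* k :=
  AdjoinRoot.lift (evalRingHom x) y (by rw [eval₂_evalRingHom]; exact h)

@[simp] lemma evalAt_mk {x y : k} (h : W.toAffine.Equation x y) (p : k[X][Y]) :
    evalAt h (Affine.CoordinateRing.mk W.toAffine p) = p.evalEval x y := by
  rw [evalAt, AdjoinRoot.lift_mk, eval₂_evalRingHom]

lemma evalAt_algebraMap {x y : k} (h : W.toAffine.Equation x y) (c : k) :
    evalAt h (algebraMap k _ c) = c := by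
  change evalAt h (Affine.CoordinateRing.mk W.toAffine (C (C c))) = c
  rw [evalAt_mk]
  simp

variable {x y : k} {h : W.toAffine.Nonsingular x y}

lemma hasValueAt_some_iff {f : W.toAffine.FunctionField} {c : k} :
    HasValueAt W (.some x y h) f c ↔ ∃ a b : W.toAffine.CoordinateRing, evalAt h.1 b ≠ 0 ∧
      f * ι b = ι a ∧ evalAt h.1 a = c * evalAt h.1 b := by
  have hinj : Function.Injective ι := IsFractionRing.injective _ _
  constructor
  · rintro ⟨p, q, hq, rfl, rfl⟩
    refine ⟨Affine.CoordinateRing.mk W.toAffine p, Affine.CoordinateRing.mk W.toAffine q,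
      by simpa using hq, ?_, ?_⟩
    · rw [div_mul_cancel₀]
      rintro h0
      rw [map_eq_zero_iff _ hinj] at h0
      apply hq
      rw [← evalAt_mk h.1, h0, map_zero]
    · simp only [evalAt_mk]
      rw [div_mul_cancel₀ _ hq]
  · rintro ⟨a, b, hb, e1, e2⟩
    obtain ⟨p, rfl⟩ := AdjoinRoot.mk_surjective a
    obtain ⟨q, rfl⟩ := AdjoinRoot.mk_surjective b
    have hb0 : ι (AdjoinRoot.mk _ q) ≠ 0 := by
      rw [Ne, map_eq_zero_iff _ hinj]
      intro h0; rw [h0, map_zero] at hb; exact hb rfl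
    have eq := evalAt_mk h.1 q
    have ep := evalAt_mk h.1 p
    rw [Affine.CoordinateRing.mk] at eq ep
    rw [eq] at e2 hb
    rw [ep] at e2
    exact ⟨p, q, hb, by rw [eq_div_iff hb0]; exact e1, by rw [e2, mul_div_cancel_right₀ _ hb]⟩

lemma HasValueAt.coordinateRing (a : W.toAffine.CoordinateRing) :
    HasValueAt W (.some x y h) (ι a) (evalAt h.1 a) :=
  hasValueAt_some_iff.mpr ⟨a, 1, by simp, by simp, by simp⟩

lemma HasValueAt.const (c : k) :
    HasValueAt W (.some x y h) (algebraMap k _ c) c := by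
  have := HasValueAt.coordinateRing (h := h) (algebraMap k W.toAffine.CoordinateRing c)
  rwa [evalAt_algebraMap, ← IsScalarTower.algebraMap_apply] at this

lemma HasValueAt.coordX : HasValueAt W (.some x y h) (genX W) x := by
  have := HasValueAt.coordinateRing (h := h) (Affine.CoordinateRing.mk W.toAffine (C X))
  rw [evalAt_mk, evalEval_C, eval_X] at this
  exact this

lemma HasValueAt.coordY : HasValueAt W (.some x y h) (genY W) y := by
  have := HasValueAt.coordinateRing (h := h) (Affine.CoordinateRing.mk W.toAffine Y)
  rw [evalAt_mk, evalEval_X] at this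
  exact this

variable {f g : W.toAffine.FunctionField} {c d : k}

lemma HasValueAt.add (hf : HasValueAt W (.some x y h) f c) (hg : HasValueAt W (.some x y h) g d) :
    HasValueAt W (.some x y h) (f + g) (c + d) := by
  obtain ⟨a, b, hb, e1, e2⟩ := hasValueAt_some_iff.mp hf
  obtain ⟨a', b', hb', e1', e2'⟩ := hasValueAt_some_iff.mp hg
  refine hasValueAt_some_iff.mpr ⟨a * b' + a' * b, b * b', ?_, ?_, ?_⟩
  · rw [map_mul]; exact mul_ne_zero hb hb'
  · simp only [map_add, map_mul, ← e1, ← e1']; ring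
  · simp only [map_add, map_mul, e2, e2']; ring

lemma HasValueAt.mul (hf : HasValueAt W (.some x y h) f c) (hg : HasValueAt W (.some x y h) g d) :
    HasValueAt W (.some x y h) (f * g) (c * d) := by
  obtain ⟨a, b, hb, e1, e2⟩ := hasValueAt_some_iff.mp hf
  obtain ⟨a', b', hb', e1', e2'⟩ := hasValueAt_some_iff.mp hg
  refine hasValueAt_some_iff.mpr ⟨a * a', b * b', ?_, ?_, ?_⟩
  · rw [map_mul]; exact mul_ne_zero hb hb'
  · simp only [map_mul, ← e1, ← e1']; ring
  · simp only [map_mul, e2, e2']; ring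

lemma HasValueAt.sub (hf : HasValueAt W (.some x y h) f c) (hg : HasValueAt W (.some x y h) g d) :
    HasValueAt W (.some x y h) (f - g) (c - d) := by
  have := hf.add ((HasValueAt.const (-1)).mul hg)
  rwa [map_neg, map_one, neg_one_mul, neg_one_mul, ← sub_eq_add_neg, ← sub_eq_add_neg] at this

lemma HasValueAt.pow (hf : HasValueAt W (.some x y h) f c) (n : ℕ) :
    HasValueAt W (.some x y h) (f ^ n) (c ^ n) := by
  induction n with
  | zero => simpa using HasValueAt.const (h := h) 1
  | succ n ih => rw [pow_succ, pow_succ]; exact ih.mul hf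

lemma HasValueAt.ne_zero (hf : HasValueAt W (.some x y h) f c) (hc : c ≠ 0) : f ≠ 0 := by
  obtain ⟨a, b, hb, e1, e2⟩ := hasValueAt_some_iff.mp hf
  rintro rfl
  rw [zero_mul, eq_comm, map_eq_zero_iff _ (IsFractionRing.injective _ _)] at e1
  rw [e1, map_zero] at e2
  exact mul_ne_zero hc hb e2.symm

lemma HasValueAt.inv (hf : HasValueAt W (.some x y h) f c) (hc : c ≠ 0) :
    HasValueAt W (.some x y h) f⁻¹ c⁻¹ := by
  have hf0 := hf.ne_zero hc
  obtain ⟨a, b, hb, e1, e2⟩ := hasValueAt_some_iff.mp hf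
  refine hasValueAt_some_iff.mpr ⟨b, a, ?_, ?_, ?_⟩
  · rw [e2]; exact mul_ne_zero hc hb
  · rw [← e1, inv_mul_cancel_left₀ hf0]
  · rw [e2, inv_mul_cancel_left₀ hc]

lemma HasValueAt.div (hf : HasValueAt W (.some x y h) f c) (hg : HasValueAt W (.some x y h) g d)
    (hd : d ≠ 0) : HasValueAt W (.some x y h) (f / g) (c / d) := by
  rw [div_eq_mul_inv, div_eq_mul_inv]; exact hf.mul (hg.inv hd)

lemma HasValueAt.polynomial (hf : HasValueAt W (.some x y h) f c) (p : k[X]) :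
    HasValueAt W (.some x y h) (aeval f p) (p.eval c) := by
  induction p using Polynomial.induction_on' with
  | add p q hp hq => rw [map_add, eval_add]; exact hp.add hq
  | monomial n a =>
    rw [aeval_monomial, eval_monomial]
    exact (HasValueAt.const a).mul (hf.pow n)

/-- A morphism sends a point to the point whose coordinates are the values of its coordinates. -/
lemma sends_some {W' : WeierstrassCurve k} {a b : k} {h' : W'.toAffine.Nonsingular a b}
    (φ : W'.toAffine.FunctionField →ₐ[k] W.toAffine.FunctionField)
    (ha : HasValueAt W (.some x y h) (φ (genX W')) a)
    (hb : HasValueAt W (.some x y h) (φ (genY W')) b) :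
    Sends φ (.some x y h) (.some a b h') := by
  have key (p : k[X][Y]) : HasValueAt W (.some x y h) (φ (algebraMap _ _
      (Affine.CoordinateRing.mk W'.toAffine p))) (p.evalEval a b) := by
    induction p using Polynomial.induction_on' with
    | add p q hp hq => simp only [map_add, evalEval_add]; exact hp.add hq
    | monomial n p =>
      rw [← C_mul_X_pow_eq_monomial, map_mul, map_mul, map_mul, map_pow, map_pow, map_pow,
        algebraMap_mk, evalEval_mul, evalEval_pow, evalEval_X, evalEval_C, ← aeval_algHom_apply]
      exact (ha.polynomial p).mul (hb.pow n)
  rintro f c ⟨p, q, hq, rfl, rfl⟩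
  rw [map_div₀]
  exact (key p).div (key q) hq

variable (h) in
-- A Taylor expansion to first order: the functions vanishing at the point form the ideal generated
-- by x - x(P) and y - y(P).
lemma exists_decomposition (a : W.toAffine.CoordinateRing) :
    ∃ (r : k) (b : W.toAffine.CoordinateRing), ι a = algebraMap k _ (evalAt h.1 a) +
      algebraMap k _ r * (genY W - algebraMap k _ y) +
      (genX W - algebraMap k _ x) * ι b := by
  obtain ⟨p, q, rfl, -⟩ := exists_eq_algebraMap a
  have hp := mul_divByMonic_eq_iff_isRoot (p := p - C (p.eval x)) (a := x) |>.mpr (by simp)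
  have hq := mul_divByMonic_eq_iff_isRoot (p := q - C (q.eval x)) (a := x) |>.mpr (by simp)
  have e1 : p = C (p.eval x) + (X - C x) * ((p - C (p.eval x)) /ₘ (X - C x)) := by rw [hp]; ring
  have e2 : q = C (q.eval x) + (X - C x) * ((q - C (q.eval x)) /ₘ (X - C x)) := by rw [hq]; ring
  generalize (p - C (p.eval x)) /ₘ (X - C x) = p₁ at e1
  generalize (q - C (q.eval x)) /ₘ (X - C x) = q₁ at e2
  refine ⟨q.eval x, p₁ • 1 + q₁ • Affine.CoordinateRing.mk W.toAffine Y, ?_⟩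
  have f1 := congrArg (aeval (genX W)) e1
  have f2 := congrArg (aeval (genX W)) e2
  simp only [map_add, map_mul, map_sub, aeval_X, aeval_C] at f1 f2
  have e (p q : k[X]) : ι (p • 1 + q • Affine.CoordinateRing.mk W.toAffine Y) =
      aeval (genX W) p +
        aeval (genX W) q * genY W := by
    rw [map_add, Affine.CoordinateRing.smul, Affine.CoordinateRing.smul, map_mul, map_mul,
      algebraMap_mk, algebraMap_mk, map_one, mul_one]
    rfl
  have e' : evalAt h.1 (p • 1 + q • Affine.CoordinateRing.mk W.toAffine Y) =
      p.eval x + q.eval x * y := by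
    rw [Affine.CoordinateRing.smul, Affine.CoordinateRing.smul, mul_one, map_add, map_mul,
      evalAt_mk, evalAt_mk, evalAt_mk, evalEval_C, evalEval_C, evalEval_X]
  rw [e, e, e', f1, f2, map_add, map_mul]
  ring

variable {Γ : Type*} [LinearOrderedCommGroupWithZero Γ] {v : Valuation W.toAffine.FunctionField Γ}
  [hv : v.IsTrivialOn k]

/-- A place of the function field centred at a point respects values at that point. -/
lemma HasValueAt.val_sub_lt (hx : v (genX W - algebraMap k _ x) < 1)
    (hy : v (genY W - algebraMap k _ y) < 1) (hf : HasValueAt W (.some x y h) f c) :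
    v (f - algebraMap k _ c) < 1 := by
  have hx1 : v (genX W) ≤ 1 := by
    rw [← sub_add_cancel (genX W) (algebraMap k _ x)]
    exact v.map_add_le hx.le (val_le_one_of_isTrivialOn x)
  have hy1 : v (genY W) ≤ 1 := by
    rw [← sub_add_cancel (genY W) (algebraMap k _ y)]
    exact v.map_add_le hy.le (val_le_one_of_isTrivialOn y)
  have hp (p : k[X]) : v (aeval (genX W) p) ≤ 1 := by
    rw [aeval_eq_sum_range]
    refine v.map_sum_le fun i _ => ?_
    rw [Algebra.smul_def, map_mul, map_pow]
    exact mul_le_one' (val_le_one_of_isTrivialOn _) (pow_le_one' hx1 _)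
  have h1 (a : W.toAffine.CoordinateRing) : v (ι a) ≤ 1 := by
    obtain ⟨p, q, -, e⟩ := exists_eq_algebraMap a
    rw [e]
    refine v.map_add_le (hp p) ?_
    rw [map_mul]; exact mul_le_one' (hp q) hy1
  have h2 (a : W.toAffine.CoordinateRing) : v (ι a - algebraMap k _ (evalAt h.1 a)) < 1 := by
    obtain ⟨r, b, e⟩ := exists_decomposition h a
    rw [e, add_assoc, add_sub_cancel_left]
    refine v.map_add_lt ?_ ?_
    · rw [map_mul]; exact (mul_le_of_le_one_left' (val_le_one_of_isTrivialOn _)).trans_lt hy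
    · rw [map_mul]; exact (mul_le_of_le_one_right' (h1 b)).trans_lt hx
  obtain ⟨a, b, hb, e1, e2⟩ := hasValueAt_some_iff.mp hf
  have hb1 : v (ι b) = 1 := by
    rw [← sub_add_cancel (ι b) (algebraMap k _ (evalAt h.1 b)),
      Valuation.map_add_eq_of_lt_right, hv.eq_one _ hb]
    rw [hv.eq_one _ hb]; exact h2 b
  have e3 : (f - algebraMap k _ c) * ι b = ι a - algebraMap k _ (evalAt h.1 a) -
      algebraMap k _ c * (ι b - algebraMap k _ (evalAt h.1 b)) := by
    rw [sub_mul, e1, e2, map_mul]; ring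
  have e4 : v (f - algebraMap k _ c) = v ((f - algebraMap k _ c) * ι b) := by
    rw [map_mul, hb1, mul_one]
  rw [e4, e3]
  refine v.map_sub_lt (h2 a) ?_
  rw [map_mul]; exact (mul_le_of_le_one_left' (val_le_one_of_isTrivialOn _)).trans_lt (h2 b)

lemma equation_sub {F : Type*} [Field F] {W : WeierstrassCurve F} {x y a b : F}
    (h : W.toAffine.Equation x y) (h' : W.toAffine.Equation a b) :
    (y - b) * (y - b + W.a₁ * (x - a) + dY W a b) =
      (x - a) * ((x - a) ^ 2 + (3 * a + W.a₂) * (x - a) + dX W a b) := by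
  have q₁ := equation_eq h
  have q₂ := equation_eq h'
  simp only [dX, dY]
  linear_combination q₁ - q₂

lemma map_dY {F K : Type*} [Field F] [Field K] {W : WeierstrassCurve F} (f : F →+* K) (a b : F) :
    f (dY W a b) = dY (W.map f) (f a) (f b) := by
  simp [dY, map_ofNat]

lemma map_dX {F K : Type*} [Field F] [Field K] {W : WeierstrassCurve F} (f : F →+* K) (a b : F) :
    f (dX W a b) = dX (W.map f) (f a) (f b) := by
  simp [dX, map_ofNat]

lemma generic_equation_sub (h : W.toAffine.Equation x y) :
    (genY W - algebraMap k _ y) * (genY W - algebraMap k _ y +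
      algebraMap k _ W.a₁ * (genX W - algebraMap k _ x) + algebraMap k _ (dY W x y)) =
    (genX W - algebraMap k _ x) * ((genX W - algebraMap k _ x) ^ 2 + algebraMap k _ (3 * x + W.a₂) *
      (genX W - algebraMap k _ x) + algebraMap k _ (dX W x y)) := by
  have e := equation_sub (generic_equation (W := W))
    (Affine.Equation.map (algebraMap k W.toAffine.FunctionField) h)
  rw [map_dX, map_dY, map_add, map_mul, map_ofNat]
  exact e

variable (h) in
/-- The local ring at a nonsingular point has a uniformizer. -/
lemma exists_uniformizer : ∃ (t r₁ r₂ r₃ : W.toAffine.FunctionField) (c₁ c₂ c₃ : k),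
    HasValueAt W (.some x y h) t 0 ∧ HasValueAt W (.some x y h) r₁ c₁ ∧
    HasValueAt W (.some x y h) r₂ c₂ ∧ HasValueAt W (.some x y h) r₃ c₃ ∧ t ≠ 0 ∧
    genX W - algebraMap k _ x = t * r₁ ∧ genY W - algebraMap k _ y = t * r₂ ∧
    t ^ 2 = (genX W - algebraMap k _ x) * r₃ := by
  have hX : HasValueAt W (.some x y h) (genX W - algebraMap k _ x) 0 := by
    simpa using (HasValueAt.coordX (h := h)).sub (HasValueAt.const x)
  have hY : HasValueAt W (.some x y h) (genY W - algebraMap k _ y) 0 := by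
    simpa using (HasValueAt.coordY (h := h)).sub (HasValueAt.const y)
  have hX0 : genX W - algebraMap k _ x ≠ 0 := by
    rw [sub_ne_zero]
    intro h0
    exact transcendental_genX (W := W) (h0 ▸ isAlgebraic_algebraMap x)
  obtain ⟨X₀, hX₀⟩ : ∃ X₀, X₀ = genX W - algebraMap k _ x := ⟨_, rfl⟩
  obtain ⟨Y₀, hY₀⟩ : ∃ Y₀, Y₀ = genY W - algebraMap k _ y := ⟨_, rfl⟩
  have e := generic_equation_sub h.1
  rw [← hX₀] at hX hX0 e ⊢
  rw [← hY₀] at hY e ⊢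
  have hM : HasValueAt W (.some x y h) (Y₀ + algebraMap k _ W.a₁ * X₀ + algebraMap k _ (dY W x y))
      (dY W x y) := by
    simpa using (hY.add ((HasValueAt.const W.a₁).mul hX)).add (HasValueAt.const (dY W x y))
  have hN : HasValueAt W (.some x y h)
      (X₀ ^ 2 + algebraMap k _ (3 * x + W.a₂) * X₀ + algebraMap k _ (dX W x y)) (dX W x y) := by
    simpa using ((hX.pow 2).add ((HasValueAt.const (3 * x + W.a₂)).mul hX)).add
      (HasValueAt.const (dX W x y))
  -- If dY ≠ 0, then x - x(P) is a uniformizer; otherwise dX ≠ 0 by nonsingularity and y - y(P) is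
  -- one.
  by_cases hd : dY W x y = 0
  · have hd' := (dY_ne_zero_or_dX_ne_zero h).resolve_left (not_not.mpr hd)
    rw [hd, map_zero, add_zero] at e
    have hN0 := hN.ne_zero hd'
    have hw : HasValueAt W (.some x y h) (Y₀ + algebraMap k _ W.a₁ * X₀) 0 := by
      simpa using hY.add ((HasValueAt.const W.a₁).mul hX)
    have hr := hw.div hN hd'
    have e' : X₀ = Y₀ * ((Y₀ + algebraMap k _ W.a₁ * X₀) /
        (X₀ ^ 2 + algebraMap k _ (3 * x + W.a₂) * X₀ + algebraMap k _ (dX W x y))) := by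
      rw [← mul_div_assoc, e, mul_div_cancel_right₀ _ hN0]
    have h1 : HasValueAt W (.some x y h) 1 1 := by simpa using HasValueAt.const (h := h) 1
    have hs := hN.sub ((HasValueAt.const W.a₁).mul hY)
    refine ⟨Y₀, _, 1, _, _, 1, _, hY, hr, h1, hs, ?_, e', (mul_one _).symm, ?_⟩
    · intro h0; rw [h0, zero_mul] at e'; exact hX0 e'
    · linear_combination e
  · have hM0 := hM.ne_zero hd
    have h1 : HasValueAt W (.some x y h) 1 1 := by simpa using HasValueAt.const (h := h) 1
    have hs := hN.div hM hd
    refine ⟨X₀, 1, _, X₀, 1, _, 0, hX, h1, hs, hX, hX0, (mul_one _).symm, ?_, sq _⟩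
    rw [← mul_div_assoc, ← e, mul_div_cancel_right₀ _ hM0]

/-- The local ring at a nonsingular point is a valuation ring: it contains every function that is
integral at a place centred at the point. -/
lemma hasValueAt_of_val_sub_lt (hx : v (genX W - algebraMap k _ x) < 1)
    (hy : v (genY W - algebraMap k _ y) < 1) (hf : v (f - algebraMap k _ c) < 1) :
    HasValueAt W (.some x y h) f c := by
  obtain ⟨t, r₁, r₂, r₃, c₁, c₂, c₃, ht, hr₁, hr₂, hr₃, ht0, e₁, e₂, e₃⟩ := exists_uniformizer h
  have hdvd (g : W.toAffine.FunctionField) (hg : HasValueAt W (.some x y h) g 0) :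
      ∃ g' d, HasValueAt W (.some x y h) g' d ∧ g = t * g' := by
    obtain ⟨a, b, hb, e4, e5⟩ := hasValueAt_some_iff.mp hg
    obtain ⟨r, a', ea⟩ := exists_decomposition h a
    have hb' := HasValueAt.coordinateRing (h := h) b
    rw [zero_mul] at e5
    rw [e5, map_zero, zero_add, ← e4, e₁, e₂] at ea
    refine ⟨_, _, (((HasValueAt.const r).mul hr₂).add
      (hr₁.mul (HasValueAt.coordinateRing a'))).div hb' hb, ?_⟩
    rw [← mul_div_assoc, eq_div_iff (hb'.ne_zero hb), ea]
    ring
  have hvt : v t < 1 := by simpa using ht.val_sub_lt hx hy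
  have hf1 : v f ≤ 1 := by
    rw [← sub_add_cancel f (algebraMap k _ c)]
    exact v.map_add_le hf.le (val_le_one_of_isTrivialOn c)
  -- If t^(e+1)·f is regular, its valuation is below 1, so its value at the point is 0 and one
  -- factor t can be divided off.
  have key (e : ℕ) : (∃ d, HasValueAt W (.some x y h) (t ^ e * f) d) →
      ∃ d, HasValueAt W (.some x y h) f d := by
    induction e with
    | zero => rintro ⟨d, hd⟩; exact ⟨d, by simpa using hd⟩
    | succ e ih =>
      rintro ⟨d, hd⟩
      have hlt : v (t ^ (e + 1) * f) < 1 := by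
        rw [map_mul, map_pow]
        exact (mul_le_of_le_one_right' hf1).trans_lt (pow_lt_one₀ zero_le hvt e.succ_ne_zero)
      have hd0 : d = 0 := by
        by_contra hd0
        have := v.map_sub_lt hlt (hd.val_sub_lt hx hy)
        rw [sub_sub_cancel, hv.eq_one _ hd0] at this
        exact this.false
      subst hd0
      obtain ⟨g', d', hg', e'⟩ := hdvd _ hd
      apply ih
      refine ⟨d', ?_⟩
      rw [pow_succ', mul_assoc] at e'
      rwa [mul_left_cancel₀ ht0 e']
  obtain ⟨d, hd⟩ : ∃ d, HasValueAt W (.some x y h) f d := by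
    obtain ⟨a, b, hb, rfl⟩ := IsFractionRing.div_surjective (A := W.toAffine.CoordinateRing) f
    have hb := nonZeroDivisors.ne_zero hb
    have hinj : Function.Injective ι := IsFractionRing.injective _ _
    have hb0 : ι b ≠ 0 := (map_ne_zero_iff _ hinj).mpr hb
    have : Module.Finite k[X] W.toAffine.CoordinateRing :=
      .of_basis (Affine.CoordinateRing.basis W.toAffine)
    have : Module.Free k[X] W.toAffine.CoordinateRing :=
      .of_basis (Affine.CoordinateRing.basis W.toAffine)
    have hN : Algebra.norm k[X] b ≠ 0 := Algebra.norm_ne_zero_iff.mpr hb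
    obtain ⟨b', hb'⟩ : ∃ b', Affine.CoordinateRing.mk W.toAffine (C (Algebra.norm k[X] b)) =
        b * b' := by
      obtain ⟨p, q, rfl⟩ := Affine.CoordinateRing.exists_smul_basis_eq b
      refine ⟨Affine.CoordinateRing.mk W.toAffine
        (C p + C q * (-(Y : k[X][Y]) - C (C W.a₁ * X + C W.a₃))), ?_⟩
      have := Affine.CoordinateRing.coe_norm_smul_basis (W' := W.toAffine) p q
      refine this.trans ?_
      rw [map_mul, Affine.CoordinateRing.smul, Affine.CoordinateRing.smul, mul_one, map_add,
        map_mul]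
    obtain ⟨u, hu, hu'⟩ := exists_eq_pow_rootMultiplicity_mul_and_not_dvd _ hN x
    set e := rootMultiplicity x (Algebra.norm k[X] b)
    rw [dvd_iff_isRoot] at hu'
    have hb'' := congrArg ι hb'
    rw [algebraMap_mk, hu, map_mul, map_mul, map_pow, map_sub, aeval_X, aeval_C] at hb''
    have hU := (HasValueAt.coordX (h := h)).polynomial u
    have hX0 : genX W - algebraMap k _ x ≠ 0 := by
      rw [sub_ne_zero]
      intro h0
      exact transcendental_genX (W := W) (h0 ▸ isAlgebraic_algebraMap x)
    -- The denominator b divides its norm (X - x)^e·u with u(x) ≠ 0, and t² = (X - x)·r₃; so t^(2e)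
    -- clears the denominator of a/b, leaving r₃^e·a·b'/u.
    apply key (2 * e)
    refine ⟨c₃ ^ e * evalAt h.1 a * evalAt h.1 b' / u.eval x, ?_⟩
    convert! (((hr₃.pow e).mul (HasValueAt.coordinateRing a)).mul
      (HasValueAt.coordinateRing b')).div hU hu' using 1
    rw [eq_div_iff (hU.ne_zero hu'), ← mul_div_assoc, div_mul_eq_mul_div, div_eq_iff hb0, pow_mul,
      e₃, mul_pow]
    linear_combination r₃ ^ e * ι a * hb''
  have := v.map_sub_lt hf (hd.val_sub_lt hx hy)
  rw [sub_sub_sub_cancel_left, ← map_sub] at this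
  by_contra hne
  have hcd : d ≠ c := by rintro rfl; exact hne hd
  rw [hv.eq_one _ (sub_ne_zero.mpr hcd)] at this
  exact this.false

/-- There is a place centred at a given point. -/
lemma exists_valuation_center (h : W.toAffine.Nonsingular x y) : ∃ V : ValuationSubring
    W.toAffine.FunctionField,
    V.valuation.IsTrivialOn k ∧ V.valuation (genX W - algebraMap k _ x) < 1 ∧
      V.valuation (genY W - algebraMap k _ y) < 1 := by
  have hinj : Function.Injective ι := IsFractionRing.injective _ _
  let e : W.toAffine.CoordinateRing ≃+* (algebraMap W.toAffine.CoordinateRing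
    W.toAffine.FunctionField).range := RingEquiv.ofLeftInverse (Function.leftInverse_invFun hinj)
  let I := RingHom.ker ((evalAt h.1).comp e.symm.toRingHom)
  obtain ⟨V, hAV, hV⟩ := Ideal.image_subset_nonunits_valuationSubring I (RingHom.ker_ne_top _)
  have hk (c : k) : algebraMap k W.toAffine.FunctionField c ∈ V :=
    hAV ⟨algebraMap k _ c, (IsScalarTower.algebraMap_apply _ _ _ _).symm⟩
  have key (a : W.toAffine.CoordinateRing) (ha : evalAt h.1 a = 0) : V.valuation (ι a) < 1 := by
    refine V.mem_nonunits_iff.mp (hV ⟨e a, ?_, rfl⟩)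
    change evalAt h.1 (e.symm (e a)) = 0
    rw [e.symm_apply_apply, ha]
  refine ⟨V, ⟨fun c hc => ?_⟩, ?_, ?_⟩
  · have h1 := (V.valuation_le_one_iff _).mpr (hk c)
    have h2 := (V.valuation_le_one_iff _).mpr (hk c⁻¹)
    rw [map_inv₀, map_inv₀] at h2
    have h0 : V.valuation (algebraMap k W.toAffine.FunctionField c) ≠ 0 := by simpa using hc
    exact le_antisymm h1 ((inv_le_one₀ (zero_lt_iff.mpr h0)).mp h2)
  · have := key (Affine.CoordinateRing.mk W.toAffine (C X) - algebraMap k _ x) (by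
      rw [map_sub, evalAt_mk, evalAt_algebraMap, evalEval_C, eval_X, sub_self])
    rwa [map_sub, ← IsScalarTower.algebraMap_apply] at this
  · have := key (Affine.CoordinateRing.mk W.toAffine Y - algebraMap k _ y) (by
      rw [map_sub, evalAt_mk, evalAt_algebraMap, evalEval_X, sub_self])
    rwa [map_sub, ← IsScalarTower.algebraMap_apply] at this

end LocalRing

/-! ### Multiplication by `m` as an isogeny -/

instance isElliptic_baseChange {k F : Type*} [Field k] [Field F] [Algebra k F]
    (W : WeierstrassCurve k) [W.IsElliptic] : (W.baseChange F).IsElliptic :=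
  inferInstanceAs (W.map (algebraMap k F)).IsElliptic

section EvalBaseChange

variable {k F : Type*} [Field k] [Field F] [Algebra k F] {W : WeierstrassCurve k}

lemma eval_baseChange_Φ (x : F) (m : ℤ) :
    ((W.baseChange F).Φ m).eval x = aeval x (W.Φ m) := by
  rw [baseChange, map_Φ, eval_map_algebraMap]

lemma eval_baseChange_ΨSq (x : F) (m : ℤ) :
    ((W.baseChange F).ΨSq m).eval x = aeval x (W.ΨSq m) := by
  rw [baseChange, map_ΨSq, eval_map_algebraMap]

end EvalBaseChange

section PoleMultiples

variable {k F Γ : Type*} [Field k] [Field F] [Algebra k F] [DecidableEq F]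
  [LinearOrderedCommGroupWithZero Γ] {v : Valuation F Γ} [v.IsTrivialOn k]
  {W : WeierstrassCurve k} [W.IsElliptic]

/-- Since Φ_m has degree m² and ΨSq_m smaller degree, x(mP) = Φ_m/ΨSq_m has a pole wherever x has
one. This works in every characteristic, also when m vanishes in k. -/
lemma xCoord_nsmul_of_hasPole {x y : F} (h : (W.baseChange F).toAffine.Nonsingular x y)
    (hx : 1 < v x) {m : ℕ} (hm : m ≠ 0) : ∃ (y' : F)
      (h' : (W.baseChange F).toAffine.Nonsingular (aeval x (W.Φ m) / aeval x (W.ΨSq m)) y'),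
      m • Affine.Point.some x y h = .some _ y' h' ∧
        1 < v (aeval x (W.Φ m) / aeval x (W.ΨSq m)) := by
  have hx0 : 0 < v x := zero_lt_one.trans hx
  have e1 := hasXRatio_nsmul h m
  rw [eval_baseChange_Φ, eval_baseChange_ΨSq] at e1
  have hΨ := ΨSq_ne_zero_of_isElliptic W hm
  have v1 := valuation_aeval_eq_valuation_X_pow_natDegree_of_one_lt_valuation_X (v := v) x hx
    (W.Φ_ne_zero m)
  have v2 := valuation_aeval_eq_valuation_X_pow_natDegree_of_one_lt_valuation_X (v := v) x hx hΨ
  have hΨ0 : aeval x (W.ΨSq m) ≠ 0 := by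
    rw [← v.ne_zero_iff, v2]; exact pow_ne_zero _ hx0.ne'
  rcases e1 with ⟨-, h0, -⟩ | ⟨hP, -, e⟩
  · exact absurd h0 hΨ0
  have e' : xCoord (m • Affine.Point.some x y h) = aeval x (W.Φ m) / aeval x (W.ΨSq m) := by
    rw [eq_div_iff hΨ0]; exact e.symm
  obtain ⟨y', h', e2⟩ := exists_eq_some hP
  rw [← e']
  refine ⟨y', h', e2, ?_⟩
  rw [e', map_div₀, v1, v2, one_lt_div₀ (pow_pos hx0 _)]
  refine pow_lt_pow_right₀ hx ?_
  have := W.natDegree_ΨSq_le m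
  rw [natDegree_Φ]
  rw [Int.natAbs_natCast] at *
  have : 0 < m ^ 2 := by positivity
  omega

lemma HasPole.nsmul {P : (W.baseChange F).toAffine.Point} (hP : HasPole v P) {m : ℕ} (hm : m ≠ 0) :
    HasPole v (m • P) := by
  obtain ⟨x, y, h, rfl, hx⟩ := hP
  obtain ⟨y', h', e, e'⟩ := xCoord_nsmul_of_hasPole h hx hm
  exact ⟨_, y', h', e, e'⟩

end PoleMultiples

section EvalAlgHom

variable {k M : Type*} [Field k] [Field M] [Algebra k M] (W : WeierstrassCurve k)

/-- The homomorphism from the function field given by a point with transcendental `x`-coordinate. -/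
def evalAlgHom {x y : M} (h : (W.baseChange M).toAffine.Equation x y) (hx : Transcendental k x) :
    W.toAffine.FunctionField →ₐ[k] M :=
  { evalHom W (algebraMap k M) x y h
      (fun p hp => transcendental_iff.mp hx p (by rwa [aeval_def])) with
    commutes' := evalHom_algebraMap h _ }

variable {W}

@[simp] lemma evalAlgHom_genX {x y : M} (h : (W.baseChange M).toAffine.Equation x y)
    (hx : Transcendental k x) : evalAlgHom W h hx (genX W) = x := evalHom_genX h
  (fun p hp => transcendental_iff.mp hx p (by rwa [aeval_def]))

@[simp] lemma evalAlgHom_genY {x y : M} (h : (W.baseChange M).toAffine.Equation x y)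
    (hx : Transcendental k x) : evalAlgHom W h hx (genY W) = y := evalHom_genY h
  (fun p hp => transcendental_iff.mp hx p (by rwa [aeval_def]))

lemma functionField_algHom_ext {g₁ g₂ : W.toAffine.FunctionField →ₐ[k] M}
    (hx : g₁ (genX W) = g₂ (genX W)) (hy : g₁ (genY W) = g₂ (genY W)) : g₁ = g₂ := by
  have : (g₁ : W.toAffine.FunctionField →+* M) = g₂ :=
    functionField_hom_ext (fun c => by simp) hx hy
  exact AlgHom.coe_ringHom_injective this

end EvalAlgHom

section PointHom

variable {k : Type u} [Field k] (W : WeierstrassCurve k) (F : Type u) [Field F] [Algebra k F]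

lemma pointBaseChange_eq_map [DecidableEq k] [DecidableEq F] (P : W.toAffine.Point) :
    pointBaseChange W F P = Affine.Point.map (W' := W) (S := k) (F := k) (Algebra.ofId k F) P := by
  cases P <;> rfl

lemma pointBaseChange_add [DecidableEq k] [DecidableEq F] (P Q : W.toAffine.Point) :
    pointBaseChange W F (P + Q) = pointBaseChange W F P + pointBaseChange W F Q := by
  rw [pointBaseChange_eq_map, pointBaseChange_eq_map, pointBaseChange_eq_map]
  exact (Affine.Point.map (W' := W) (S := k) (F := k) (Algebra.ofId k F)).map_add P Q

lemma pointBaseChange_nsmul [DecidableEq k] [DecidableEq F] (n : ℕ) (P : W.toAffine.Point) :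
    pointBaseChange W F (n • P) = n • pointBaseChange W F P := by
  rw [pointBaseChange_eq_map, pointBaseChange_eq_map]
  exact (Affine.Point.map (W' := W) (S := k) (F := k) (Algebra.ofId k F)).map_nsmul n P

end PointHom

section MulIsogeny

variable {k : Type u} [Field k] (W : WeierstrassCurve k) [W.IsElliptic]

open Classical in
-- The pullback along [m] is evaluation at the m-th multiple of the generic point. Its x-coordinate
-- has a pole at infinity; hence it is transcendental, so the evaluation is defined, and the origin
-- goes to the origin.
lemma exists_nsmul_generic {m : ℕ} (hm : m ≠ 0) :
    ∃ (φ : Isogeny W W) (h : (W.baseChange W.toAffine.FunctionField).toAffine.Nonsingular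
      (genX W) (genY W)) (h' : (W.baseChange W.toAffine.FunctionField).toAffine.Nonsingular
      (φ.pullback (genX W)) (φ.pullback (genY W))),
      m • Affine.Point.some _ _ h = .some _ _ h' ∧
      φ.pullback (genX W) = aeval (genX W) (W.Φ m) / aeval (genX W) (W.ΨSq m) := by
  obtain ⟨V, hV, hx⟩ := exists_valuation_one_lt (transcendental_genX (W := W))
  have h : (W.baseChange W.toAffine.FunctionField).toAffine.Nonsingular (genX W) (genY W) :=
    (Affine.equation_iff_nonsingular (W := W.baseChange W.toAffine.FunctionField)).mp
      generic_equation
  obtain ⟨y', h', e, e'⟩ := xCoord_nsmul_of_hasPole h hx hm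
  have ht : Transcendental k (aeval (genX W) (W.Φ m) / aeval (genX W) (W.ΨSq m)) := by
    apply Valuation.transcendental_of_ne_one (v := V.valuation) k _ _ e'.ne'
    rintro h0
    rw [h0, map_zero] at e'
    exact not_lt_zero e'
  let g := evalAlgHom W h'.1 ht
  have gx : g (genX W) = _ := evalAlgHom_genX _ _
  have gy : g (genY W) = _ := evalAlgHom_genY _ _
  refine ⟨⟨g, ?_⟩, h, by rw [gx, gy]; exact h', ?_, gx⟩
  · intro f c hf
    rw [hasValueAt_zero_iff hx]
    have : (V.valuation.comap (g : W.toAffine.FunctionField →+* _)).IsTrivialOn k :=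
      ⟨fun c hc => by simpa using hV.eq_one c hc⟩
    have h2 := (hasValueAt_zero_iff (v := V.valuation.comap
      (g : W.toAffine.FunctionField →+* _)) (by simpa [gx] using e') f c).mp hf
    simpa using h2
  · simp only [gx, gy]
    exact e

end MulIsogeny

/-- The function field is k(x)(y) with y integral over k(x). Only finiteness is needed, in order to
cancel this degree in a tower. -/
lemma finrank_adjoin_genX_ne_zero {k : Type*} [Field k] (W : WeierstrassCurve k) :
    Module.finrank (IntermediateField.adjoin k {genX W}) W.toAffine.FunctionField ≠ 0 := by
  let Kx := IntermediateField.adjoin k {genX W}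
  have hx : genX W ∈ Kx := IntermediateField.mem_adjoin_simple_self k _
  have hp (p : k[X]) : aeval (genX W) p ∈ Kx :=
    IntermediateField.algebra_adjoin_le_adjoin _ _ (aeval_mem_adjoin_singleton _ _)
  have hint : IsIntegral Kx (genY W) := by
    have e := equation_eq (generic_equation (W := W))
    let b : Kx := ⟨algebraMap k _ W.a₁ * genX W + algebraMap k _ W.a₃,
      add_mem (mul_mem (algebraMap_mem Kx _) hx) (algebraMap_mem Kx _)⟩
    let c : Kx := ⟨genX W ^ 3 + algebraMap k _ W.a₂ * genX W ^ 2 + algebraMap k _ W.a₄ * genX W +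
      algebraMap k _ W.a₆, add_mem (add_mem (add_mem (pow_mem hx 3) (mul_mem (algebraMap_mem Kx _)
      (pow_mem hx 2))) (mul_mem (algebraMap_mem Kx _) hx)) (algebraMap_mem Kx _)⟩
    refine ⟨X ^ 2 + C b * X - C c, by monicity!, ?_⟩
    simp only [eval₂_sub, eval₂_add, eval₂_mul, eval₂_pow, eval₂_X, eval₂_C]
    change genY W ^ 2 + (algebraMap k _ W.a₁ * genX W + algebraMap k _ W.a₃) * genY W -
      (genX W ^ 3 + algebraMap k _ W.a₂ * genX W ^ 2 + algebraMap k _ W.a₄ * genX W +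
      algebraMap k _ W.a₆) = 0
    simp only [baseChange, map_a₁, map_a₂, map_a₃, map_a₄, map_a₆] at e
    linear_combination e
  have htop : IntermediateField.adjoin Kx {genY W} = ⊤ := by
    rw [eq_top_iff]
    intro z _
    have hc (a : W.toAffine.CoordinateRing) : algebraMap _ W.toAffine.FunctionField a ∈
        IntermediateField.adjoin Kx {genY W} := by
      obtain ⟨p, q, -, e⟩ := exists_eq_algebraMap a
      rw [e]
      exact add_mem (IntermediateField.algebraMap_mem _ (⟨_, hp p⟩ : Kx)) (mul_mem
        (IntermediateField.algebraMap_mem _ (⟨_, hp q⟩ : Kx))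
        (IntermediateField.mem_adjoin_simple_self Kx _))
    obtain ⟨a, b, -, rfl⟩ := IsFractionRing.div_surjective (A := W.toAffine.CoordinateRing) z
    exact div_mem (hc a) (hc b)
  have hfd : FiniteDimensional Kx (IntermediateField.adjoin Kx {genY W}) :=
    IntermediateField.adjoin.finiteDimensional hint
  have : Module.finrank Kx (IntermediateField.adjoin Kx {genY W}) ≠ 0 := Module.finrank_pos.ne'
  rw [htop, IntermediateField.finrank_top'] at this
  exact this

/-- The field k(t) is identified with rational functions, where the degree over k(f) is the larger
degree of numerator and denominator; coprimality identifies these with p and q up to units. -/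
lemma relfinrank_adjoin_div {k F : Type*} [Field k] [Field F] [Algebra k F] {t : F}
    (ht : Transcendental k t) {p q : k[X]} (hq : q ≠ 0) (hpq : IsCoprime p q) :
    IntermediateField.relfinrank (IntermediateField.adjoin k {aeval t p / aeval t q})
      (IntermediateField.adjoin k {t}) = max p.natDegree q.natDegree := by
  classical
  let e := RatFunc.algEquivOfTranscendental t ht
  let ψ : RatFunc k →ₐ[k] F := (IntermediateField.val _).comp e.toAlgHom
  have hX : ψ RatFunc.X = t := by
    simp [ψ, e]
  have hp (p : k[X]) : ψ (algebraMap _ _ p) = aeval t p := by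
    have : (ψ.comp (IsScalarTower.toAlgHom k k[X] (RatFunc k))) = aeval t := by
      ext; simpa using hX
    exact DFunLike.congr_fun this p
  let f : RatFunc k := algebraMap _ _ p / algebraMap _ _ q
  have h1 : IntermediateField.adjoin k {aeval t p / aeval t q} =
      (IntermediateField.adjoin k {f}).map ψ := by
    rw [IntermediateField.adjoin_map, Set.image_singleton, map_div₀, hp, hp]
  have h2 : IntermediateField.adjoin k {t} = (⊤ : IntermediateField k _).map ψ := by
    rw [← RatFunc.adjoin_X, IntermediateField.adjoin_map, Set.image_singleton, hX]
  rw [h1, h2, IntermediateField.relfinrank_map_map, IntermediateField.relfinrank_top_right,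
    RatFunc.finrank_eq_max_natDegree]
  have hf : f.num * q = p * f.denom := (RatFunc.num_mul_eq_mul_denom_iff hq).mpr rfl
  have hc := RatFunc.isCoprime_num_denom f
  have a1 : Associated f.num p := associated_of_dvd_dvd
    (hc.dvd_of_dvd_mul_right ⟨q, hf.symm⟩) (hpq.dvd_of_dvd_mul_right ⟨f.denom, hf⟩)
  have a2 : Associated f.denom q := associated_of_dvd_dvd
    (hc.symm.dvd_of_dvd_mul_left ⟨p, by rw [hf, mul_comm]⟩)
    (hpq.symm.dvd_of_dvd_mul_left ⟨f.num, by rw [← hf, mul_comm]⟩)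
  rw [natDegree_eq_of_degree_eq (degree_eq_degree_of_associated a1),
    natDegree_eq_of_degree_eq (degree_eq_degree_of_associated a2)]

section MulIsogeny

lemma val_algebraMap_eq_one_or {k F Γ : Type*} [Field k] [Field F] [Algebra k F]
    [LinearOrderedCommGroupWithZero Γ] {v : Valuation F Γ} [hv : v.IsTrivialOn k]
    {W : WeierstrassCurve k} {a b : k} (h : W.toAffine.Nonsingular a b) :
    v (dY (W.baseChange F) (algebraMap k F a) (algebraMap k F b)) = 1 ∨
      v (dX (W.baseChange F) (algebraMap k F a) (algebraMap k F b)) = 1 := by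
  rw [baseChange, ← map_dY, ← map_dX]
  exact (dY_ne_zero_or_dX_ne_zero h).imp (hv.eq_one _) (hv.eq_one _)

variable {k : Type u} [Field k] {W : WeierstrassCurve k} [W.IsElliptic]

open Classical in
-- At a place centred at R the generic point is R plus a point with a pole. Multiplying by m gives
-- mR plus a point with a pole, so m times the generic point reduces to mR. Values at R are then
-- recovered because the local ring is a valuation ring.
lemma nsmul_generic_sends {m : ℕ} (hm : m ≠ 0) (φ : Isogeny W W)
    (h : (W.baseChange W.toAffine.FunctionField).toAffine.Nonsingular (genX W) (genY W))
    (h' : (W.baseChange W.toAffine.FunctionField).toAffine.Nonsingular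
      (φ.pullback (genX W)) (φ.pullback (genY W)))
    (e : m • Affine.Point.some _ _ h = .some _ _ h') {x y a b : k} (hR : W.toAffine.Nonsingular x y)
    (hP : W.toAffine.Nonsingular a b) (hRP : m • Affine.Point.some x y hR = .some a b hP) :
    Sends φ.pullback (.some x y hR) (.some a b hP) := by
  obtain ⟨V, hV, hx, hy⟩ := exists_valuation_center hR
  let K := W.toAffine.FunctionField
  have hW : IntegralCoeffs V.valuation (W.baseChange K) := integralCoeffs_baseChange W
  have hη : ReducesTo V.valuation (Affine.Point.some _ _ h) (algebraMap k K x)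
      (algebraMap k K y) := ⟨_, _, h, rfl, hx, hy⟩
  have hR' : (W.baseChange K).toAffine.Nonsingular (algebraMap k K x) (algebraMap k K y) :=
    (Affine.map_nonsingular W.toAffine (algebraMap k K).injective x y).mpr hR
  have hP' : (W.baseChange K).toAffine.Nonsingular (algebraMap k K a) (algebraMap k K b) :=
    (Affine.map_nonsingular W.toAffine (algebraMap k K).injective a b).mpr hP
  have p1 : HasPole V.valuation (Affine.Point.some _ _ h - .some _ _ hR') := by
    refine hη.hasPole_sub hW hR' (val_le_one_of_isTrivialOn x) (val_le_one_of_isTrivialOn y)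
      (val_algebraMap_eq_one_or hR) fun y' h'' he => ?_
    have := (Affine.Point.some.inj he).1
    exact transcendental_genX (W := W) (this ▸ isAlgebraic_algebraMap x)
  have p2 := p1.nsmul hm
  have e2 : m • Affine.Point.some _ _ hR' = .some _ _ hP' := by
    have := pointBaseChange_nsmul W K m (.some x y hR)
    rw [hRP] at this
    exact this.symm
  rw [nsmul_sub, e, e2] at p2
  have p3 := p2.add_reducesTo hW hP' (val_le_one_of_isTrivialOn a) (val_le_one_of_isTrivialOn b)
  rw [sub_add_cancel] at p3
  obtain ⟨x', y', h'', e3, hx', hy'⟩ := p3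
  obtain ⟨rfl, rfl⟩ := Affine.Point.some.inj e3
  exact sends_some φ.pullback (hasValueAt_of_val_sub_lt hx hy hx')
    (hasValueAt_of_val_sub_lt hx hy hy')

/-- Compare two towers from k(x∘[m]) to the function field, one through k(x) and one through the
image of [m]^*. The extension of k(x∘[m]) inside that image is a copy of the function field over
k(x), so the degree of [m] equals [k(x) : k(x∘[m])], which is m² by coprimality. -/
lemma degree_mul {m : ℕ} (hm : m ≠ 0) (φ : Isogeny W W)
    (e : φ.pullback (genX W) = aeval (genX W) (W.Φ m) / aeval (genX W) (W.ΨSq m)) :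
    φ.degree = m ^ 2 := by
  let Kx := IntermediateField.adjoin k {genX W}
  let KX := IntermediateField.adjoin k {φ.pullback (genX W)}
  have hmap : KX = Kx.map φ.pullback := by
    rw [IntermediateField.adjoin_map, Set.image_singleton]
  have htop : φ.pullback.fieldRange = (⊤ : IntermediateField k _).map φ.pullback := by
    rw [AlgHom.fieldRange_eq_map]
  have hle : KX ≤ φ.pullback.fieldRange := by
    rw [hmap, htop]; exact IntermediateField.map_mono _ le_top
  have hle' : KX ≤ Kx := by
    rw [IntermediateField.adjoin_simple_le_iff, e]
    exact div_mem (IntermediateField.algebra_adjoin_le_adjoin _ _ (aeval_mem_adjoin_singleton _ _))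
      (IntermediateField.algebra_adjoin_le_adjoin _ _ (aeval_mem_adjoin_singleton _ _))
  have h1 := IntermediateField.relfinrank_mul_finrank_top hle
  have h2 := IntermediateField.relfinrank_mul_finrank_top hle'
  have h3 : IntermediateField.relfinrank KX φ.pullback.fieldRange =
      Module.finrank Kx W.toAffine.FunctionField := by
    rw [hmap, htop, IntermediateField.relfinrank_map_map, IntermediateField.relfinrank_top_right]
  have h4 : IntermediateField.relfinrank KX Kx = m ^ 2 := by
    have hcop := isCoprime_Φ_ΨSq W m (by omega)
    have hΨ := ΨSq_ne_zero_of_isElliptic W hm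
    have := relfinrank_adjoin_div (transcendental_genX (W := W)) hΨ hcop
    rw [← e] at this
    rw [this, natDegree_Φ, Int.natAbs_natCast, max_eq_left]
    have := W.natDegree_ΨSq_le m
    rw [Int.natAbs_natCast] at this
    omega
  rw [h3, ← h2, h4, mul_comm] at h1
  exact Nat.eq_of_mul_eq_mul_right (Nat.pos_of_ne_zero (finrank_adjoin_genX_ne_zero W)) h1

open Classical in
/-- Multiplication by `m` is an isogeny of degree `m ^ 2`. -/
theorem exists_isogeny_nsmul (W : WeierstrassCurve k) [W.IsElliptic] {m : ℕ} (hm : m ≠ 0) :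
    ∃ φ : Isogeny W W, φ.degree = m ^ 2 ∧ ∀ {x y a b : k} (hR : W.toAffine.Nonsingular x y)
      (hP : W.toAffine.Nonsingular a b), m • Affine.Point.some x y hR = .some a b hP →
        Sends φ.pullback (.some x y hR) (.some a b hP) := by
  obtain ⟨φ, h, h', e, e'⟩ := exists_nsmul_generic W hm
  exact ⟨φ, degree_mul hm φ e', fun hR hP => nsmul_generic_sends hm φ h h' e hR hP⟩

end MulIsogeny

/-! ### Factorizations of the polynomials `δ_m` -/

section Delta

variable {K : Type u} [Field K]

lemma factorizes_of_root {L : Type*} [Field L] [Algebra K L] {f : K[X]} (hf : f ≠ 0) {s : L}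
    (hs : aeval s f = 0) (hd : (minpoly K s).natDegree < f.natDegree) : Factorizes f := by
  obtain ⟨g, hg⟩ := minpoly.dvd K s hs
  have hint : IsIntegral K s := isAlgebraic_iff_isIntegral.mp ⟨f, hf, hs⟩
  rw [hg] at hf
  have h := natDegree_mul (left_ne_zero_of_mul hf) (right_ne_zero_of_mul hf)
  rw [← hg] at h
  exact ⟨_, g, minpoly.natDegree_pos hint, by omega, hg⟩

lemma factorizes_pow {f : K[X]} (hf : 0 < f.natDegree) {n : ℕ} (hn : 2 ≤ n) :
    Factorizes (f ^ n) := by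
  obtain ⟨n, rfl⟩ := Nat.exists_eq_add_of_le' hn
  refine ⟨f, f ^ (n + 1), hf, ?_, pow_succ' f (n + 1)⟩
  rw [natDegree_pow]
  positivity

variable (E : WeierstrassCurve K)

lemma delta_neg (m : ℤ) (P : E.toAffine.Point) : delta E (-m) P = delta E m P := by
  cases P <;> simp [delta, Φ_neg, ΨSq_neg]

variable {E} {a b : K} (h : E.toAffine.Nonsingular a b)

lemma delta_some (m : ℤ) : delta E m (.some a b h) = E.Φ m - C a * E.ΨSq m := rfl

lemma natDegree_delta_some (m : ℕ) : (delta E m (.some a b h)).natDegree = m ^ 2 := by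
  rcases Nat.eq_zero_or_pos m with rfl | hm
  · simp [delta_some]
  rw [delta_some, natDegree_sub_eq_left_of_natDegree_lt]
  · rw [natDegree_Φ, Int.natAbs_natCast]
  · have h1 := E.natDegree_ΨSq_le m
    have h2 := natDegree_C_mul_le a (E.ΨSq m)
    rw [natDegree_Φ]
    rw [Int.natAbs_natCast] at *
    have : 0 < m ^ 2 := by positivity
    omega

lemma delta_some_ne_zero {m : ℕ} (hm : m ≠ 0) : delta E m (.some a b h) ≠ 0 := by
  intro h0
  have := natDegree_delta_some h m
  rw [h0, natDegree_zero] at this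
  exact pow_ne_zero 2 hm this.symm

variable [E.IsElliptic] {L : Type u} [Field L] [Algebra K L]

open Classical in
lemma aeval_delta_of_nsmul_eq {s t : L} (hQ : (E.baseChange L).toAffine.Nonsingular s t) {m : ℕ}
    (e : m • Affine.Point.some s t hQ = pointBaseChange E L (.some a b h)) :
    aeval s (delta E m (.some a b h)) = 0 := by
  have e1 := hasXRatio_nsmul hQ m
  rw [e, eval_baseChange_Φ, eval_baseChange_ΨSq] at e1
  rcases e1 with ⟨h0, -⟩ | ⟨-, -, e2⟩
  · exact absurd h0 (Affine.Point.some_ne_zero _)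
  · rw [delta_some, map_sub, map_mul, aeval_C, e2]
    exact sub_self _

open Classical in
-- A root of δ_m only fixes the x-coordinate of mQ, hence the sign ambiguity. Coprimality enters
-- through `hasXRatio_nsmul`: numerator and denominator do not vanish together.
lemma nsmul_eq_of_aeval_delta {s t : L} (hQ : (E.baseChange L).toAffine.Nonsingular s t) {m : ℕ}
    (e : aeval s (delta E m (.some a b h)) = 0) :
    m • Affine.Point.some s t hQ = pointBaseChange E L (.some a b h) ∨
      m • Affine.Point.some s t hQ = -pointBaseChange E L (.some a b h) := by
  have e1 := hasXRatio_nsmul hQ m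
  rw [eval_baseChange_Φ, eval_baseChange_ΨSq] at e1
  rw [delta_some, map_sub, map_mul, aeval_C, sub_eq_zero] at e
  rcases e1 with ⟨-, h1, h2⟩ | ⟨h0, h1, h2⟩
  · rw [h1, mul_zero] at e
    exact absurd e h2
  · rw [e] at h2
    exact eq_or_eq_neg_of_xCoord_eq h0 (Affine.Point.some_ne_zero _)
      (mul_right_cancel₀ h1 h2).symm

end Delta

section BaseChange

variable {K : Type u} [Field K] (E : WeierstrassCurve K) {L M : Type u} [Field L] [Field M]
  [Algebra K L] [Algebra K M]

lemma map_pointBaseChange [DecidableEq L] [DecidableEq M] (f : L →ₐ[K] M) (P : E.toAffine.Point) :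
    Affine.Point.map (W' := E) f (pointBaseChange E L P) = pointBaseChange E M P := by
  cases P with
  | zero => rfl
  | some x y h =>
    have hL : (E.baseChange L).toAffine.Nonsingular (algebraMap K L x) (algebraMap K L y) :=
      (Affine.map_nonsingular E.toAffine (algebraMap K L).injective x y).mpr h
    refine (Affine.Point.map_some f hL).trans ?_
    simp only [AlgHom.commutes]
    rfl

lemma pointBaseChange_injective : Function.Injective (pointBaseChange E L) := by
  classical
  intro P Q h
  rw [pointBaseChange_eq_map, pointBaseChange_eq_map] at h
  exact Affine.Point.map_injective (Algebra.ofId K L) h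

lemma exists_equation [IsAlgClosed L] (W : WeierstrassCurve L) (x : L) :
    ∃ y, W.toAffine.Equation x y := by
  obtain ⟨y, hy⟩ := IsAlgClosed.exists_root (X ^ 2 + C (W.a₁ * x + W.a₃) * X -
    C (x ^ 3 + W.a₂ * x ^ 2 + W.a₄ * x + W.a₆) : L[X]) (by
      rw [show (X ^ 2 + C (W.a₁ * x + W.a₃) * X -
        C (x ^ 3 + W.a₂ * x ^ 2 + W.a₄ * x + W.a₆) : L[X]).degree = 2 by compute_degree!]
      simp)
  refine ⟨y, ?_⟩
  rw [Affine.equation_iff]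
  simp only [IsRoot, eval_sub, eval_add, eval_mul, eval_pow, eval_X, eval_C] at hy
  linear_combination hy

end BaseChange

/-! ### A factorization yields a magnified point -/

section Magnified

variable {K : Type u} [Field K] {E : WeierstrassCurve K} [E.IsElliptic]

lemma isMagnified_of_nsmul_eq {L : Type u} [Field L] [DecidableEq L] [Algebra K L]
    [FiniteDimensional K L]
    {P : E.toAffine.Point} {m : ℕ} (Q : (E.baseChange L).toAffine.Point)
    (hQ : m • Q = pointBaseChange E L P) (hd : Module.finrank K L < m ^ 2) : IsMagnified E P := by
  have hm : m ≠ 0 := by rintro rfl; simp at hd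
  obtain ⟨φ, hφ, hs⟩ := exists_isogeny_nsmul (E.baseChange L) hm
  rw [← hφ] at hd
  cases P with
  -- For P = O the origin serves as preimage, whatever Q is.
  | zero => exact ⟨L, _, _, inferInstance, _, inferInstance, φ, .zero, φ.sends_zero, hd⟩
  | some a b h =>
    cases Q with
    | zero => exact absurd (hQ.symm.trans (nsmul_zero m)) (Affine.Point.some_ne_zero _)
    | some x y hxy => exact ⟨L, _, _, inferInstance, _, inferInstance, φ, _,
      hs hxy _ (by convert! hQ), hd⟩

open Classical in
-- Here 3P = P, and multiplication by 3 has degree 9 over K itself.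
lemma isMagnified_of_two_nsmul_eq_zero {P : E.toAffine.Point} (hP : 2 • P = 0) :
    IsMagnified E P := by
  refine isMagnified_of_nsmul_eq (L := K) (m := 3) (pointBaseChange E K P) ?_ (by simp)
  rw [← pointBaseChange_nsmul, succ_nsmul, hP, zero_add]

omit [E.IsElliptic] in
open Classical in
-- An automorphism fixing s sends Q to Q or -Q. It fixes mQ = P, so -Q would give P = -P, which is
-- excluded; thus t is fixed too, and Galois theory over the perfect field K puts t in K(s).
lemma mem_adjoin_of_nsmul_eq [PerfectField K] {Ω : Type u} [Field Ω] [Algebra K Ω]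
    [IsAlgClosure K Ω] {P : E.toAffine.Point} (hP : 2 • P ≠ 0) {s t : Ω}
    (hQ : (E.baseChange Ω).toAffine.Nonsingular s t) {m : ℕ}
    (e : m • Affine.Point.some s t hQ = pointBaseChange E Ω P) :
    t ∈ IntermediateField.adjoin K {s} := by
  have : IsGalois K Ω := { }
  rw [← InfiniteGalois.fixedField_fixingSubgroup (IntermediateField.adjoin K {s}),
    IntermediateField.mem_fixedField_iff]
  intro σ hσ
  have hs : σ s = s := (IntermediateField.mem_fixingSubgroup_iff _ _).mp hσ s
    (IntermediateField.mem_adjoin_simple_self K s)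
  have e' := congrArg (Affine.Point.map (W' := E) (σ : Ω →ₐ[K] Ω)) e
  rw [map_nsmul, map_pointBaseChange, Affine.Point.map_some] at e'
  have hσQ : (E.baseChange Ω).toAffine.Nonsingular (σ s) (σ t) :=
    (Affine.baseChange_nonsingular E (f := (σ : Ω →ₐ[K] Ω)) σ.injective ..).mpr hQ
  rcases (Affine.Point.X_eq_iff (h₁ := hσQ) (h₂ := hQ)).mp hs with h1 | h1
  · exact (Affine.Point.some.inj h1).2
  · exfalso
    have h2 : m • -Affine.Point.some s t hQ = pointBaseChange E Ω P := by rw [← h1]; exact e'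
    rw [smul_neg, e, neg_eq_iff_add_eq_zero, ← two_nsmul, ← pointBaseChange_nsmul] at h2
    exact hP (pointBaseChange_injective E h2)

theorem isMagnified_of_factorizes [PerfectField K] {P : E.toAffine.Point} {m : ℤ}
    (hf : Factorizes (delta E m P)) : IsMagnified E P := by
  classical
  wlog hm : 0 ≤ m generalizing m
  · exact this (m := -m) (by rwa [delta_neg]) (by omega)
  lift m to ℕ using hm
  by_cases hP : 2 • P = 0
  · exact isMagnified_of_two_nsmul_eq_zero hP
  cases P with
  | zero => exact absurd (nsmul_zero 2) hP
  | some a b h =>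
    obtain ⟨g, g', hg, hg', e⟩ := hf
    have hgg : g * g' ≠ 0 :=
      mul_ne_zero (ne_zero_of_natDegree_gt hg) (ne_zero_of_natDegree_gt hg')
    have hdeg := natDegree_delta_some h m
    rw [e, natDegree_mul (left_ne_zero_of_mul hgg) (right_ne_zero_of_mul hgg)] at hdeg
    obtain ⟨s, hs⟩ := IsAlgClosed.exists_aeval_eq_zero (AlgebraicClosure K) g
      (natDegree_pos_iff_degree_pos.mp hg).ne'
    obtain ⟨t, ht⟩ := exists_equation (E.baseChange (AlgebraicClosure K)) s
    have hQ := Affine.equation_iff_nonsingular.mp ht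
    -- If mQ = -P, replace Q by -Q, which has the same x-coordinate s.
    have key : ∃ (t : AlgebraicClosure K) (hQ : (E.baseChange (AlgebraicClosure
        K)).toAffine.Nonsingular s t),
        m • Affine.Point.some s t hQ = pointBaseChange E _ (.some a b h) := by
      rcases nsmul_eq_of_aeval_delta h hQ (m := m) (by rw [e, map_mul, hs, zero_mul]) with h1 | h1
      · exact ⟨t, hQ, h1⟩
      · refine ⟨_, (Affine.nonsingular_neg ..).mpr hQ, ?_⟩
        rw [← neg_neg (pointBaseChange _ _ _), ← h1, ← smul_neg, Affine.Point.neg_some]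
    clear! t
    obtain ⟨t, hQ, e1⟩ := key
    have ht := mem_adjoin_of_nsmul_eq hP hQ e1
    have hint : IsIntegral K s := Algebra.IsIntegral.isIntegral s
    let L := IntermediateField.adjoin K {s}
    have : FiniteDimensional K L := IntermediateField.adjoin.finiteDimensional hint
    have hQL : (E.baseChange L).toAffine.Nonsingular (⟨s, IntermediateField.mem_adjoin_simple_self
        K s⟩ : L)
        ⟨t, ht⟩ := (Affine.baseChange_nonsingular E (f := L.val) L.val.injective ..).mp hQ
    refine isMagnified_of_nsmul_eq (L := L) (m := m) (.some _ _ hQL) ?_ ?_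
    · apply Affine.Point.map_injective (W' := E) L.val
      rw [map_nsmul, map_pointBaseChange, Affine.Point.map_some]
      exact e1
    · rw [IntermediateField.adjoin.finrank hint]
      -- The degree of s is at most deg g, and deg g < m² because the other factor is nonconstant.
      have := natDegree_le_of_dvd (minpoly.dvd K s hs) (ne_zero_of_natDegree_gt hg)
      omega

end Magnified

/-! ### Factorizations for torsion points of order two and in positive characteristic -/

section Factorizes

variable {K : Type u} [Field K] {E : WeierstrassCurve K} [E.IsElliptic]

omit [E.IsElliptic] in
lemma exists_factorizes_zero : ∃ m : ℤ, Factorizes (delta E m .zero) := by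
  obtain ⟨m, h1, h2, h3⟩ : ∃ m : ℤ, 2 < m.natAbs ∧ (m : K) ≠ 0 ∧ ¬ Even m := by
    -- An odd m makes ψ_m a polynomial in x, so ψ_m² is a square in K[X]; m = 5 replaces m = 3 in
    -- characteristic 3 so that m stays nonzero in K and ψ_m nonconstant.
    by_cases h3 : (3 : K) = 0
    · refine ⟨5, by decide, ?_, by decide⟩
      intro h5
      have : (1 : K) = 2 * 3 - 5 := by norm_num
      push_cast at h5
      rw [h3, h5] at this
      simp at this
    · exact ⟨3, by decide, by exact_mod_cast h3, by decide⟩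
  refine ⟨m, ?_⟩
  rw [delta, ΨSq, if_neg h3, mul_one]
  exact factorizes_pow (E.natDegree_preΨ_pos h1 h2) le_rfl

open Classical in
-- For an affine point of order two, 3P = P makes x(P) ∈ K a root of δ_3^P, which has degree 9.
lemma exists_factorizes_of_two_nsmul_eq_zero {P : E.toAffine.Point} (hP : 2 • P = 0) :
    ∃ m : ℤ, Factorizes (delta E m P) := by
  cases P with
  | zero => exact exists_factorizes_zero
  | some a b h =>
    refine ⟨(3 : ℕ), factorizes_of_root (L := K) (s := algebraMap K K a)
      (delta_some_ne_zero h three_ne_zero) ?_ ?_⟩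
    · refine aeval_delta_of_nsmul_eq h (t := algebraMap K K b) ?_ ?_
      · exact (Affine.map_nonsingular E.toAffine (algebraMap K K).injective a b).mpr h
      · change 3 • pointBaseChange E K (.some a b h) = _
        rw [← pointBaseChange_nsmul, succ_nsmul, hP, zero_add]
    · rw [natDegree_delta_some, minpoly.eq_X_sub_C, natDegree_X_sub_C]
      norm_num

/-- Such an f is a polynomial in X^p, and its coefficients have p-th roots because K is perfect. -/
lemma exists_eq_pow_of_derivative_eq_zero [PerfectField K] (p : ℕ) [Fact p.Prime] [CharP K p]
    {f : K[X]} (hf : derivative f = 0) : ∃ g : K[X], f = g ^ p := by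
  have : PerfectRing K p := PerfectField.toPerfectRing p
  refine ⟨(contract p f).map ((frobeniusEquiv K p).symm : K →+* K), ?_⟩
  rw [← map_frobenius_expand p, map_expand, Polynomial.map_map, frobenius_comp_frobeniusEquiv_symm,
    Polynomial.map_id, expand_contract p hf (Fact.out : p.Prime).ne_zero]

/-- The Wronskian of Φ_p and ΨSq_p vanishes since [p]^*ω = 0. By coprimality ΨSq_p divides its own
derivative, so both derivatives are zero; δ_p is then a p-th power, and its root has degree p. -/
lemma factorizes_delta_char [PerfectField K] (p : ℕ) [Fact p.Prime] [CharP K p] {a b : K}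
    (h : E.toAffine.Nonsingular a b) : Factorizes (delta E p (.some a b h)) := by
  have hp := (Fact.out : p.Prime)
  have hw := (divisionIdentities E p).wronskian hp.one_le
  rw [CharP.cast_eq_zero K[X] p, zero_pow two_ne_zero, zero_mul, zero_mul, mul_eq_zero, or_iff_left,
    pow_eq_zero_iff two_ne_zero, sub_eq_zero] at hw
  · have hc := isCoprime_Φ_ΨSq E p hp.one_le
    have h1 : derivative (E.ΨSq p) = 0 := by
      by_contra h0
      have h2 : E.ΨSq p ∣ derivative (E.ΨSq p) := hc.symm.dvd_of_dvd_mul_left ⟨_, by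
        rw [← hw, mul_comm]⟩
      have := natDegree_le_of_dvd h2 h0
      have h3 := natDegree_derivative_lt (p := E.ΨSq p) (fun h => h0 (by
        rw [eq_C_of_natDegree_eq_zero h, derivative_C]))
      omega
    have h2 : derivative (E.Φ p) = 0 := by
      rw [h1, mul_zero, mul_eq_zero] at hw
      exact hw.resolve_right (ΨSq_ne_zero_of_isElliptic E hp.ne_zero)
    obtain ⟨g, hg⟩ := exists_eq_pow_of_derivative_eq_zero p
      (show derivative (delta E p (.some a b h)) = 0 by
        rw [delta_some, derivative_sub, derivative_C_mul, h1, h2, mul_zero, sub_zero])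
    have hd := natDegree_delta_some h p
    rw [hg, natDegree_pow, sq] at hd
    rw [hg]
    exact factorizes_pow (by rw [Nat.eq_of_mul_eq_mul_left hp.pos hd]; exact hp.pos) hp.two_le
  · have := ΨSq_ne_zero_of_isElliptic E two_ne_zero
    rwa [Nat.cast_ofNat, ΨSq_two] at this

end Factorizes

/-! ### The invariant derivation at a pole of `x` -/

section InvariantDerivation

variable {k F Γ : Type*} [Field k] [Field F] [Algebra k F] [LinearOrderedCommGroupWithZero Γ]
  {v : Valuation F Γ} [hv : v.IsTrivialOn k]

lemma val_lt_of_sq_eq_cube {a b : Γ} (ha : 1 < a) (h : b ^ 2 = a ^ 3) : a < b := by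
  rw [← pow_lt_pow_iff_left₀ zero_le zero_le two_ne_zero, h]
  exact pow_lt_pow_right₀ ha (by norm_num)

lemma val_two_eq_one [CharZero k] : v 2 = 1 := by
  have := hv.eq_one (2 : k) two_ne_zero
  rwa [map_ofNat] at this

lemma val_dY_eq_of_pole [CharZero k] {W : WeierstrassCurve F} (hW : IntegralCoeffs v W) {x y : F}
    (h : W.toAffine.Equation x y) (hx : 1 < v x) : v (dY W x y) = v y := by
  have hxy := val_lt_of_sq_eq_cube hx (one_lt_val_y hW h hx)
  have h2 : v (2 * y) = v y := by rw [map_mul, val_two_eq_one (k := k), one_mul]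
  rw [dY, add_assoc, Valuation.map_add_eq_of_lt_left, h2]
  rw [h2]
  refine v.map_add_lt ?_ ?_
  · rw [map_mul]; exact (mul_le_of_le_one_left' hW.a₁).trans_lt hxy
  · exact hW.a₃.trans_lt (hx.trans hxy)

lemma val_dX_le_of_pole {W : WeierstrassCurve F} (hW : IntegralCoeffs v W) {x y : F}
    (h : W.toAffine.Equation x y) (hx : 1 < v x) : v (dX W x y) ≤ v x ^ 2 := by
  have e := one_lt_val_y hW h hx
  have hx2 : v x ≤ v x ^ 2 := le_self_pow₀ hx.le two_ne_zero
  have hy : v y ≤ v x ^ 2 := by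
    rw [← pow_le_pow_iff_left₀ zero_le zero_le two_ne_zero, e, ← pow_mul]
    exact pow_le_pow_right₀ hx.le (by norm_num)
  have h2 : v (2 : F) ≤ 1 := by simpa using val_natCast_le (v := v) 2
  have h3 : v (3 : F) ≤ 1 := by simpa using val_natCast_le (v := v) 3
  refine v.map_sub_le (v.map_add_le (v.map_add_le ?_ ?_) ?_) ?_
  · rw [map_mul, map_pow]; exact mul_le_of_le_one_left' h3
  · rw [map_mul, map_mul]
    exact (mul_le_of_le_one_left' (mul_le_one' h2 hW.a₂)).trans hx2
  · exact hW.a₄.trans (hx.le.trans hx2)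
  · rw [map_mul]; exact (mul_le_of_le_one_left' hW.a₁).trans hy

lemma val_aeval_derivative_mul_le {x : F} (hx : 1 < v x) (p : k[X]) :
    v (aeval x (derivative p)) * v x ≤ v (aeval x p) := by
  by_cases hp : derivative p = 0
  · rw [hp, map_zero, map_zero, zero_mul]; exact zero_le
  have hp0 : p ≠ 0 := by rintro rfl; exact hp derivative_zero
  have hd : p.natDegree ≠ 0 := fun h => hp (by
    rw [eq_C_of_natDegree_eq_zero h, derivative_C])
  rw [valuation_aeval_eq_valuation_X_pow_natDegree_of_one_lt_valuation_X x hx hp,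
    valuation_aeval_eq_valuation_X_pow_natDegree_of_one_lt_valuation_X x hx hp0, ← pow_succ]
  have := natDegree_derivative_lt hd
  exact pow_le_pow_right₀ hx.le this

/-- The squares of the two values are powers of v(x) with exponents of different parity, so the two
terms cannot cancel. -/
lemma max_val_eq {x y : F} (hx : 1 < v x) (hy : v y ^ 2 = v x ^ 3) (p q : k[X]) :
    v (aeval x p) ≤ v (aeval x p + aeval x q * y) ∧
      v (aeval x q * y) ≤ v (aeval x p + aeval x q * y) := by
  by_cases hp : p = 0
  · rw [hp, map_zero, zero_add, map_zero]; exact ⟨zero_le, le_rfl⟩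
  by_cases hq : q = 0
  · rw [hq, map_zero, zero_mul, add_zero, map_zero]; exact ⟨le_rfl, zero_le⟩
  have hne : v (aeval x p) ≠ v (aeval x q * y) := by
    intro h
    have := congrArg (· ^ 2) h
    simp only [map_mul, mul_pow, hy] at this
    rw [valuation_aeval_eq_valuation_X_pow_natDegree_of_one_lt_valuation_X x hx hp,
      valuation_aeval_eq_valuation_X_pow_natDegree_of_one_lt_valuation_X x hx hq, ← pow_mul,
      ← pow_mul, ← pow_add] at this
    have := pow_right_injective₀ (zero_lt_one.trans hx) hx.ne' this
    omega
  rw [v.map_add_of_distinct_val hne]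
  exact ⟨le_max_left _ _, le_max_right _ _⟩

omit hv in
lemma val_deriv_div_mul_le {D : Derivation k F F} {r s : Γ} {a b : F} (hb : b ≠ 0)
    (ha' : v (D a) * r ≤ v a * s) (hb' : v (D b) * r ≤ v b * s) :
    v (D (a / b)) * r ≤ v (a / b) * s := by
  have hb0 : 0 < v b := by rwa [zero_lt_iff, v.ne_zero_iff]
  have e : D (a / b) = (b * D a - a * D b) / b ^ 2 := by
    rw [Derivation.leibniz_div, smul_eq_mul, smul_eq_mul, smul_eq_mul, inv_pow, inv_mul_eq_div]
  have h1 : v (b * D a - a * D b) * r ≤ v a * v b * s := by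
    rcases le_total (v (b * D a)) (v (a * D b)) with h | h
    · refine (mul_le_mul_left ((v.map_sub _ _).trans (max_le h le_rfl)) r).trans ?_
      rw [map_mul, mul_assoc, mul_assoc]
      exact mul_le_mul_right hb' _
    · refine (mul_le_mul_left ((v.map_sub _ _).trans (max_le le_rfl h)) r).trans ?_
      rw [map_mul, mul_assoc, mul_comm (v a), mul_assoc]
      exact mul_le_mul_right ha' _
  rw [e, map_div₀, map_div₀, map_pow, div_mul_eq_mul_div, div_mul_eq_mul_div,
    div_le_div_iff₀ (pow_pos hb0 2) hb0]
  calc _ ≤ v a * v b * s * v b := mul_le_mul_left h1 _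
    _ = _ := by rw [sq, mul_right_comm (v a) (v b), mul_assoc]

variable {W : WeierstrassCurve F} (hW : IntegralCoeffs v W) {x y : F}
  (h : W.toAffine.Equation x y) (hx : 1 < v x) {D : Derivation k F F} (hDx : D x = dY W x y)
  (hDy : D y = dX W x y)

include hW h hx hDx hDy

/-- The quotient y/x is the inverse of a uniformizer at infinity, so the bound says that the
invariant derivation raises pole orders by at most one there. -/
lemma val_deriv_mul_le [CharZero k] (p q : k[X]) :
    v (D (aeval x p + aeval x q * y)) * v x ≤ v (aeval x p + aeval x q * y) * v y := by
  have hy := one_lt_val_y hW h hx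
  have hx0 : 0 < v x := zero_lt_one.trans hx
  obtain ⟨h1, h2⟩ := max_val_eq hx hy p q
  rw [map_add, Derivation.leibniz, Derivation.map_aeval, Derivation.map_aeval, hDx, hDy,
    smul_eq_mul, smul_eq_mul, smul_eq_mul, smul_eq_mul]
  rw [← le_div_iff₀ hx0]
  have hdY := val_dY_eq_of_pole (k := k) hW h hx
  refine v.map_add_le ?_ (v.map_add_le ?_ ?_) <;> rw [le_div_iff₀ hx0]
  · rw [map_mul, hdY, mul_right_comm]
    exact mul_le_mul_left ((val_aeval_derivative_mul_le hx p).trans h1) _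
  · have h3 := val_dX_le_of_pole hW h hx
    rw [map_mul, mul_assoc]
    refine le_trans ?_ (mul_le_mul_left h2 (v y))
    rw [map_mul, mul_assoc, ← sq, hy, pow_succ]
    exact mul_le_mul_right (mul_le_mul_left h3 _) _
  · rw [map_mul, map_mul, hdY]
    refine le_trans ?_ (mul_le_mul_left h2 (v y))
    rw [map_mul, mul_comm (v y), mul_right_comm]
    refine mul_le_mul_left ?_ _
    rw [mul_right_comm]
    exact mul_le_mul_left (val_aeval_derivative_mul_le hx q) _

end InvariantDerivation

lemma exists_algebraMap_eq_of_isAlgebraic {k F : Type*} [Field k] [IsAlgClosed k] [Field F]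
    [Algebra k F] {f : F} (hf : IsAlgebraic k f) : ∃ c : k, algebraMap k F c = f :=
  minpoly.mem_range_of_degree_eq_one k f
    (IsAlgClosed.degree_eq_one_of_irreducible k (minpoly.irreducible hf.isIntegral))

/-! ### Uniformizer at infinity and residue fields of places -/

section FunctionField

variable {k : Type*} [Field k] {W : WeierstrassCurve k} {Γ : Type*}
  [LinearOrderedCommGroupWithZero Γ] {v : Valuation W.toAffine.FunctionField Γ} [v.IsTrivialOn k]

local notation "ι" => algebraMap W.toAffine.CoordinateRing W.toAffine.FunctionField

/-- The squares of values of functions are integral powers of v(x), and v(x/y)² = v(x)⁻¹; so x/y has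
the largest value below 1. -/
lemma val_mul_val_genY_le (hx : 1 < v (genX W)) {f : W.toAffine.FunctionField} (hf : v f < 1) :
    v f * v (genY W) ≤ v (genX W) := by
  by_cases hf0 : f = 0
  · rw [hf0, map_zero, zero_mul]; exact zero_le
  have hx0 : 0 < v (genX W) := zero_lt_one.trans hx
  have hy := one_lt_val_y (integralCoeffs_baseChange W) generic_equation hx
  obtain ⟨a, b, hb, rfl⟩ := IsFractionRing.div_surjective (A := W.toAffine.CoordinateRing) f
  have hb0 : b ≠ 0 := nonZeroDivisors.ne_zero hb
  have ha0 : a ≠ 0 := by rintro rfl; simp at hf0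
  have hιb : 0 < v (ι b) := by
    rw [zero_lt_iff, v.ne_zero_iff]; simpa using hb0
  rw [map_div₀, div_lt_one₀ hιb, ← pow_lt_pow_iff_left₀ zero_le zero_le two_ne_zero,
    val_sq_eq hx ha0, val_sq_eq hx hb0, pow_lt_pow_iff_right₀ hx] at hf
  rw [map_div₀, div_mul_eq_mul_div, div_le_iff₀ hιb,
    ← pow_le_pow_iff_left₀ zero_le zero_le two_ne_zero, mul_pow, mul_pow, val_sq_eq hx ha0,
    val_sq_eq hx hb0, hy, ← pow_add, ← pow_add]
  exact pow_le_pow_right₀ hx.le (by omega)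

lemma val_deriv_genX_le [CharZero k] (hx : 1 < v (genX W))
    {D : Derivation k W.toAffine.FunctionField W.toAffine.FunctionField}
    (hDx : D (genX W) = dY (W.baseChange _) (genX W) (genY W))
    (hDy : D (genY W) = dX (W.baseChange _) (genX W) (genY W)) (f : W.toAffine.FunctionField) :
    v (D f) * v (genX W) ≤ v f * v (genY W) := by
  obtain ⟨a, b, hb, rfl⟩ := IsFractionRing.div_surjective (A := W.toAffine.CoordinateRing) f
  have hb0 : ι b ≠ 0 := by simpa using nonZeroDivisors.ne_zero hb
  obtain ⟨p, q, -, ea⟩ := exists_eq_algebraMap a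
  obtain ⟨p', q', -, eb⟩ := exists_eq_algebraMap b
  have hW : IntegralCoeffs v (W.baseChange W.toAffine.FunctionField) := integralCoeffs_baseChange W
  refine val_deriv_div_mul_le hb0 ?_ ?_
  · rw [ea]; exact val_deriv_mul_le hW generic_equation hx hDx hDy p q
  · rw [eb]; exact val_deriv_mul_le hW generic_equation hx hDx hDy p' q'

lemma isAlgebraic_adjoin_of_transcendental {f : W.toAffine.FunctionField}
    (hf : Transcendental k f) :
    Algebra.IsAlgebraic (Algebra.adjoin k {f}) W.toAffine.FunctionField := by
  have h1 : FiniteDimensional (IntermediateField.adjoin k {genX W}) W.toAffine.FunctionField :=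
    Module.finite_of_finrank_pos (Nat.pos_of_ne_zero (finrank_adjoin_genX_ne_zero W))
  have h2 : Algebra.IsAlgebraic (Algebra.adjoin k {genX W}) W.toAffine.FunctionField := by
    open scoped IntermediateField.algebraAdjoinAdjoin in
    exact (IsFractionRing.comap_isAlgebraic_iff (A := Algebra.adjoin k {genX W})
      (K := IntermediateField.adjoin k {genX W})).mpr inferInstance
  have h3 := Algebra.IsAlgebraic.trdeg_le_cardinalMk k {genX W}
  rw [Cardinal.mk_singleton] at h3
  have h4 : AlgebraicIndependent k (fun _ : Unit => f) :=
    (algebraicIndependent_unique_type_iff).mpr hf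
  have h5 := (h4.isTranscendenceBasis_of_lift_trdeg_le_of_finite (by simpa using h3)).isAlgebraic
  rwa [Set.range_const] at h5

/-- The residue field of a nontrivial place of the function field over an algebraically closed
field is the constant field. -/
lemma exists_val_sub_lt_one [IsAlgClosed k] {t : W.toAffine.FunctionField} (ht0 : t ≠ 0)
    (ht : v t < 1) {f : W.toAffine.FunctionField} (hf : v f ≤ 1) :
    ∃ c : k, v (f - algebraMap k _ c) < 1 := by
  by_cases hft : Transcendental k f
  -- In transcendence degree 1, t is algebraic over k[f]. Since v t < 1, the nonzero constant
  -- coefficient p(f) of an equation for t has value below 1; as p splits over k, some factor f - c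
  -- has value below 1.
  · have := isAlgebraic_adjoin_of_transcendental hft
    obtain ⟨q, hq0, hq⟩ := (Algebra.IsAlgebraic.isAlgebraic (R := Algebra.adjoin k {f})
      t).exists_nonzero_coeff_and_aeval_eq_zero (mem_nonZeroDivisors_of_ne_zero ht0)
    have hp (p : k[X]) : v (aeval f p) ≤ 1 := by
      rw [aeval_eq_sum_range]
      refine v.map_sum_le fun i _ => ?_
      rw [Algebra.smul_def, map_mul, map_pow]
      exact mul_le_one' (val_le_one_of_isTrivialOn _) (pow_le_one' hf _)
    have hmem (a : W.toAffine.FunctionField) (ha : a ∈ Algebra.adjoin k {f}) :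
        ∃ p : k[X], aeval f p = a := by
      rwa [Algebra.adjoin_singleton_eq_range_aeval] at ha
    have hA (a : Algebra.adjoin k {f}) : v (a : W.toAffine.FunctionField) ≤ 1 := by
      obtain ⟨p, hp'⟩ := hmem a a.2
      rw [← hp']
      exact hp p
    have e := q.divX_mul_X_add
    have h1 : v (aeval t q.divX) ≤ 1 := by
      rw [aeval_eq_sum_range]
      refine v.map_sum_le fun i _ => ?_
      rw [Algebra.smul_def, map_mul, map_pow]
      exact mul_le_one' (hA _) (pow_le_one' ht.le _)
    obtain ⟨p, hp0⟩ := hmem _ (q.coeff 0).2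
    have hpne : p ≠ 0 := by
      rintro rfl
      rw [map_zero] at hp0
      exact hq0 (Subtype.ext hp0.symm)
    rw [← e, map_add, map_mul, aeval_X, aeval_C] at hq
    have h2 : v (aeval f p) < 1 := by
      rw [hp0, show (q.coeff 0 : W.toAffine.FunctionField) = -(aeval t q.divX * t) from
        eq_neg_of_add_eq_zero_right hq, Valuation.map_neg, map_mul]
      exact (mul_le_of_le_one_left' h1).trans_lt ht
    by_contra! hc
    have h3 : v (aeval f p) = 1 := by
      have hs := IsAlgClosed.splits p
      rw [hs.eq_prod_roots, map_mul, aeval_C, map_multiset_prod, Multiset.map_map, map_mul,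
        Valuation.IsTrivialOn.eq_one (v := v) _ (leadingCoeff_ne_zero.mpr hpne), one_mul,
        map_multiset_prod, Multiset.map_map]
      apply Multiset.prod_eq_one
      intro r hr
      obtain ⟨c, -, rfl⟩ := Multiset.mem_map.mp hr
      simp only [Function.comp, map_sub, aeval_X, aeval_C]
      exact le_antisymm (v.map_sub_le hf (val_le_one_of_isTrivialOn c)) (hc c)
    exact h2.ne h3
  · rw [Transcendental, not_not] at hft
    obtain ⟨c, rfl⟩ := exists_algebraMap_eq_of_isAlgebraic hft
    exact ⟨c, by simp⟩

end FunctionField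

/-! ### Points over the function field -/

section GenericPoint

variable {k M V : Type*} [Field k] [Field M] [Algebra k M]

section
variable (W : WeierstrassCurve k) [W.IsElliptic]

/-- The generic point of an elliptic curve. -/
def genPoint : (W.baseChange W.toAffine.FunctionField).toAffine.Point :=
  .some (genX W) (genY W) (Affine.equation_iff_nonsingular.mp generic_equation)

end

lemma exists_const_of_isAlgebraic [IsAlgClosed k] {W : WeierstrassCurve k} {x y : M}
    (h : (W.baseChange M).toAffine.Nonsingular x y) (hx : IsAlgebraic k x) :
    ∃ a b : k, W.toAffine.Nonsingular a b ∧ algebraMap k M a = x ∧ algebraMap k M b = y := by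
  obtain ⟨a, rfl⟩ := exists_algebraMap_eq_of_isAlgebraic hx
  have hy : _root_.IsIntegral k y := by
    refine ⟨X ^ 2 + C (W.a₁ * a + W.a₃) * X - C (a ^ 3 + W.a₂ * a ^ 2 + W.a₄ * a + W.a₆),
      by monicity!, ?_⟩
    have e := equation_eq h.1
    simp only [baseChange, map_a₁, map_a₂, map_a₃, map_a₄, map_a₆] at e
    simp only [eval₂_sub, eval₂_add, eval₂_mul, eval₂_pow, eval₂_X, eval₂_C, map_add, map_mul,
      map_pow]
    linear_combination e
  obtain ⟨b, rfl⟩ := exists_algebraMap_eq_of_isAlgebraic hy.isAlgebraic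
  exact ⟨a, b, (Affine.map_nonsingular W.toAffine (algebraMap k M).injective a b).mp h, rfl, rfl⟩

lemma val_y_le_one {F Γ : Type*} [Field F] [LinearOrderedCommGroupWithZero Γ] {v : Valuation F Γ}
    {W : WeierstrassCurve F} (hW : IntegralCoeffs v W) {x y : F} (h : W.toAffine.Equation x y)
    (hx : v x ≤ 1) : v y ≤ 1 := by
  by_contra! hy
  have e := equation_eq h
  have h1 : v (x ^ 3 + W.a₂ * x ^ 2 + W.a₄ * x + W.a₆) ≤ 1 := by
    refine v.map_add_le (v.map_add_le (v.map_add_le ?_ ?_) ?_) hW.a₆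
    · rw [map_pow]; exact pow_le_one' hx 3
    · rw [map_mul, map_pow]; exact mul_le_one' hW.a₂ (pow_le_one' hx 2)
    · rw [map_mul]; exact mul_le_one' hW.a₄ hx
  have h2 : v (y + (W.a₁ * x + W.a₃)) = v y := by
    refine Valuation.map_add_eq_of_lt_left _ (lt_of_le_of_lt (v.map_add_le ?_ hW.a₃) hy)
    rw [map_mul]; exact mul_le_one' hW.a₁ hx
  rw [← e, show y ^ 2 + W.a₁ * x * y + W.a₃ * y = y * (y + (W.a₁ * x + W.a₃)) by ring, map_mul,
    h2] at h1
  exact absurd h1 (not_le.mpr (one_lt_mul'' hy hy))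

lemma val_dY_sub_lt {F Γ : Type*} [Field F] [LinearOrderedCommGroupWithZero Γ] {v : Valuation F Γ}
    {W : WeierstrassCurve F} (hW : IntegralCoeffs v W) {x y a b : F} (ha : v (x - a) < 1)
    (hb : v (y - b) < 1) : v (dY W x y - dY W a b) < 1 := by
  have h2 : v (2 : F) ≤ 1 := by simpa using val_natCast_le (v := v) 2
  rw [show dY W x y - dY W a b = 2 * (y - b) + W.a₁ * (x - a) by simp only [dY]; ring]
  refine v.map_add_lt ?_ ?_ <;> rw [map_mul]
  · exact (mul_le_of_le_one_left' h2).trans_lt hb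
  · exact (mul_le_of_le_one_left' hW.a₁).trans_lt ha

lemma val_dX_sub_lt {F Γ : Type*} [Field F] [LinearOrderedCommGroupWithZero Γ] {v : Valuation F Γ}
    {W : WeierstrassCurve F} (hW : IntegralCoeffs v W) {x y a b : F} (hx : v x ≤ 1)
    (ha : v (x - a) < 1) (hb : v (y - b) < 1) : v (dX W x y - dX W a b) < 1 := by
  have h2 : v (2 : F) ≤ 1 := by simpa using val_natCast_le (v := v) 2
  have h3 : v (3 : F) ≤ 1 := by simpa using val_natCast_le (v := v) 3
  have ha' : v a ≤ 1 := by rw [← sub_sub_cancel x a]; exact v.map_sub_le hx ha.le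
  rw [show dX W x y - dX W a b = (3 * (x + a) + 2 * W.a₂) * (x - a) - W.a₁ * (y - b) by
    simp only [dX]; ring]
  refine v.map_sub_lt ?_ ?_ <;> rw [map_mul]
  · refine (mul_le_of_le_one_left' (v.map_add_le ?_ ?_)).trans_lt ha <;> rw [map_mul]
    · exact mul_le_one' h3 (v.map_add_le hx ha')
    · exact mul_le_one' h2 hW.a₂
  · exact (mul_le_of_le_one_left' hW.a₁).trans_lt hb

/-- The equation evaluated at (a, b) is a constant congruent to its value 0 at (x, y), and a nonzero
constant has value 1. -/
lemma equation_of_val_sub_lt {Γ : Type*} [LinearOrderedCommGroupWithZero Γ] {v : Valuation M Γ}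
    [hv : v.IsTrivialOn k] {W : WeierstrassCurve k} {x y : M}
    (h : (W.baseChange M).toAffine.Equation x y) (hx : v x ≤ 1) (hy : v y ≤ 1) {a b : k}
    (ha : v (x - algebraMap k M a) < 1) (hb : v (y - algebraMap k M b) < 1) :
    W.toAffine.Equation a b := by
  have e := equation_eq h
  simp only [baseChange, map_a₁, map_a₂, map_a₃, map_a₄, map_a₆] at e
  rw [Affine.equation_iff']
  by_contra h0
  have h1 := hv.eq_one _ h0
  have hc (c : k) : v (algebraMap k M c) ≤ 1 := val_le_one_of_isTrivialOn c
  simp only [toAffine, map_sub, map_add, map_mul, map_pow] at h1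
  generalize algebraMap k M a = a' at *
  generalize algebraMap k M b = b' at *
  have ha' : v a' ≤ 1 := by
    rw [← sub_sub_cancel x a']; exact v.map_sub_le hx ha.le
  have hb' : v b' ≤ 1 := by
    rw [← sub_sub_cancel y b']; exact v.map_sub_le hy hb.le
  have h2 : b' ^ 2 + algebraMap k M W.a₁ * a' * b' + algebraMap k M W.a₃ * b' -
      (a' ^ 3 + algebraMap k M W.a₂ * a' ^ 2 + algebraMap k M W.a₄ * a' + algebraMap k M W.a₆) =
      (x - a') * (x * (x + a') + a' ^ 2 + algebraMap k M W.a₂ * (x + a') + algebraMap k M W.a₄ -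
        algebraMap k M W.a₁ * b') -
      (y - b') * (y + b' + algebraMap k M W.a₁ * x + algebraMap k M W.a₃) := by
    linear_combination e
  rw [h2] at h1
  refine h1.not_lt (v.map_sub_lt ?_ ?_)
  · rw [map_mul]
    refine (mul_le_of_le_one_right' ?_).trans_lt ha
    have hs := v.map_add_le hx ha'
    refine v.map_sub_le (v.map_add_le (v.map_add_le (v.map_add_le ?_ ?_) ?_) (hc _)) ?_
    · rw [map_mul]; exact mul_le_one' hx hs
    · rw [map_pow]; exact pow_le_one' ha' 2
    · rw [map_mul]; exact mul_le_one' (hc _) hs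
    · rw [map_mul]; exact mul_le_one' (hc _) hb'
  · rw [map_mul]
    refine (mul_le_of_le_one_right' ?_).trans_lt hb
    refine v.map_add_le (v.map_add_le (v.map_add_le hy hb') ?_) (hc _)
    rw [map_mul]; exact mul_le_one' (hc _) hx

variable [AddCommGroup V] [Module k V] [Module M V]

lemma logDer_pointBaseChange {k : Type u} {M : Type u} {V : Type*} [Field k] [Field M] [Algebra k M]
    [AddCommGroup V] [Module k V] [Module M V] (h2 : (2 : M) ≠ 0) (W : WeierstrassCurve k)
    (d : Derivation k M V) (P : W.toAffine.Point) :
    logDer d (W.baseChange M) (pointBaseChange W M P) = 0 := by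
  cases P with
  | zero => rfl
  | some a b h =>
    exact logDer_eq_of_deriv_eq _ h2 (constCoeffs_baseChange W d) (by simp) (by simp)

lemma logDer_map {M' V' : Type*} [Field M'] [Algebra k M'] [AddCommGroup V'] [Module k V']
    [Module M' V'] [DecidableEq M] [DecidableEq M'] (h2 : (2 : M) ≠ 0) (h2' : (2 : M') ≠ 0)
    {W : WeierstrassCurve k} {d : Derivation k M V} {d' : Derivation k M' V'}
    (τ : M →ₐ[k] M') (u : V →+ V') (hu : ∀ a w, u (a • w) = τ a • u w)
    (hd : ∀ a, u (d a) = d' (τ a)) (P : (W.baseChange M).toAffine.Point) :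
    logDer d' (W.baseChange M') (Affine.Point.map (W' := W) τ P) =
      u (logDer d (W.baseChange M) P) := by
  cases P with
  | zero => exact (map_zero u).symm
  | some x y h =>
    have hτ : (W.baseChange M).map (τ : M →+* M') = W.baseChange M' := W.map_baseChange τ
    obtain ⟨ex, ey⟩ := deriv_eq_smul_logDer h2 (constCoeffs_baseChange W d) h
    refine logDer_eq_of_deriv_eq _ h2' (constCoeffs_baseChange W d') ?_ ?_
    · rw [← hd, ex, hu, ← hτ]
      congr 1
      exact map_dY (τ : M →+* M') x y
    · rw [← hd, ey, hu, ← hτ]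
      congr 1
      exact map_dX (τ : M →+* M') x y

lemma exists_kaehler_map {M' : Type*} [Field M'] [Algebra k M'] (τ : M →ₐ[k] M') :
    ∃ u : KaehlerDifferential k M →+ KaehlerDifferential k M', (∀ a w, u (a • w) = τ a • u w) ∧
      ∀ a, u (KaehlerDifferential.D k M a) = KaehlerDifferential.D k M' (τ a) := by
  let _ : Algebra M M' := (τ : M →+* M').toAlgebra
  have : IsScalarTower k M M' := .of_algebraMap_eq fun c => (τ.commutes c).symm
  refine ⟨(KaehlerDifferential.map k k M M').toAddMonoidHom, fun a w => ?_, fun a => ?_⟩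
  · exact (map_smul (KaehlerDifferential.map k k M M') a w)
  · exact KaehlerDifferential.map_D k k M M' a

end GenericPoint

/-! ### The invariant derivation and regularity of pulled back differentials at infinity -/

section FunctionField

variable {k : Type*} [Field k] {W : WeierstrassCurve k}

local notation "ι" => algebraMap W.toAffine.CoordinateRing W.toAffine.FunctionField

lemma derivation_eq_zero {V : Type*} [AddCommGroup V] [Module k V] [Module W.toAffine.FunctionField
    V]
    {d : Derivation k W.toAffine.FunctionField V} (hx : d (genX W) = 0) (hy : d (genY W) = 0) (f :
        W.toAffine.FunctionField) : d f = 0 := by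
  have hc (a : W.toAffine.CoordinateRing) : d (ι a) = 0 := by
    obtain ⟨p, q, -, e⟩ := exists_eq_algebraMap a
    rw [e, map_add, Derivation.leibniz, Derivation.map_aeval, Derivation.map_aeval, hx, hy]
    simp only [smul_zero, add_zero]
  obtain ⟨a, b, hb, rfl⟩ := IsFractionRing.div_surjective (A := W.toAffine.CoordinateRing) f
  rw [Derivation.leibniz_div, hc, hc, smul_zero, smul_zero, sub_zero, smul_zero]

variable [W.IsElliptic] [CharZero k]

variable (W) in
lemma logDer_genPoint_ne_zero :
    logDer (KaehlerDifferential.D k W.toAffine.FunctionField) (W.baseChange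
        W.toAffine.FunctionField) (genPoint W) ≠ 0 :=
  logDer_ne_zero (constCoeffs_baseChange W _) _ transcendental_genX

variable (W) in
/-- The derivation dual to the invariant differential. -/
lemma exists_invariant_derivation : ∃ D : Derivation k W.toAffine.FunctionField
    W.toAffine.FunctionField,
    D (genX W) = dY (W.baseChange W.toAffine.FunctionField) (genX W) (genY W) ∧
    D (genY W) = dX (W.baseChange W.toAffine.FunctionField) (genX W) (genY W) ∧
    ∀ f, KaehlerDifferential.D k W.toAffine.FunctionField f =
      D f • logDer (KaehlerDifferential.D k W.toAffine.FunctionField) (W.baseChange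
          W.toAffine.FunctionField) (genPoint W) := by
  have : CharZero W.toAffine.FunctionField := charZero_of_injective_algebraMap (algebraMap k
      W.toAffine.FunctionField).injective
  obtain ⟨ex, ey⟩ := deriv_eq_smul_logDer (two_ne_zero) (constCoeffs_baseChange W
    (KaehlerDifferential.D k W.toAffine.FunctionField)) (Affine.equation_iff_nonsingular.mp
        (generic_equation (W := W)))
  change _ = _ • logDer _ _ (genPoint W) at ex ey
  obtain ⟨ω, hω⟩ : ∃ ω, ω = logDer (KaehlerDifferential.D k W.toAffine.FunctionField) (W.baseChange
      W.toAffine.FunctionField) (genPoint W) :=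
    ⟨_, rfl⟩
  have hω0 := logDer_genPoint_ne_zero W
  rw [← hω] at hω0 ex ey ⊢
  -- A functional with l(ω) = 1 turns the universal derivation into D; the derivation f ↦ df - D(f)ω
  -- kills both coordinates, hence everything.
  obtain ⟨l, hl⟩ := Module.Projective.exists_dual_eq_one W.toAffine.FunctionField hω0
  let D := l.compDer (KaehlerDifferential.D k W.toAffine.FunctionField)
  have hDx : D (genX W) = dY (W.baseChange W.toAffine.FunctionField) (genX W) (genY W) := by
    refine (congrArg l ex).trans ?_
    rw [map_smul, hl, smul_eq_mul, mul_one]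
  have hDy : D (genY W) = dX (W.baseChange W.toAffine.FunctionField) (genX W) (genY W) := by
    refine (congrArg l ey).trans ?_
    rw [map_smul, hl, smul_eq_mul, mul_one]
  refine ⟨D, hDx, hDy, fun f => sub_eq_zero.mp (derivation_eq_zero
    (d := KaehlerDifferential.D k W.toAffine.FunctionField - (LinearMap.toSpanSingleton
        W.toAffine.FunctionField _ ω).compDer D) ?_ ?_ f)⟩
  · change KaehlerDifferential.D k W.toAffine.FunctionField (genX W) - D (genX W) • ω = 0
    rw [ex, hDx, sub_self]
  · change KaehlerDifferential.D k W.toAffine.FunctionField (genY W) - D (genY W) • ω = 0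
    rw [ey, hDy, sub_self]

variable {Γ : Type*} [LinearOrderedCommGroupWithZero Γ] {v : Valuation W.toAffine.FunctionField Γ}
  [hv : v.IsTrivialOn k]

omit [W.IsElliptic] in
-- The pullback of the invariant differential of W' along Z is regular at infinity. If x(Z) is
-- integral, Z reduces to a nonsingular point, the derivatives of its coordinates are integral, and
-- dY or dX is a unit. If x(Z) has a pole, the derivative bound is played against x/y being at most
-- a uniformizer.
lemma val_logDer_le_one [IsAlgClosed k] (hx : 1 < v (genX W)) {D : Derivation k
    W.toAffine.FunctionField W.toAffine.FunctionField}
    (hDx : D (genX W) = dY (W.baseChange W.toAffine.FunctionField) (genX W) (genY W))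
    (hDy : D (genY W) = dX (W.baseChange W.toAffine.FunctionField) (genX W) (genY W))
    {W' : WeierstrassCurve k} [W'.IsElliptic] (Z : (W'.baseChange
        W.toAffine.FunctionField).toAffine.Point) :
    v (logDer D (W'.baseChange W.toAffine.FunctionField) Z) ≤ 1 := by
  have : CharZero W.toAffine.FunctionField := charZero_of_injective_algebraMap (algebraMap k
      W.toAffine.FunctionField).injective
  cases Z with
  | zero => change v 0 ≤ 1; simp
  | some x y h =>
    have hW : IntegralCoeffs v (W.baseChange W.toAffine.FunctionField) := integralCoeffs_baseChange
        W
    have hW' : IntegralCoeffs v (W'.baseChange W.toAffine.FunctionField) :=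
        integralCoeffs_baseChange W'
    have hx0 : 0 < v (genX W) := zero_lt_one.trans hx
    have hy := one_lt_val_y hW generic_equation hx
    have hy0 : 0 < v (genY W) := hx0.trans (val_lt_of_sq_eq_cube hx hy)
    obtain ⟨ex, ey⟩ := deriv_eq_smul_logDer (two_ne_zero) (constCoeffs_baseChange W' D) h
    obtain ⟨l, hl⟩ : ∃ l, l = logDer D (W'.baseChange W.toAffine.FunctionField) (.some x y h) :=
        ⟨_, rfl⟩
    rw [← hl, smul_eq_mul] at ex ey
    rw [← hl]
    rcases le_or_gt (v x) 1 with h1 | h1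
    · have h2 := val_y_le_one hW' h.1 h1
      obtain ⟨a, ha⟩ := exists_val_sub_lt_one (t := (genX W)⁻¹)
        (inv_ne_zero (v.ne_zero_iff.mp hx0.ne')) (by rw [map_inv₀]; exact inv_lt_one_of_one_lt₀ hx)
            h1
      obtain ⟨b, hb⟩ := exists_val_sub_lt_one (t := (genX W)⁻¹)
        (inv_ne_zero (v.ne_zero_iff.mp hx0.ne')) (by rw [map_inv₀]; exact inv_lt_one_of_one_lt₀ hx)
            h2
      -- Subtracting its residue does not change the derivative of f and makes f vanish, which
      -- compensates the one order that D can lose.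
      have hD (f : W.toAffine.FunctionField) (c : k) (hf : v (f - algebraMap k
          W.toAffine.FunctionField c) < 1) : v (D f) ≤ 1 := by
        have e1 := val_deriv_genX_le hx hDx hDy (f - algebraMap k W.toAffine.FunctionField c)
        rw [map_sub, Derivation.map_algebraMap, sub_zero] at e1
        have e2 := e1.trans (val_mul_val_genY_le hx hf)
        rwa [mul_le_iff_le_one_left hx0] at e2
      have hab := equation_of_val_sub_lt h.1 h1 h2 ha hb
      have hdY : v (dY (W'.baseChange W.toAffine.FunctionField) x y - algebraMap k
          W.toAffine.FunctionField (dY W' a b)) < 1 := by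
        rw [map_dY]
        exact val_dY_sub_lt hW' ha hb
      have hdX : v (dX (W'.baseChange W.toAffine.FunctionField) x y - algebraMap k
          W.toAffine.FunctionField (dX W' a b)) < 1 := by
        rw [map_dX]
        exact val_dX_sub_lt hW' h1 ha hb
      have key (r : W.toAffine.FunctionField) (c : k) (hc : c ≠ 0) (hr : v (r - algebraMap k
          W.toAffine.FunctionField c) < 1) (f : W.toAffine.FunctionField)
          (hf : v f ≤ 1) (e : f = r * l) : v l ≤ 1 := by
        have : v r = 1 := by
          rw [← sub_add_cancel r (algebraMap k W.toAffine.FunctionField c),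
              Valuation.map_add_eq_of_lt_right,
            hv.eq_one c hc]
          rwa [hv.eq_one c hc]
        rwa [e, map_mul, this, one_mul] at hf
      rcases dY_ne_zero_or_dX_ne_zero (Affine.equation_iff_nonsingular.mp hab) with h3 | h3
      · exact key _ _ h3 hdY _ (hD x a ha) ex
      · exact key _ _ h3 hdX _ (hD y b hb) ey
    · have e := one_lt_val_y hW' h.1 h1
      have hy1 : 0 < v y := (zero_lt_one.trans h1).trans (val_lt_of_sq_eq_cube h1 e)
      have e1 := val_deriv_genX_le hx hDx hDy x
      have hu : v (x / y) < 1 := by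
        rw [map_div₀, div_lt_one₀ hy1]; exact val_lt_of_sq_eq_cube h1 e
      have e2 := val_mul_val_genY_le hx hu
      rw [ex, map_mul, val_dY_eq_of_pole (k := k) hW' h.1 h1] at e1
      rw [map_div₀, div_mul_eq_mul_div, div_le_iff₀ hy1] at e2
      have e3 := e1.trans e2
      rwa [mul_comm (v (genX W)), mul_right_comm, mul_le_iff_le_one_right (mul_pos hy1 hx0)] at e3

end FunctionField

/-! ### Translations and the homomorphism attached to a point over the function field -/

section PointBaseChange

variable {k : Type u} [Field k] (W : WeierstrassCurve k) (F : Type u) [Field F] [Algebra k F]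
  [DecidableEq k] [DecidableEq F]

lemma pointBaseChange_neg (P : W.toAffine.Point) :
    pointBaseChange W F (-P) = -pointBaseChange W F P := by
  rw [pointBaseChange_eq_map, pointBaseChange_eq_map]
  exact (Affine.Point.map (W' := W) (S := k) (F := k) (Algebra.ofId k F)).map_neg P

lemma pointBaseChange_sub (P Q : W.toAffine.Point) :
    pointBaseChange W F (P - Q) = pointBaseChange W F P - pointBaseChange W F Q := by
  rw [sub_eq_add_neg, sub_eq_add_neg, pointBaseChange_add, pointBaseChange_neg]

end PointBaseChange

section LogDer

variable {k : Type u} [Field k] {W : WeierstrassCurve k} [W.IsElliptic] {M : Type u} [Field M]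
  [Algebra k M] [CharZero k] {W' : WeierstrassCurve k}

/-- In characteristic 0 a transcendental x-coordinate would have nonzero differential, so x and then
y are algebraic over the algebraically closed k, hence constants. -/
lemma exists_pointBaseChange_of_logDer_eq_zero [IsAlgClosed k] {Z : (W'.baseChange
    M).toAffine.Point}
    (hZ : logDer (KaehlerDifferential.D k M) (W'.baseChange M) Z = 0) :
    ∃ P, Z = pointBaseChange W' M P := by
  cases Z with
  | zero => exact ⟨.zero, rfl⟩
  | some x y h =>
    by_cases hx : IsAlgebraic k x
    · obtain ⟨a, b, h', rfl, rfl⟩ := exists_const_of_isAlgebraic h hx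
      exact ⟨.some a b h', rfl⟩
    · exact absurd hZ (logDer_ne_zero (constCoeffs_baseChange W' _) h hx)

/-- A homomorphism of fields respects proportionality to the invariant differential. -/
lemma logDer_map_eq_smul [DecidableEq W.toAffine.FunctionField] [DecidableEq M] {X : (W'.baseChange
    W.toAffine.FunctionField).toAffine.Point}
    {g : W.toAffine.FunctionField}
    (hg : logDer (KaehlerDifferential.D k _) (W'.baseChange W.toAffine.FunctionField) X =
      g • logDer (KaehlerDifferential.D k _) (W.baseChange _) (genPoint W))
    (τ : W.toAffine.FunctionField →ₐ[k] M) :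
    logDer (KaehlerDifferential.D k _) (W'.baseChange M) (Affine.Point.map (W' := W') τ X) =
      τ g • logDer (KaehlerDifferential.D k _) (W.baseChange M)
        (Affine.Point.map (W' := W) τ (genPoint W)) := by
  have : CharZero M := charZero_of_injective_algebraMap (algebraMap k M).injective
  have : CharZero W.toAffine.FunctionField :=
    charZero_of_injective_algebraMap (algebraMap k _).injective
  obtain ⟨u, hu, hd⟩ := exists_kaehler_map τ
  rw [logDer_map two_ne_zero two_ne_zero τ u hu hd, logDer_map two_ne_zero two_ne_zero τ u hu hd,
    hg, hu]

lemma logDer_add_pointBaseChange [DecidableEq M] (Z : (W'.baseChange M).toAffine.Point) (A :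
    W'.toAffine.Point) :
    logDer (KaehlerDifferential.D k M) (W'.baseChange M) (Z + pointBaseChange W' M A) =
      logDer (KaehlerDifferential.D k M) (W'.baseChange M) Z := by
  have : CharZero M := charZero_of_injective_algebraMap (algebraMap k M).injective
  rw [logDer_add two_ne_zero (constCoeffs_baseChange W' _), logDer_pointBaseChange two_ne_zero,
    add_zero]

end LogDer

section Translation

variable {k : Type u} [Field k] {W : WeierstrassCurve k} [W.IsElliptic] {M : Type u} [Field M]
  [Algebra k M]

lemma genPoint_ne_pointBaseChange (P : W.toAffine.Point) :
    genPoint W ≠ pointBaseChange W _ P := by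
  cases P with
  | zero => exact Affine.Point.some_ne_zero _
  | some a b h =>
    intro e
    exact transcendental_genX (W := W) ((Affine.Point.some.inj e).1 ▸ isAlgebraic_algebraMap a)

section

variable [DecidableEq W.toAffine.FunctionField] [DecidableEq M]

lemma algHom_ext_genPoint {τ σ : W.toAffine.FunctionField →ₐ[k] M}
    (h : Affine.Point.map (W' := W) τ (genPoint W) = Affine.Point.map (W' := W) σ (genPoint W)) :
    τ = σ :=
  functionField_algHom_ext (Affine.Point.some.inj h).1 (Affine.Point.some.inj h).2

/-- A nonconstant point has transcendental x-coordinate, so evaluation at it embeds the function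
field. -/
lemma exists_map_genPoint_eq [IsAlgClosed k] {Z : (W.baseChange M).toAffine.Point}
    (hZ : ∀ P, Z ≠ pointBaseChange W M P) : ∃ τ : W.toAffine.FunctionField →ₐ[k] M,
      Affine.Point.map (W' := W) τ (genPoint W) = Z := by
  cases Z with
  | zero => exact absurd rfl (hZ .zero)
  | some x y h =>
    have hx : Transcendental k x := by
      intro hx
      obtain ⟨a, b, h', rfl, rfl⟩ := exists_const_of_isAlgebraic h hx
      exact hZ (.some a b h') rfl
    refine ⟨evalAlgHom W h.1 hx, (Affine.Point.map_some _ _).trans ?_⟩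
    simp only [evalAlgHom_genX, evalAlgHom_genY]

end

variable [IsAlgClosed k] [DecidableEq k] [DecidableEq W.toAffine.FunctionField]

lemma exists_translation (A : W.toAffine.Point) :
    ∃ τ : W.toAffine.FunctionField →ₐ[k] W.toAffine.FunctionField,
      Affine.Point.map (W' := W) τ (genPoint W) = genPoint W + pointBaseChange W _ A := by
  refine exists_map_genPoint_eq fun P hP => genPoint_ne_pointBaseChange (P - A) ?_
  rw [← eq_sub_iff_add_eq] at hP
  rw [hP, pointBaseChange_sub]

/-- The pullback of functions along the translation by `A`. -/
def translation (A : W.toAffine.Point) :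
    W.toAffine.FunctionField →ₐ[k] W.toAffine.FunctionField := (exists_translation A).choose

lemma map_translation_genPoint (A : W.toAffine.Point) :
    Affine.Point.map (W' := W) (translation A) (genPoint W) =
      genPoint W + pointBaseChange W _ A := (exists_translation A).choose_spec

lemma translation_comp (A B : W.toAffine.Point) :
    (translation A).comp (translation B) = translation (A + B) := by
  apply algHom_ext_genPoint
  rw [← Affine.Point.map_map, map_translation_genPoint, map_translation_genPoint, map_add,
    map_translation_genPoint, map_pointBaseChange, pointBaseChange_add, add_assoc]

lemma translation_zero : translation (0 : W.toAffine.Point) = AlgHom.id k _ := by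
  apply algHom_ext_genPoint
  rw [map_translation_genPoint]
  exact add_zero _

variable [CharZero k] {W' : WeierstrassCurve k} [W'.IsElliptic]

omit [IsAlgClosed k] [DecidableEq k] [DecidableEq W.toAffine.FunctionField] [W'.IsElliptic] in
lemma logDer_eq_logDer_smul {D : Derivation k W.toAffine.FunctionField W.toAffine.FunctionField}
    (hD : ∀ f, KaehlerDifferential.D k W.toAffine.FunctionField f = D f •
      logDer (KaehlerDifferential.D k _) (W.baseChange W.toAffine.FunctionField) (genPoint W))
    (X : (W'.baseChange W.toAffine.FunctionField).toAffine.Point) :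
    logDer (KaehlerDifferential.D k _) (W'.baseChange W.toAffine.FunctionField) X =
      logDer D (W'.baseChange W.toAffine.FunctionField) X •
        logDer (KaehlerDifferential.D k _) (W.baseChange _) (genPoint W) := by
  have : CharZero W.toAffine.FunctionField :=
    charZero_of_injective_algebraMap (algebraMap k _).injective
  cases X with
  | zero => exact (zero_smul _ _).symm
  | some x y h =>
    obtain ⟨ex, ey⟩ := deriv_eq_smul_logDer two_ne_zero (constCoeffs_baseChange W' D) h
    refine logDer_eq_of_deriv_eq h two_ne_zero (constCoeffs_baseChange W' _) ?_ ?_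
    · rw [hD, ex, smul_eq_mul, mul_smul]
    · rw [hD, ey, smul_eq_mul, mul_smul]

variable {Γ : Type*} [LinearOrderedCommGroupWithZero Γ] {v : Valuation W.toAffine.FunctionField Γ}
  [hv : v.IsTrivialOn k]

omit [CharZero k] in
/-- A place of the function field becomes a pole of `x` after a translation. -/
lemma exists_one_lt_val_translation {t : W.toAffine.FunctionField} (ht0 : t ≠ 0) (ht : v t < 1)
    (hx : v (genX W) ≤ 1) : ∃ A : W.toAffine.Point, 1 < v (translation A (genX W)) := by
  have hW : IntegralCoeffs v (W.baseChange W.toAffine.FunctionField) :=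
    integralCoeffs_baseChange W
  have hy := val_y_le_one hW generic_equation hx
  obtain ⟨a, ha⟩ := exists_val_sub_lt_one ht0 ht hx
  obtain ⟨b, hb⟩ := exists_val_sub_lt_one ht0 ht hy
  have hE : W.toAffine.Equation a b :=
    equation_of_val_sub_lt (W := W) generic_equation hx hy ha hb
  have hB : W.toAffine.Nonsingular a b := Affine.equation_iff_nonsingular.mp hE
  have hred : ReducesTo v (genPoint W) (algebraMap k _ a) (algebraMap k _ b) :=
    ⟨_, _, _, rfl, ha, hb⟩
  have hB' : (W.baseChange W.toAffine.FunctionField).toAffine.Nonsingular (algebraMap k _ a)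
      (algebraMap k _ b) := (Affine.map_nonsingular W.toAffine (algebraMap k _).injective a b).mpr
          hB
  have hpole : HasPole v (genPoint W - pointBaseChange W _ (.some a b hB)) := by
    refine hred.hasPole_sub hW hB' (val_le_one_of_isTrivialOn a) (val_le_one_of_isTrivialOn b)
      (val_algebraMap_eq_one_or hB) fun y' h'' he => ?_
    exact transcendental_genX (W := W)
      ((Affine.Point.some.inj he).1 ▸ isAlgebraic_algebraMap a)
  -- The generic point reduces to (a, b) at this place, so translating by -(a, b) makes it reduce to
  -- the origin.
  refine ⟨-.some a b hB, ?_⟩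
  have hτ := map_translation_genPoint (-.some a b hB)
  rw [pointBaseChange_neg, ← sub_eq_add_neg] at hτ
  obtain ⟨x, y, h, e, hx⟩ := hpole
  rw [e] at hτ
  rw [(Affine.Point.some.inj hτ).1]
  exact hx

/-- The invariant differential pulls back to a constant multiple of the invariant differential. -/
theorem exists_logDer_eq_smul (X : (W'.baseChange W.toAffine.FunctionField).toAffine.Point) :
    ∃ g : k, logDer (KaehlerDifferential.D k _) (W'.baseChange W.toAffine.FunctionField) X =
      algebraMap k W.toAffine.FunctionField g •
        logDer (KaehlerDifferential.D k _) (W.baseChange _) (genPoint W) := by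
  obtain ⟨D, hDx, hDy, hD⟩ := exists_invariant_derivation W
  have hX := logDer_eq_logDer_smul (W' := W') hD
  suffices h : IsAlgebraic k (logDer D (W'.baseChange W.toAffine.FunctionField) X) by
    obtain ⟨g, hg⟩ := exists_algebraMap_eq_of_isAlgebraic h
    exact ⟨g, by rw [hX, hg]⟩
  by_contra hg
  -- A transcendental g has a pole at some place. A translation carries that place to one where x
  -- has a pole, and there logarithmic derivatives are integral.
  obtain ⟨V, hV, hVg⟩ := exists_valuation_one_lt hg
  rcases lt_or_ge 1 (V.valuation (genX W)) with hx | hx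
  · exact (val_logDer_le_one hx hDx hDy X).not_gt hVg
  obtain ⟨g, hgdef⟩ : ∃ g, g = logDer D (W'.baseChange W.toAffine.FunctionField) X := ⟨_, rfl⟩
  rw [← hgdef] at hg hVg
  have hg0 : g ≠ 0 := by rintro rfl; simp at hVg
  have ht : V.valuation g⁻¹ < 1 := by rw [map_inv₀]; exact inv_lt_one_of_one_lt₀ hVg
  obtain ⟨A, hx'⟩ := exists_one_lt_val_translation (inv_ne_zero hg0) ht hx
  have hv' : (V.valuation.comap (translation A : W.toAffine.FunctionField →+* _)).IsTrivialOn k :=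
    ⟨fun c hc => by simpa using hV.eq_one c hc⟩
  -- Writing X as the translate of X' exhibits g as the translate of the logarithmic derivative of
  -- X', to which the bound at the moved place applies.
  obtain ⟨X', hX'⟩ : ∃ X', Affine.Point.map (W' := W') (translation A) X' = X := by
    refine ⟨Affine.Point.map (W' := W') (translation (-A)) X, ?_⟩
    rw [Affine.Point.map_map, translation_comp, add_neg_cancel, translation_zero]
    cases X <;> rfl
  let v' := V.valuation.comap (translation A : W.toAffine.FunctionField →+* _)
  have hx'' : 1 < v' (genX W) := hx'
  have h1 : v' _ ≤ 1 := val_logDer_le_one hx'' hDx hDy X'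
  have h2 := logDer_map_eq_smul (hX X') (translation A)
  rw [hX', hX, map_translation_genPoint, logDer_add_pointBaseChange, ← hgdef] at h2
  have h3 := smul_left_injective _ (logDer_genPoint_ne_zero W) h2
  change V.valuation (translation A _) ≤ 1 at h1
  rw [← h3] at h1
  exact h1.not_gt hVg

/-- Translations act on points over the function field through translations. -/
lemma exists_map_translation_eq (X : (W'.baseChange W.toAffine.FunctionField).toAffine.Point)
    (A : W.toAffine.Point) : ∃ B : W'.toAffine.Point,
      Affine.Point.map (W' := W') (translation A) X = X + pointBaseChange W' _ B := by
  have : CharZero W.toAffine.FunctionField :=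
    charZero_of_injective_algebraMap (algebraMap k _).injective
  obtain ⟨g, hg⟩ := exists_logDer_eq_smul X
  have h := logDer_map_eq_smul hg (translation A)
  rw [AlgHom.commutes, map_translation_genPoint, logDer_add_pointBaseChange, ← hg] at h
  -- Translation preserves ω and the constant g, so X and its translate have the same logarithmic
  -- derivative and differ by a constant point.
  obtain ⟨B, hB⟩ := exists_pointBaseChange_of_logDer_eq_zero (Z := Affine.Point.map (W' := W')
    (translation A) X - X) (by
      rw [sub_eq_add_neg, logDer_add two_ne_zero (constCoeffs_baseChange W' _), logDer_neg, h,
        add_neg_cancel])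
  exact ⟨B, by rw [← hB, add_sub_cancel]⟩

/-- The homomorphism of groups of points attached to a morphism of elliptic curves, the morphism
being given as a point over the function field. -/
def pointHom (X : (W'.baseChange W.toAffine.FunctionField).toAffine.Point) :
    W.toAffine.Point →+ W'.toAffine.Point where
  toFun A := (exists_map_translation_eq X A).choose
  map_zero' := by
    apply pointBaseChange_injective W' (L := W.toAffine.FunctionField)
    have h := (exists_map_translation_eq X 0).choose_spec
    generalize (exists_map_translation_eq X 0).choose = B at h ⊢
    rw [translation_zero] at h
    have h' : X = X + pointBaseChange W' _ B := by
      refine Eq.trans ?_ h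
      cases X <;> rfl
    exact left_eq_add.mp h'
  map_add' A B := by
    apply pointBaseChange_injective W' (L := W.toAffine.FunctionField)
    have h := (exists_map_translation_eq X (A + B)).choose_spec
    have hA := (exists_map_translation_eq X A).choose_spec
    have hB := (exists_map_translation_eq X B).choose_spec
    generalize (exists_map_translation_eq X (A + B)).choose = A₁ at h ⊢
    generalize (exists_map_translation_eq X A).choose = A₂ at hA ⊢
    generalize (exists_map_translation_eq X B).choose = A₃ at hB ⊢
    apply add_left_cancel (a := X)
    rw [← h, ← translation_comp, ← Affine.Point.map_map, hB, map_add, hA, map_pointBaseChange,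
      pointBaseChange_add, add_assoc]

lemma map_translation (X : (W'.baseChange W.toAffine.FunctionField).toAffine.Point)
    (A : W.toAffine.Point) : Affine.Point.map (W' := W') (translation A) X =
      X + pointBaseChange W' _ (pointHom X A) :=
  (exists_map_translation_eq X A).choose_spec

end Translation

/-! ### The kernel of the homomorphism of points attached to an isogeny -/

section Kernel

variable {k : Type u} [Field k] {W : WeierstrassCurve k} [W.IsElliptic] [IsAlgClosed k]
  [CharZero k] {W' : WeierstrassCurve k} [W'.IsElliptic] {M : Type u} [Field M]
  [Algebra k M] [DecidableEq k] [DecidableEq W.toAffine.FunctionField] [DecidableEq M]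

omit [DecidableEq M] in
lemma mem_ker_pointHom {X : (W'.baseChange W.toAffine.FunctionField).toAffine.Point}
    {A : W.toAffine.Point} : A ∈ (pointHom X).ker ↔
      Affine.Point.map (W' := W') (translation A) X = X := by
  rw [map_translation, add_eq_left, AddMonoidHom.mem_ker]
  constructor
  · intro h; rw [h]; rfl
  · intro h; exact pointBaseChange_injective W' h

/-- Both embeddings send X to the same point, and the pullback factor g is a nonzero constant, so
the images of the generic point have equal logarithmic derivatives. They differ by a constant point
A, so σ is i after translation by A, and A fixes X. -/
lemma exists_mem_ker_pointHom {x y : W.toAffine.FunctionField}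
    {h : (W'.baseChange W.toAffine.FunctionField).toAffine.Nonsingular x y}
    (hx : Transcendental k x) {i σ : W.toAffine.FunctionField →ₐ[k] M}
    (hσ : Affine.Point.map (W' := W') σ (.some x y h) = Affine.Point.map (W' := W') i (.some x y
        h)) :
    ∃ A ∈ (pointHom (.some x y h)).ker, σ = i.comp (translation A) := by
  have : CharZero M := charZero_of_injective_algebraMap (algebraMap k M).injective
  obtain ⟨g, hg⟩ := exists_logDer_eq_smul (.some x y h)
  have hg0 : algebraMap k M g ≠ 0 := by
    rw [Ne, map_eq_zero_iff _ (algebraMap k M).injective]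
    rintro rfl
    rw [map_zero, zero_smul] at hg
    exact logDer_ne_zero (constCoeffs_baseChange W' _) h hx hg
  have h1 := logDer_map_eq_smul hg σ
  have h2 := logDer_map_eq_smul hg i
  rw [hσ, h2, AlgHom.commutes, AlgHom.commutes] at h1
  have h3 := smul_right_injective _ hg0 h1
  obtain ⟨A, hA⟩ := exists_pointBaseChange_of_logDer_eq_zero (Z := Affine.Point.map (W' := W)
    σ (genPoint W) - Affine.Point.map (W' := W) i (genPoint W)) (by
      rw [sub_eq_add_neg, logDer_add two_ne_zero (constCoeffs_baseChange W _), logDer_neg, ← h3,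
        add_neg_cancel])
  have e : σ = i.comp (translation A) := by
    apply algHom_ext_genPoint
    rw [← Affine.Point.map_map, map_translation_genPoint, map_add, map_pointBaseChange, ← hA,
      add_sub_cancel]
  refine ⟨A, mem_ker_pointHom.mpr ?_, e⟩
  apply Affine.Point.map_injective (W' := W') i
  rw [Affine.Point.map_map, ← e, hσ]

end Kernel

/-! ### Function fields and isogenies under extension of constants -/

section ScalarExtension

variable {L C : Type u} [Field L] [Field C] [Algebra L C] {E' E : WeierstrassCurve L}

lemma equation_map {M F : Type*} [Field M] [Field F] [Algebra L M] [Algebra C F] {r : M →+* F}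
    (hr : r.comp (algebraMap L M) = (algebraMap C F).comp (algebraMap L C)) {x y : M}
    (h : (E.baseChange M).toAffine.Equation x y) :
    ((E.baseChange C).baseChange F).toAffine.Equation (r x) (r y) := by
  have e : (E.baseChange M).map r = (E.baseChange C).baseChange F := by
    rw [baseChange, WeierstrassCurve.map_map, hr, ← WeierstrassCurve.map_map]
    rfl
  rw [← e]
  exact h.map r

lemma mem_subfield_functionField {S : Subfield E.toAffine.FunctionField}
    (hc : ∀ c : L, algebraMap L _ c ∈ S) (hx : genX E ∈ S) (hy : genY E ∈ S)
    (z : E.toAffine.FunctionField) : z ∈ S := by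
  have hp (p : L[X]) : aeval (genX E) p ∈ S := by
    rw [aeval_eq_sum_range]
    refine sum_mem fun i _ => ?_
    rw [Algebra.smul_def]
    exact mul_mem (hc _) (pow_mem hx _)
  have ha (a : E.toAffine.CoordinateRing) :
      algebraMap _ E.toAffine.FunctionField a ∈ S := by
    obtain ⟨p, q, -, e⟩ := exists_eq_algebraMap a
    rw [e]
    exact add_mem (hp p) (mul_mem (hp q) hy)
  obtain ⟨a, b, -, rfl⟩ := IsFractionRing.div_surjective (A := E.toAffine.CoordinateRing) z
  exact div_mem (ha a) (ha b)

variable (C E') in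
/-- The inclusion of the function field of a curve over `L` into that of the curve over `C`. -/
def functionFieldMap : E'.toAffine.FunctionField →+* (E'.baseChange C).toAffine.FunctionField :=
  evalHom E' ((algebraMap C _).comp (algebraMap L C)) (genX _) (genY _) (by
    rw [← WeierstrassCurve.map_map]; exact generic_equation) fun p hp => by
    rw [← eval₂_map, ← aeval_def] at hp
    exact (Polynomial.map_eq_zero _).mp (transcendental_iff.mp transcendental_genX _ hp)

lemma functionFieldMap_genX : functionFieldMap C E' (genX E') = genX _ := evalHom_genX _ _

lemma functionFieldMap_genY : functionFieldMap C E' (genY E') = genY _ := evalHom_genY _ _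

lemma functionFieldMap_algebraMap (c : L) :
    functionFieldMap C E' (algebraMap L _ c) = algebraMap C _ (algebraMap L C c) :=
  evalHom_algebraMap _ _ c

variable (φ : Isogeny E' E)

lemma functionFieldMap_comp_pullback (c : L) :
    functionFieldMap C E' (φ.pullback (algebraMap L _ c)) = algebraMap C _ (algebraMap L C c) := by
  rw [AlgHom.commutes, functionFieldMap_algebraMap]

variable (C) in
lemma isogenyPoint_nonsingular [E.IsElliptic] : ((E.baseChange C).baseChange
    (E'.baseChange C).toAffine.FunctionField).toAffine.Nonsingular
      (functionFieldMap C E' (φ.pullback (genX E)))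
      (functionFieldMap C E' (φ.pullback (genY E))) := by
  obtain ⟨r, hr⟩ : ∃ r : E.toAffine.FunctionField →+* (E'.baseChange C).toAffine.FunctionField,
      ∀ z, r z = functionFieldMap C E' (φ.pullback z) :=
    ⟨(functionFieldMap C E').comp φ.pullback.toRingHom, fun _ => rfl⟩
  rw [← hr, ← hr]
  have hg : (E.baseChange E.toAffine.FunctionField).toAffine.Equation (genX E) (genY E) :=
    generic_equation
  have h := equation_map (E := E) (C := C) (M := E.toAffine.FunctionField) (r := r)
    (RingHom.ext fun c => (hr _).trans (functionFieldMap_comp_pullback φ c)) hg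
  exact Affine.equation_iff_nonsingular.mp h

variable (C) in
/-- An isogeny as a point over the function field. -/
def isogenyPoint [E.IsElliptic] :
    ((E.baseChange C).baseChange (E'.baseChange C).toAffine.FunctionField).toAffine.Point :=
  .some _ _ (isogenyPoint_nonsingular C φ)

section

variable {Γ : Type*} [LinearOrderedCommGroupWithZero Γ]
  {v : Valuation (E'.baseChange C).toAffine.FunctionField Γ} [hv : v.IsTrivialOn C]

lemma isTrivialOn_comap_functionFieldMap : (v.comap (functionFieldMap C E')).IsTrivialOn L :=
  ⟨fun c hc => by
    rw [Valuation.comap_apply, functionFieldMap_algebraMap]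
    exact hv.eq_one _ (by simpa using hc)⟩

/-- The function 1/x vanishes at the origin, so its pullback does too, because the isogeny preserves
origins. -/
lemma one_lt_val_pullback_genX (hx : 1 < v (genX _)) :
    1 < v (functionFieldMap C E' (φ.pullback (genX E))) := by
  have := isTrivialOn_comap_functionFieldMap (v := v)
  have hx' : 1 < v.comap (functionFieldMap C E') (genX E') := by
    rwa [Valuation.comap_apply, functionFieldMap_genX]
  obtain ⟨V, hV, hVx⟩ := exists_valuation_one_lt (transcendental_genX (W := E))
  have h1 : HasValueAt E .zero (genX E)⁻¹ 0 := by
    rw [hasValueAt_zero_iff hVx, map_zero, sub_zero, map_inv₀]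
    exact inv_lt_one_of_one_lt₀ hVx
  have h2 := φ.sends_zero _ _ h1
  rw [hasValueAt_zero_iff hx', map_zero, sub_zero, Valuation.comap_apply, map_inv₀, map_inv₀,
    map_inv₀] at h2
  have h0 : v (functionFieldMap C E' (φ.pullback (genX E))) ≠ 0 := by
    rw [v.ne_zero_iff]
    intro h0
    have h3 : genX E = 0 := by simpa using h0
    exact transcendental_genX (W := E) (by rw [h3]; exact isAlgebraic_zero)
  exact (inv_lt_one₀ (zero_lt_iff.mpr h0)).mp h2

end

variable (C) in
lemma transcendental_pullback_genX :
    Transcendental C (functionFieldMap C E' (φ.pullback (genX E))) := by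
  obtain ⟨V, hV, hVx⟩ := exists_valuation_one_lt (transcendental_genX (W := E'.baseChange C))
  have h := one_lt_val_pullback_genX (v := V.valuation) φ hVx
  refine Valuation.transcendental_of_ne_one (v := V.valuation) C _ ?_ h.ne'
  rintro h0
  rw [h0, map_zero] at h
  exact not_lt_zero h

end ScalarExtension

/-- In characteristic 0 the extension is separable, so its degree counts the embeddings into Ω over
the image of φ. The embeddings are kept as ring homomorphisms so that Ω needs no fixed algebra
structure. -/
lemma natCard_eq_finrank_of_bijective {L M₁ M₂ Ω S : Type*} [Field L] [CharZero L] [Field M₁]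
    [Field M₂] [Algebra L M₁] [Algebra L M₂] [Field Ω] [IsAlgClosed Ω] {r : M₁ →+* Ω}
    (φ : M₂ →ₐ[L] M₁) (hd : Module.finrank φ.fieldRange M₁ ≠ 0) (f : S → M₁ →+* Ω)
    (hf : ∀ s z, f s (φ z) = r (φ z)) (hinj : Function.Injective f)
    (hsurj : ∀ σ : M₁ →+* Ω, (∀ z, σ (φ z) = r (φ z)) → ∃ s, f s = σ) :
    Nat.card S = Module.finrank φ.fieldRange M₁ := by
  let _ : Algebra φ.fieldRange Ω := (r.comp (algebraMap φ.fieldRange M₁)).toAlgebra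
  have hmap (z : φ.fieldRange) : algebraMap φ.fieldRange Ω z = r z := rfl
  have : FiniteDimensional φ.fieldRange M₁ :=
    Module.finite_of_finrank_pos (Nat.pos_of_ne_zero hd)
  have : CharZero φ.fieldRange :=
    charZero_of_injective_algebraMap (algebraMap L φ.fieldRange).injective
  rw [← AlgHom.natCard_of_splits φ.fieldRange M₁ Ω fun _ => IsAlgClosed.splits _]
  refine Nat.card_eq_of_bijective (fun s => ({ f s with
    commutes' := by rintro ⟨_, z, rfl⟩; exact hf s z } : M₁ →ₐ[φ.fieldRange] Ω))
    ⟨fun s t hst => hinj ?_, fun σ => ?_⟩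
  · exact congrArg (fun σ : M₁ →ₐ[φ.fieldRange] Ω => (σ : M₁ →+* Ω)) hst
  · obtain ⟨s, hs⟩ := hsurj σ fun z => σ.commutes ⟨_, z, rfl⟩
    exact ⟨s, AlgHom.ext fun z => DFunLike.congr_fun hs z⟩

lemma exists_ringHom_comp {k M₁ M₂ M₃ : Type*} [Field k] [Field M₁] [Field M₂] [Field M₃]
    [Algebra k M₂] [Algebra k M₃] (j : M₁ →+* M₂) (i : M₂ →ₐ[k] M₃) :
    ∃ ρ : M₁ →+* M₃, ∀ z, ρ z = i (j z) :=
  ⟨(i : M₂ →+* M₃).comp j, fun _ => rfl⟩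

lemma exists_ringHom_comp_comp {k M₁ M₂ M₃ : Type*} [Field k] [Field M₁] [Field M₂] [Field M₃]
    [Algebra k M₂] [Algebra k M₃] (j : M₁ →+* M₂) (τ : M₂ →ₐ[k] M₂) (i : M₂ →ₐ[k] M₃) :
    ∃ ρ : M₁ →+* M₃, ∀ z, ρ z = i (τ (j z)) :=
  ⟨((i.comp τ : M₂ →ₐ[k] M₃) : M₂ →+* M₃).comp j, fun _ => rfl⟩

/-! ### Counting the kernel by embeddings of the function field -/

section IsogenyKernel

variable {L C : Type u} [Field L] [Field C] [Algebra L C] [IsAlgClosed C] [CharZero C]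
  {E' E : WeierstrassCurve L} [E'.IsElliptic] [E.IsElliptic] (φ : Isogeny E' E) [DecidableEq C]
  [DecidableEq (E'.baseChange C).toAffine.FunctionField]

omit [IsAlgClosed C] [CharZero C] [E'.IsElliptic] [E.IsElliptic] [DecidableEq C]
  [DecidableEq (E'.baseChange C).toAffine.FunctionField] in
lemma algHom_pullback_eq {F : Type*} [Field F] [Algebra C F] {j : E'.toAffine.FunctionField →+* F}
    (hj : ∀ c, j (algebraMap L _ c) = algebraMap C F (algebraMap L C c)) (τ : F →ₐ[C] F)
    (hx : τ (j (φ.pullback (genX E))) = j (φ.pullback (genX E)))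
    (hy : τ (j (φ.pullback (genY E))) = j (φ.pullback (genY E))) (z : E.toAffine.FunctionField) :
    τ (j (φ.pullback z)) = j (φ.pullback z) := by
  have := functionField_hom_ext (W := E) (g₁ := τ.toRingHom.comp (j.comp φ.pullback.toRingHom))
    (g₂ := j.comp φ.pullback.toRingHom) (fun c => ?_) hx hy
  · exact DFunLike.congr_fun this z
  · change τ (j (φ.pullback (algebraMap L _ c))) = j (φ.pullback (algebraMap L _ c))
    rw [AlgHom.commutes, hj, AlgHom.commutes]

variable {φ} in
lemma translation_pullback {A : (E'.baseChange C).toAffine.Point}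
    (hA : A ∈ (pointHom (isogenyPoint C φ)).ker) (z : E.toAffine.FunctionField) :
    translation A (functionFieldMap C E' (φ.pullback z)) =
      functionFieldMap C E' (φ.pullback z) := by
  have h := mem_ker_pointHom.mp hA
  rw [isogenyPoint, Affine.Point.map_some, Affine.Point.some.injEq] at h
  exact algHom_pullback_eq φ functionFieldMap_algebraMap _ h.1 h.2 z

omit [CharZero C] in
lemma translation_injective {A B : (E'.baseChange C).toAffine.Point}
    (h : ∀ z, translation A (functionFieldMap C E' z) = translation B (functionFieldMap C E' z)) :
    A = B := by
  have h1 := h (genX E')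
  have h2 := h (genY E')
  rw [functionFieldMap_genX] at h1
  rw [functionFieldMap_genY] at h2
  have e : translation A = translation B := functionField_algHom_ext h1 h2
  have hA := map_translation_genPoint A
  rw [e, map_translation_genPoint] at hA
  exact (pointBaseChange_injective _ (add_left_cancel hA)).symm

variable {M : Type u} [Field M] [Algebra C M]

omit [CharZero C] [E.IsElliptic] [DecidableEq C]
  [DecidableEq (E'.baseChange C).toAffine.FunctionField] in
-- It suffices that σ(x) be transcendental over C. If it were algebraic, σ would map the whole
-- function field of E' into C, including the pullback of x, which is transcendental.
lemma exists_extension {i : (E'.baseChange C).toAffine.FunctionField →ₐ[C] M}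
    {σ : E'.toAffine.FunctionField →+* M}
    (hσ : ∀ z, σ (φ.pullback z) = i (functionFieldMap C E' (φ.pullback z))) :
    ∃ σ' : (E'.baseChange C).toAffine.FunctionField →ₐ[C] M,
      ∀ z, σ' (functionFieldMap C E' z) = σ z := by
  have hc (c : L) : σ (algebraMap L _ c) = algebraMap C M (algebraMap L C c) := by
    rw [← φ.pullback.commutes, hσ, functionFieldMap_comp_pullback, AlgHom.commutes]
  have hg : (E'.baseChange E'.toAffine.FunctionField).toAffine.Equation (genX E') (genY E') :=
    generic_equation
  have hE : ((E'.baseChange C).baseChange M).toAffine.Equation (σ (genX E')) (σ (genY E')) :=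
    equation_map (E := E') (C := C) (M := E'.toAffine.FunctionField) (r := σ)
      (RingHom.ext fun c => hc c) hg
  have hx : Transcendental C (σ (genX E')) := by
    intro hx
    obtain ⟨a, b, -, ha, hb⟩ := exists_const_of_isAlgebraic
      (Affine.equation_iff_nonsingular.mp hE) hx
    have key := mem_subfield_functionField (E := E')
      (S := (algebraMap C M).fieldRange.comap σ) (fun c => ⟨_, (hc c).symm⟩) ⟨a, ha⟩ ⟨b, hb⟩
      (φ.pullback (genX E))
    obtain ⟨c, hc⟩ := key
    rw [hσ, ← i.commutes] at hc
    refine transcendental_pullback_genX C φ ?_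
    rw [← i.injective hc]
    exact isAlgebraic_algebraMap c
  refine ⟨evalAlgHom (E'.baseChange C) hE hx, fun z => ?_⟩
  obtain ⟨r, hr⟩ : ∃ r : E'.toAffine.FunctionField →+* M,
      ∀ z, r z = evalAlgHom (E'.baseChange C) hE hx (functionFieldMap C E' z) :=
    ⟨(evalAlgHom (E'.baseChange C) hE hx).toRingHom.comp (functionFieldMap C E'), fun _ => rfl⟩
  rw [← hr]
  refine DFunLike.congr_fun (functionField_hom_ext (fun c => ?_) ?_ ?_) z
  · rw [hr, hc, functionFieldMap_algebraMap, AlgHom.commutes]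
  · rw [hr, functionFieldMap_genX, evalAlgHom_genX]
  · rw [hr, functionFieldMap_genY, evalAlgHom_genY]

lemma exists_mem_ker_of_ringHom [DecidableEq M]
    {i : (E'.baseChange C).toAffine.FunctionField →ₐ[C] M} {σ : E'.toAffine.FunctionField →+* M}
    (hσ : ∀ z, σ (φ.pullback z) = i (functionFieldMap C E' (φ.pullback z))) :
    ∃ A ∈ (pointHom (isogenyPoint C φ)).ker,
      ∀ z, σ z = i (translation A (functionFieldMap C E' z)) := by
  obtain ⟨σ', hσ'⟩ := exists_extension φ hσ
  obtain ⟨A, hA, e⟩ := exists_mem_ker_pointHom (h := isogenyPoint_nonsingular C φ)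
    (transcendental_pullback_genX C φ) (i := i) (σ := σ') (by
      rw [Affine.Point.map_some, Affine.Point.map_some]
      simp only [hσ', hσ])
  refine ⟨A, hA, fun z => ?_⟩
  rw [← hσ', e]
  rfl

/-- The kernel of an isogeny has as many points as the degree says. -/
theorem natCard_ker_pointHom (hd : φ.degree ≠ 0) :
    Nat.card (pointHom (isogenyPoint C φ)).ker = φ.degree := by
  classical
  have : CharZero L := (algebraMap L C).charZero
  obtain ⟨M, _, _, _, ⟨i⟩⟩ : ∃ (M : Type u) (_ : Field M) (_ : IsAlgClosed M) (_ : Algebra C M),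
      Nonempty ((E'.baseChange C).toAffine.FunctionField →ₐ[C] M) :=
    ⟨AlgebraicClosure (E'.baseChange C).toAffine.FunctionField, inferInstance, inferInstance,
      inferInstance, ⟨IsScalarTower.toAlgHom _ _ _⟩⟩
  obtain ⟨r, hr⟩ : ∃ r : E'.toAffine.FunctionField →+* M, ∀ z, r z = i (functionFieldMap C E' z) :=
    exists_ringHom_comp _ _
  have key (A : (E'.baseChange C).toAffine.Point) : ∃ ρ : E'.toAffine.FunctionField →+* M,
      ∀ z, ρ z = i (translation A (functionFieldMap C E' z)) :=
    exists_ringHom_comp_comp _ _ _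
  choose ρ hρ using key
  refine natCard_eq_finrank_of_bijective (r := r) φ.pullback hd
    -- A kernel point A corresponds to the embedding i after translation by A, restricted to the
    -- function field over L.
    (fun A : (pointHom (isogenyPoint C φ)).ker => ρ A.1) (fun A z => ?_)
    (fun A B hAB => ?_) fun σ hσ => ?_
  · rw [hρ, hr, translation_pullback A.2]
  · refine Subtype.ext (translation_injective fun z => i.injective ?_)
    change i _ = i _
    rw [← hρ, ← hρ]
    exact DFunLike.congr_fun hAB z
  · obtain ⟨A, hA, e⟩ := exists_mem_ker_of_ringHom φ (i := i) (σ := σ) fun z => by rw [hσ, hr]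
    exact ⟨⟨A, hA⟩, RingHom.ext fun z => by rw [hρ, e]⟩

end IsogenyKernel

/-! ### The homomorphism of points attached to an isogeny sends points as the isogeny does -/

section

variable {k : Type u} [Field k] {W : WeierstrassCurve k} [W.IsElliptic] [IsAlgClosed k]
  [DecidableEq k] [DecidableEq W.toAffine.FunctionField]
  {Γ : Type*} [LinearOrderedCommGroupWithZero Γ] {v : Valuation W.toAffine.FunctionField Γ}
  [hv : v.IsTrivialOn k]

omit [W.IsElliptic] [IsAlgClosed k] [DecidableEq k] [DecidableEq W.toAffine.FunctionField] in
lemma eq_of_val_sub_lt {f : W.toAffine.FunctionField} {a b : k} (ha : v (f - algebraMap k _ a) < 1)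
    (hb : v (f - algebraMap k _ b) < 1) : a = b := by
  by_contra hab
  have h := v.map_sub_lt ha hb
  rw [sub_sub_sub_cancel_left, ← map_sub, hv.eq_one _ (sub_ne_zero.mpr (Ne.symm hab))] at h
  exact lt_irrefl _ h

omit [W.IsElliptic] [IsAlgClosed k] [DecidableEq k] in
lemma add_pointBaseChange_reducesTo {W' : WeierstrassCurve k}
    {X : (W'.baseChange W.toAffine.FunctionField).toAffine.Point} (hX : HasPole v X) {a b : k}
    (h : W'.toAffine.Nonsingular a b) :
    ReducesTo v (X + pointBaseChange W' _ (.some a b h)) (algebraMap k _ a) (algebraMap k _ b) :=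
  hX.add_reducesTo (integralCoeffs_baseChange W') _ (val_le_one_of_isTrivialOn a)
    (val_le_one_of_isTrivialOn b)

lemma val_translation_genX_sub_lt (hx : 1 < v (genX W)) {a b : k} (h : W.toAffine.Nonsingular a b) :
    v (translation (.some a b h) (genX W) - algebraMap k _ a) < 1 ∧
      v (translation (.some a b h) (genY W) - algebraMap k _ b) < 1 := by
  have hP : HasPole v (genPoint W) := ⟨_, _, _, rfl, hx⟩
  obtain ⟨x, y, h', e, h1, h2⟩ := add_pointBaseChange_reducesTo hP h
  have hτ := map_translation_genPoint (.some a b h)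
  rw [e] at hτ
  rw [(Affine.Point.some.inj hτ).1, (Affine.Point.some.inj hτ).2]
  exact ⟨h1, h2⟩

variable [CharZero k] {W' : WeierstrassCurve k} [W'.IsElliptic]

/-- The translate of X by A is X plus the image of A. Where X has a pole this sum reduces to the
image of A, which is therefore read off from the residues of the translated coordinates. -/
lemma pointHom_eq_some {x y : W.toAffine.FunctionField}
    {h : (W'.baseChange W.toAffine.FunctionField).toAffine.Nonsingular x y} (hx : 1 < v x)
    {A : W.toAffine.Point} {c d : k} (h' : W'.toAffine.Nonsingular c d)
    (hc : v (translation A x - algebraMap k _ c) < 1)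
    (hd : v (translation A y - algebraMap k _ d) < 1) :
    pointHom (.some x y h) A = .some c d h' := by
  have e := map_translation (.some x y h) A
  rw [Affine.Point.map_some] at e
  generalize pointHom (.some x y h) A = B at e ⊢
  cases B with
  | zero =>
    have e' := (Affine.Point.some.inj (e.trans (add_zero _))).1
    rw [e'] at hc
    have := v.map_sub_lt (hc.trans hx) (lt_of_le_of_lt (val_le_one_of_isTrivialOn (-c)) hx)
    rw [map_neg, sub_neg_eq_add, sub_add_cancel] at this
    exact absurd this (lt_irrefl _)
  | some c' d' hB =>
    obtain ⟨x₁, y₁, h₁, e₁, hc', hd'⟩ := add_pointBaseChange_reducesTo (v := v)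
      (X := .some x y h) ⟨_, _, _, rfl, hx⟩ hB
    rw [e₁] at e
    rw [← (Affine.Point.some.inj e).1] at hc'
    rw [← (Affine.Point.some.inj e).2] at hd'
    cases eq_of_val_sub_lt hc hc'
    cases eq_of_val_sub_lt hd hd'
    rfl

end

section

variable {L C : Type u} [Field L] [Field C] [Algebra L C] [IsAlgClosed C] [CharZero C]
  {E' E : WeierstrassCurve L} [E'.IsElliptic] [E.IsElliptic] (φ : Isogeny E' E) [DecidableEq C]
  [DecidableEq (E'.baseChange C).toAffine.FunctionField]

omit [IsAlgClosed C] [CharZero C] [E'.IsElliptic] [DecidableEq C]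
  [DecidableEq (E'.baseChange C).toAffine.FunctionField] in
lemma HasValueAt.val_map_sub_lt {a b : L} {hR : E'.toAffine.Nonsingular a b}
    (σ : E'.toAffine.FunctionField →+* (E'.baseChange C).toAffine.FunctionField)
    {Γ : Type*} [LinearOrderedCommGroupWithZero Γ]
    {v : Valuation (E'.baseChange C).toAffine.FunctionField Γ} [hv : v.IsTrivialOn C]
    (hσ : ∀ c, σ (algebraMap L _ c) = algebraMap C _ (algebraMap L C c))
    (hx : v (σ (genX E') - algebraMap C _ (algebraMap L C a)) < 1)
    (hy : v (σ (genY E') - algebraMap C _ (algebraMap L C b)) < 1)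
    {f : E'.toAffine.FunctionField} {c : L} (hf : HasValueAt E' (.some a b hR) f c) :
    v (σ f - algebraMap C _ (algebraMap L C c)) < 1 := by
  have hv' : (v.comap σ).IsTrivialOn L := ⟨fun c hc => by
    rw [Valuation.comap_apply, hσ]
    exact hv.eq_one _ (by simpa using hc)⟩
  have := hf.val_sub_lt (v := v.comap σ) (by rwa [Valuation.comap_apply, map_sub, hσ])
    (by rwa [Valuation.comap_apply, map_sub, hσ])
  rwa [Valuation.comap_apply, map_sub, hσ] at this

/-- The homomorphism of points attached to an isogeny sends points as the isogeny does. -/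
theorem pointHom_isogenyPoint_of_sends {R : E'.toAffine.Point} {c d : L}
    {h : E.toAffine.Nonsingular c d} (hs : Sends φ.pullback R (.some c d h)) :
    pointHom (isogenyPoint C φ) (pointBaseChange E' C R) =
      pointBaseChange E C (.some c d h) := by
  obtain ⟨V, hV, hVx⟩ := exists_valuation_one_lt (transcendental_genX (W := E'.baseChange C))
  have hp := one_lt_val_pullback_genX (v := V.valuation) φ hVx
  have h1 := hs _ _ HasValueAt.coordX
  have h2 := hs _ _ HasValueAt.coordY
  cases R with
  -- The pullback of x has a pole at the origin, so it cannot take the finite value c there.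
  | zero =>
    have := isTrivialOn_comap_functionFieldMap (v := V.valuation)
    have hx' : 1 < V.valuation.comap (functionFieldMap C E') (genX E') := by
      rwa [Valuation.comap_apply, functionFieldMap_genX]
    rw [hasValueAt_zero_iff hx', Valuation.comap_apply, map_sub, functionFieldMap_algebraMap] at h1
    have := V.valuation.map_sub_lt (h1.trans hp)
      (lt_of_le_of_lt (val_le_one_of_isTrivialOn (-algebraMap L C c)) hp)
    rw [map_neg, sub_neg_eq_add, sub_add_cancel] at this
    exact absurd this (lt_irrefl _)
  | some a b hR =>
    -- Composed with the translation by R, the place at infinity becomes a place centred at R, and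
    -- values at R become residues.
    obtain ⟨σ, hσ⟩ := exists_ringHom_comp (functionFieldMap C E')
      (translation (pointBaseChange E' C (.some a b hR)))
    have hσc (c : L) : σ (algebraMap L _ c) = algebraMap C _ (algebraMap L C c) := by
      rw [hσ, functionFieldMap_algebraMap, AlgHom.commutes]
    obtain ⟨t1, t2⟩ := val_translation_genX_sub_lt (v := V.valuation) hVx
      ((Affine.map_nonsingular E'.toAffine (algebraMap L C).injective a b).mpr hR)
    rw [← functionFieldMap_genX] at t1
    rw [← functionFieldMap_genY] at t2
    have key {f : E'.toAffine.FunctionField} {c : L} (hf : HasValueAt E' (.some a b hR) f c) :=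
      HasValueAt.val_map_sub_lt (v := V.valuation) σ hσc (by rw [hσ]; exact t1)
        (by rw [hσ]; exact t2) hf
    have k1 := key h1
    have k2 := key h2
    rw [hσ] at k1 k2
    exact pointHom_eq_some (v := V.valuation) hp _ k1 k2

end

/-! ### Galois equivariance of the homomorphism of points attached to an isogeny -/

section

variable {L C : Type u} [Field L] [Field C] [Algebra L C] [DecidableEq C]

lemma _root_.WeierstrassCurve.Affine.Point.some_eq_some {F : Type*} [Field F]
    {W : WeierstrassCurve F} {x y x' y' : F} {h : W.toAffine.Nonsingular x y}
    {h' : W.toAffine.Nonsingular x' y'} (hx : x = x') (hy : y = y') :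
    Affine.Point.some x y h = Affine.Point.some x' y' h' := by
  subst hx hy; rfl

/-- Semilinear maps act on points. -/
lemma exists_semilinear_pointMap (E : WeierstrassCurve L) (σ : C →ₐ[L] C) {M : Type u} [Field M]
    [Algebra C M] [DecidableEq M] (θ : M →+* M) (hθ : ∀ c, θ (algebraMap C M c) = algebraMap C M (σ
        c)) :
    ∃ T : ((E.baseChange C).baseChange M).toAffine.Point →+
        ((E.baseChange C).baseChange M).toAffine.Point,
      (∀ x y h, ∃ h', T (.some x y h) = .some (θ x) (θ y) h') ∧
        ∀ P, T (pointBaseChange (E.baseChange C) M P) =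
          pointBaseChange (E.baseChange C) M (Affine.Point.map (W' := E) σ P) := by
  -- With this structure the twice base-changed curve is the base change of E from L to M, and θ is
  -- L-linear, so functoriality of points applies.
  let _ : Algebra L M := ((algebraMap C M).comp (algebraMap L C)).toAlgebra
  let θ' : M →ₐ[L] M := { θ with
    commutes' c := (hθ _).trans (congrArg _ (σ.commutes c)) }
  have hT (x y : M) (h : (E.baseChange M).toAffine.Nonsingular x y) :=
    Affine.Point.map_some (W' := E) θ' h
  refine ⟨Affine.Point.map (W' := E) θ', fun x y h => ⟨_, hT x y h⟩, fun P => ?_⟩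
  cases P with
  | zero => rfl
  | some a b h =>
    have e : Affine.Point.map (W' := E) σ (.some a b h) = .some (σ a) (σ b) _ :=
      Affine.Point.map_some (W' := E) σ h
    rw [e]
    refine (hT _ _ _).trans ?_
    simp only [pointBaseChange]
    exact Affine.Point.some_eq_some (hθ a) (hθ b)

omit [DecidableEq C] in
-- The curve is defined over L, so σ can act on the constants while fixing both coordinates.
lemma exists_semilinear_functionField (E : WeierstrassCurve L) (σ : C →ₐ[L] C) :
    ∃ θ : (E.baseChange C).toAffine.FunctionField →+* (E.baseChange C).toAffine.FunctionField,
      (∀ c, θ (algebraMap C _ c) = algebraMap C _ (σ c)) ∧ θ (genX _) = genX _ ∧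
        θ (genY _) = genY _ := by
  have hσ : (E.baseChange C).map (σ : C →+* C) = E.baseChange C := by
    rw [baseChange, WeierstrassCurve.map_map, AlgHom.comp_algebraMap]
  have h : ((E.baseChange C).map ((algebraMap C (E.baseChange C).toAffine.FunctionField).comp
      (σ : C →+* C))).toAffine.Equation (genX _) (genY _) := by
    rw [← WeierstrassCurve.map_map, hσ]; exact generic_equation
  have hp (p : C[X]) (hp : p.eval₂ ((algebraMap C (E.baseChange C).toAffine.FunctionField).comp
      (σ : C →+* C)) (genX (E.baseChange C)) = 0) : p = 0 := by
    rw [← eval₂_map, ← aeval_def] at hp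
    exact (Polynomial.map_eq_zero _).mp (transcendental_iff.mp transcendental_genX _ hp)
  exact ⟨evalHom _ _ _ _ h hp, evalHom_algebraMap h hp, evalHom_genX h hp, evalHom_genY h hp⟩

variable [IsAlgClosed C] [CharZero C]
  {E' E : WeierstrassCurve L} [E'.IsElliptic] [E.IsElliptic] (φ : Isogeny E' E)
  [DecidableEq (E'.baseChange C).toAffine.FunctionField]

/-- The homomorphism of points attached to an isogeny commutes with the Galois action. -/
theorem pointHom_isogenyPoint_map (σ : C →ₐ[L] C) (A : (E'.baseChange C).toAffine.Point) :
    pointHom (isogenyPoint C φ) (Affine.Point.map (W' := E') σ A) =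
      Affine.Point.map (W' := E) σ (pointHom (isogenyPoint C φ) A) := by
  obtain ⟨θ, hc, hx, hy⟩ := exists_semilinear_functionField E' σ
  obtain ⟨T', hT', hT'c⟩ := exists_semilinear_pointMap E' σ θ hc
  obtain ⟨T, hT, hTc⟩ := exists_semilinear_pointMap E σ θ hc
  have hj (z : E'.toAffine.FunctionField) :
      θ (functionFieldMap C E' z) = functionFieldMap C E' z := by
    have := functionField_hom_ext (g₁ := θ.comp (functionFieldMap C E'))
      (g₂ := functionFieldMap C E') (fun c => ?_) ?_ ?_
    · exact DFunLike.congr_fun this z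
    · rw [RingHom.comp_apply, functionFieldMap_algebraMap, hc, σ.commutes]
    · rw [RingHom.comp_apply, functionFieldMap_genX, hx]
    · rw [RingHom.comp_apply, functionFieldMap_genY, hy]
  obtain ⟨B, hB⟩ : ∃ B, B = Affine.Point.map (W' := E') σ A := ⟨_, rfl⟩
  -- The semilinear map fixes the generic point and acts by σ on constant points, so it carries the
  -- translation by A to the translation by σ(A). The point X is fixed as well, being defined over
  -- L, and comparing the translates of X gives equivariance.
  have hτ : Affine.Point.map (W' := E'.baseChange C) (translation B) (genPoint (E'.baseChange C)) =
      T' (Affine.Point.map (W' := E'.baseChange C) (translation A) (genPoint (E'.baseChange C))) :=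
          by
    have hgen : T' (genPoint (E'.baseChange C)) = genPoint (E'.baseChange C) := by
      obtain ⟨h, e⟩ := hT' _ _ (Affine.equation_iff_nonsingular.mp generic_equation)
      exact e.trans (Affine.Point.some_eq_some hx hy)
    rw [map_translation_genPoint, map_translation_genPoint, map_add, hgen, hT'c, hB]
  have hθτ (z : E'.toAffine.FunctionField) :
      translation B (functionFieldMap C E' z) = θ (translation A (functionFieldMap C E' z)) := by
    obtain ⟨g₁, h₁⟩ := exists_ringHom_comp (functionFieldMap C E') (translation B)
    obtain ⟨g₂, h₂⟩ := exists_ringHom_comp (functionFieldMap C E') (translation A)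
    rw [genPoint, Affine.Point.map_some, Affine.Point.map_some] at hτ
    obtain ⟨h', e⟩ := hT' _ _ _
    have hτ' := hτ.trans e
    rw [← h₁, ← h₂]
    have := functionField_hom_ext (g₁ := g₁) (g₂ := θ.comp g₂) (fun c => ?_) ?_ ?_
    · exact DFunLike.congr_fun this z
    · rw [RingHom.comp_apply, h₁, h₂, functionFieldMap_algebraMap, AlgHom.commutes,
        AlgHom.commutes, hc, σ.commutes]
    · rw [RingHom.comp_apply, h₁, h₂, functionFieldMap_genX]
      exact (Affine.Point.some.inj hτ').1
    · rw [RingHom.comp_apply, h₁, h₂, functionFieldMap_genY]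
      exact (Affine.Point.some.inj hτ').2
  have hX : T (isogenyPoint C φ) = isogenyPoint C φ := by
    obtain ⟨h, e⟩ := hT _ _ (isogenyPoint_nonsingular C φ)
    exact e.trans (Affine.Point.some_eq_some (hj _) (hj _))
  have key : Affine.Point.map (W' := E.baseChange C) (translation B) (isogenyPoint C φ) =
      T (Affine.Point.map (W' := E.baseChange C) (translation A) (isogenyPoint C φ)) := by
    rw [isogenyPoint, Affine.Point.map_some, Affine.Point.map_some]
    obtain ⟨h', e⟩ := hT _ _ _
    exact (Affine.Point.some_eq_some (hθτ _) (hθτ _)).trans e.symm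
  rw [map_translation, map_translation, map_add, hX, hTc] at key
  rw [← hB]
  exact pointBaseChange_injective _ (add_left_cancel key)

end

/-! ### A magnified point yields a factorization -/

/-- A homomorphism with kernel of order `N` maps the `N`-division points of a point, if there are
at most `N ^ 2` of these, to at most `N` points. -/
lemma ncard_image_division_le {G H : Type*} [AddCommGroup G] [AddCommGroup H] (f : G →+ H) {N : ℕ}
    (hN : Nat.card f.ker = N) (hN0 : N ≠ 0) (R : G) (hS : {A : G | N • A = R}.Finite)
    (hc : {A : G | N • A = R}.ncard ≤ N ^ 2) : (f '' {A : G | N • A = R}).ncard ≤ N := by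
  classical
  obtain ⟨S, hS'⟩ := hS.exists_finset
  have hSe : {A : G | N • A = R} = S := Set.ext fun A => (hS' A).symm
  rw [hSe, Set.ncard_coe_finset] at hc
  rw [hSe, ← Finset.coe_image, Set.ncard_coe_finset]
  have : Finite f.ker := Nat.finite_of_card_ne_zero (hN ▸ hN0)
  have : Fintype f.ker := Fintype.ofFinite _
  refine le_of_mul_le_mul_left ?_ (Nat.pos_of_ne_zero hN0)
  refine (Finset.mul_card_image_le_card (f := f) S N fun b hb => ?_).trans (hc.trans_eq (sq N))
  obtain ⟨A, hA, rfl⟩ := Finset.mem_image.mp hb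
  rw [← hN, Nat.card_eq_fintype_card, ← Finset.card_univ]
  -- The fibre through A contains the coset A + ker f, because kernel elements are killed by the
  -- order N of the kernel.
  refine Finset.card_le_card_of_injOn (fun B => A + B.1) (fun B _ => ?_) fun B _ B' _ h =>
    Subtype.ext (add_left_cancel h)
  have h1 : N • B.1 = 0 := by
    have := congrArg Subtype.val (card_nsmul_eq_zero' (x := B))
    rwa [hN] at this
  have hA' := (hS' A).mp hA
  simp only [Finset.coe_filter, Set.mem_ofPred_eq]
  refine ⟨(hS' _).mpr ?_, ?_⟩
  · simp only [Set.mem_ofPred_eq] at hA' ⊢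
    rw [nsmul_add, h1, hA', add_zero]
  · rw [map_add, AddMonoidHom.mem_ker.mp B.2, add_zero]

section

variable {L C : Type u} [Field L] [Field C] [Algebra L C] {E : WeierstrassCurve L} [E.IsElliptic]

open Classical in
/-- A point has at most `N ^ 2` many `N`-division points. -/
lemma finite_division_and_ncard_le {R : E.toAffine.Point} (hR : 2 • R ≠ 0) {N : ℕ} (hN : N ≠ 0) :
    {A : (E.baseChange C).toAffine.Point | N • A = pointBaseChange E C R}.Finite ∧
      {A : (E.baseChange C).toAffine.Point | N • A = pointBaseChange E C R}.ncard ≤ N ^ 2 := by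
  cases R with
  | zero => exact absurd (smul_zero _) hR
  | some a b h =>
    have h0 {A : (E.baseChange C).toAffine.Point}
        (hA : N • A = pointBaseChange E C (.some a b h)) : A ≠ 0 := by
      rintro rfl
      rw [smul_zero] at hA
      exact Affine.Point.some_ne_zero _ hA.symm
    have hmap : Set.MapsTo xCoord {A : (E.baseChange C).toAffine.Point |
        N • A = pointBaseChange E C (.some a b h)} ((delta E N (.some a b h)).rootSet C) := by
      intro A hA
      obtain ⟨y, h', e⟩ := exists_eq_some (h0 hA)
      rw [mem_rootSet]
      refine ⟨delta_some_ne_zero h hN, aeval_delta_of_nsmul_eq h h' ?_⟩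
      rw [← e]; exact hA
    -- Points with the same x-coordinate agree up to sign, and the negative of an N-division point
    -- of R is one of -R, which differs from R.
    have hinj : Set.InjOn xCoord {A : (E.baseChange C).toAffine.Point |
        N • A = pointBaseChange E C (.some a b h)} := by
      intro A hA B hB e
      refine (eq_or_eq_neg_of_xCoord_eq (h0 hA) (h0 hB) e).resolve_right fun e' => hR ?_
      simp only [Set.mem_ofPred_eq] at hA hB
      rw [e', smul_neg, hB, neg_eq_iff_add_eq_zero, ← two_nsmul, ← pointBaseChange_nsmul] at hA
      exact pointBaseChange_injective E hA
    have hfin := rootSet_finite (delta E N (.some a b h)) C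
    refine ⟨Set.Finite.of_injOn hmap hinj hfin, ?_⟩
    rw [← natDegree_delta_some h N]
    refine (Set.ncard_le_ncard_of_injOn _ hmap hinj hfin).trans ?_
    rw [rootSet_def, Set.ncard_coe_finset]
    exact (Multiset.toFinset_card_le _).trans
      ((card_roots' _).trans (natDegree_map_le))

open Classical in
lemma exists_nsmul_eq_pointBaseChange [IsAlgClosed C] (R : E.toAffine.Point) {N : ℕ} (hN : N ≠ 0) :
    ∃ A : (E.baseChange C).toAffine.Point, N • A = pointBaseChange E C R := by
  cases R with
  | zero => exact ⟨0, smul_zero _⟩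
  | some a b h =>
    obtain ⟨s, hs⟩ := IsAlgClosed.exists_aeval_eq_zero C (delta E N (.some a b h))
        (degree_ne_of_natDegree_ne (by
      rw [natDegree_delta_some]
      positivity))
    obtain ⟨t, ht⟩ := exists_equation (E.baseChange C) s
    rcases nsmul_eq_of_aeval_delta h (Affine.equation_iff_nonsingular.mp ht) hs with e | e
    · exact ⟨_, e⟩
    · exact ⟨_, (smul_neg _ _).trans (neg_eq_iff_eq_neg.mpr e)⟩

end

lemma natDegree_minpoly_le_finrank_mul {K L C : Type*} [Field K] [Field L] [Field C] [Algebra K L]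
    [Algebra L C] [Algebra K C] [IsScalarTower K L C] [FiniteDimensional K L] {s : C}
    (hs : IsIntegral L s) :
    (minpoly K s).natDegree ≤ Module.finrank K L * (minpoly L s).natDegree := by
  let M := IntermediateField.adjoin L {s}
  have : FiniteDimensional L M := IntermediateField.adjoin.finiteDimensional hs
  have : IsScalarTower K M C := IsScalarTower.of_algebraMap_eq fun c => by
    rw [IsScalarTower.algebraMap_apply K L C, IsScalarTower.algebraMap_apply K L M]
    rfl
  have : FiniteDimensional K M := FiniteDimensional.trans K L M
  rw [← IntermediateField.adjoin.finrank hs, Module.finrank_mul_finrank K L M,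
    ← IntermediateField.AdjoinSimple.algebraMap_gen L s,
    minpoly.algebraMap_eq (algebraMap M C).injective]
  exact minpoly.natDegree_le _

open Classical in
/-- The conjugates of an algebraic element of which all conjugates lie in `T` are at most as many
as the elements of `T`. -/
lemma natDegree_minpoly_le_ncard {L C : Type*} [Field L] [PerfectField L] [Field C] [Algebra L C]
    [IsAlgClosure L C] {s : C} {T : Set C} (hT : T.Finite) (h : ∀ σ : C →ₐ[L] C, σ s ∈ T) :
    (minpoly L s).natDegree ≤ T.ncard := by
  have : IsAlgClosed C := IsAlgClosure.isAlgClosed L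
  have : Algebra.IsAlgebraic L C := IsAlgClosure.isAlgebraic
  have : Normal L C := IsAlgClosure.normal L C
  have hs : IsIntegral L s := Algebra.IsIntegral.isIntegral s
  rw [← card_rootSet_eq_natDegree (K := C) (PerfectField.separable_of_irreducible
    (minpoly.irreducible hs)) (IsAlgClosed.splits _), ← Nat.card_eq_fintype_card]
  refine Set.ncard_le_ncard (fun x hx => ?_) hT
  obtain ⟨σ, rfl⟩ := minpoly.exists_algEquiv_of_root' hs.isAlgebraic (mem_rootSet.mp hx).2
  exact h σ

section

variable {K : Type u} [Field K] [CharZero K] {E : WeierstrassCurve K} [E.IsElliptic]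

omit [CharZero K] [E.IsElliptic] in
lemma map_delta {L : Type u} [Field L] [Algebra K L] (m : ℤ) (P : E.toAffine.Point) :
    delta (E.baseChange L) m (pointBaseChange E L P) =
      (delta E m P).map (algebraMap K L) := by
  cases P with
  | zero => exact map_ΨSq E (algebraMap K L) m
  | some a b h =>
    change (E.map (algebraMap K L)).Φ m - C (algebraMap K L a) * (E.map (algebraMap K L)).ΨSq m = _
    rw [delta_some, map_Φ, map_ΨSq, Polynomial.map_sub, Polynomial.map_mul, Polynomial.map_C]

open Classical in
-- Take A with N·A = R. Its image B satisfies N·B = P, so x(B) is a root of δ_N^P. The conjugates of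
-- B are images of N-division points of R, and at most N points arise this way, although R may have
-- N² such division points.
theorem factorizes_of_sends {a b : K} {h : E.toAffine.Nonsingular a b}
    (hP : 2 • Affine.Point.some a b h ≠ 0) {L : Type u} [Field L] [Algebra K L]
    [FiniteDimensional K L] {E' : WeierstrassCurve L} [E'.IsElliptic]
    {φ : Isogeny E' (E.baseChange L)} {R : E'.toAffine.Point}
    (hs : Sends φ.pullback R (pointBaseChange E L (.some a b h)))
    (hd : Module.finrank K L < φ.degree) :
    Factorizes (delta E φ.degree (.some a b h)) := by
  have : CharZero L := charZero_of_injective_algebraMap (algebraMap K L).injective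
  let C := AlgebraicClosure L
  have : CharZero C := charZero_of_injective_algebraMap (algebraMap L C).injective
  obtain ⟨f, hf⟩ : ∃ f, f = pointHom (isogenyPoint C φ) := ⟨_, rfl⟩
  have hN0 : φ.degree ≠ 0 := by omega
  have hN : Nat.card f.ker = φ.degree := hf ▸ natCard_ker_pointHom φ hN0
  have hfσ (σ : C →ₐ[L] C) (A : (E'.baseChange C).toAffine.Point) :
      f (Affine.Point.map (W' := E') σ A) =
        Affine.Point.map (W' := E.baseChange L) σ (f A) := hf ▸ pointHom_isogenyPoint_map φ σ A
  have hfR : f (pointBaseChange E' C R) =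
      pointBaseChange (E.baseChange L) C (pointBaseChange E L (.some a b h)) :=
    hf ▸ pointHom_isogenyPoint_of_sends φ hs
  clear hf
  -- This lets x-coordinates separate the N-division points of R, giving the bound N² on their
  -- number.
  have hR : 2 • R ≠ 0 := by
    intro hR
    apply hP
    apply pointBaseChange_injective E (L := L)
    apply pointBaseChange_injective (E.baseChange L) (L := C)
    rw [pointBaseChange_nsmul, pointBaseChange_nsmul, ← hfR, ← map_nsmul, ← pointBaseChange_nsmul,
      hR]
    exact map_zero f
  obtain ⟨hfin, hcard⟩ := finite_division_and_ncard_le (C := C) hR hN0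
  obtain ⟨A, hA⟩ := exists_nsmul_eq_pointBaseChange (C := C) R hN0
  have hB : φ.degree • f A =
      pointBaseChange (E.baseChange L) C (pointBaseChange E L (.some a b h)) := by
    rw [← map_nsmul, hA, hfR]
  have hB0 : f A ≠ 0 := by
    intro h0
    rw [h0, smul_zero] at hB
    exact Affine.Point.some_ne_zero _ hB.symm
  obtain ⟨t, ht, e⟩ := exists_eq_some hB0
  -- Galois conjugates of A over L are again N-division points of the L-rational R, and f commutes
  -- with conjugation.
  have hle : (minpoly L (xCoord (f A))).natDegree ≤ φ.degree := by
    refine (natDegree_minpoly_le_ncard (T := xCoord '' (f '' {A | φ.degree • A =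
      pointBaseChange E' C R})) ((hfin.image _).image _) fun σ => ?_).trans ?_
    · refine ⟨_, ⟨Affine.Point.map (W' := E') σ A, ?_, hfσ σ A⟩, ?_⟩
      · rw [Set.mem_ofPred_eq, ← map_nsmul, hA, map_pointBaseChange]
      · rw [e]; rfl
    · exact (Set.ncard_image_le (hfin.image _)).trans
        (ncard_image_division_le f hN hN0 _ hfin hcard)
  refine factorizes_of_root (L := C) (s := xCoord (f A)) (delta_some_ne_zero h hN0) ?_ ?_
  · rw [e] at hB
    have := aeval_delta_of_nsmul_eq (E := E.baseChange L) _ ht hB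
    have hm := map_delta (L := L) φ.degree (.some a b h)
    rw [pointBaseChange] at hm
    rwa [hm, aeval_map_algebraMap] at this
  · rw [natDegree_delta_some, sq]
    -- The degree of x(B) over K is at most [L : K]·N, which is less than N², the degree of δ_N^P.
    refine (natDegree_minpoly_le_finrank_mul (L := L) (Algebra.IsIntegral.isIntegral _)).trans_lt ?_
    exact (Nat.mul_le_mul_left _ hle).trans_lt (Nat.mul_lt_mul_of_pos_right hd (Nat.pos_of_ne_zero
        hN0))

end

end

end EllipticMagnified

theorem mainTheorem4 {K : Type u} [Field K] [PerfectField K] (E : WeierstrassCurve K)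
    [E.IsElliptic] (P : E.toAffine.Point) :
    EllipticMagnified.IsMagnified E P ↔
      ∃ m : ℤ, EllipticMagnified.Factorizes (EllipticMagnified.delta E m P) := by
  classical
  refine ⟨fun ⟨L, _, _, _, E', _, φ, R, hs, hd⟩ => ?_, fun ⟨m, hm⟩ =>
    EllipticMagnified.isMagnified_of_factorizes hm⟩
  by_cases hP : 2 • P = 0
  · exact EllipticMagnified.exists_factorizes_of_two_nsmul_eq_zero hP
  cases P with
  | zero => exact absurd (smul_zero _) hP
  | some a b h =>
    obtain ⟨p, hp⟩ := CharP.exists K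
    -- The witness is m = p in positive characteristic, where δ_p is a p-th power, and m = deg φ in
    -- characteristic 0.
    rcases CharP.char_is_prime_or_zero K p with hp' | rfl
    · have : Fact p.Prime := ⟨hp'⟩
      exact ⟨p, EllipticMagnified.factorizes_delta_char p h⟩
    · have : CharZero K := CharP.charP_to_charZero K
      exact ⟨φ.degree, EllipticMagnified.factorizes_of_sends hP hs hd⟩
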